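/- **Theorem ($\sqrt C$-Clipped SGD+WD).** There are absolute constants $\kappa>0$ and $K>0$ such that the following holds. *Setting.* Let $\nu$ be a probability distribution on a set $\Gamma$. For each $\gamma\in\Gamma$ let $L_\gamma$ be a scale invariant function on $\mathbb R^d$ (that is, $L_\gamma(cx)=L_\gamma(x)$ for $c>0$, $x\neq0$) that is $C^1$ on $\mathbb R^d\setminus\{0\}$, with $\gamma\mapsto L_\gamma(x)$ measurable and $\nu$-integrable for each $x\ne 0$. Assume that $L:=\mathbb E_{\gamma\sim\nu}L_\gamma$ is $C^2$ on $\mathbb R^d\setminus\{0\}$, and let $\rho:=\max_{\|x\|=1}\|\nabla^2L(x)\|$. Write $\overline x:=x/\|x\|$. Let $C>1$, $\eta,\lambda>0$, $x(0)\ne0$, let $\gamma_0,\gamma_1,\dots$ be i.i.d. with law $\nu$, and let $$x(t+1)=(1-\eta\lambda)x(t)-\eta N_t\frac{\nabla L_{\gamma_t}(x(t))}{\|\nabla L_{\gamma_t}(x(t))\|},\qquad N_t=\min\Big\{\sqrt{\tfrac{2C\lambda}{\eta}}\,\|x(t)\|,\ \|\nabla L_{\gamma_t}(x(t))\|\Big\}$$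 (no gradient step is made if $\nabla L_{\gamma_t}(x(t))=0$). *Assumption.* For a distribution $P$ on $[0,\infty)$ let the $C$-clipped mean $\mu_{P,C}$ be the largest $\mu\ge0$ with $\mathbb E_{s\sim P}[\min\{s,C\mu\}]=\mu$, and let $M_{P,1/C}:=\sup\{M\ge0 : \mathbb P_{s\sim P}[s\ge M]\ge 1/C\}$. Let $P_x$ be the law of $\|\nabla L_\gamma(x)\|^2$ for $\gamma\sim\nu$. Assume that $\alpha_C>0$ satisfies $$\alpha_C\,\mu_{P_x,C}\le\mathbb E_{s\sim P_x}\big[s\,\mathbf 1[s<M_{P_x,1/C}]\big]\qquad\text{for all }x\neq0,$$ and that $\mu_{\min}:=\min_{\|x\|=1}\mu_{P_x,C}>0$; let $\mu_{\max}:=\max_{\|x\|=1}\mu_{P_x,C}$. (No bound on $\sup_{\gamma}\max_{\|x\|=1}\|\nabla L_\gamma(x)\|$ is assumed.) *Conclusion.* Let $0<\delta<1$, let $T\ge 1$ be an integer with $\eta\lambda\le\kappa\min\{1,\ \alpha_C/(C\ln(T/\delta^2))\}$, let $R_0^2:=\frac{2\lambda}{\eta}\|x(0)\|^4$, and let $T'$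 be the least nonnegative integer with $$T'\ \ge\ \frac1{\alpha_C\,\eta\lambda}\Big(\max\Big\{\ln\frac{R_0^2}{\mu_{\max}},\ \ln\frac{\mu_{\min}}{R_0^2}\Big\}+K\Big).$$ If $T'<T$, then with probability at least $1-5\delta$ both of the following hold: $$\frac{\mu_{\min}}2\le\frac{2\lambda}{\eta}\|x(t)\|^4\le2\mu_{\max}\qquad\text{for all } T'\le t\le T-1,$$ $$\frac1{T-T'}\sum_{t=T'}^{T-1}\big\langle\nabla L(\overline{x(t)}),\widetilde{\nabla L}(x(t))\big\rangle\le\frac{\pi^2\rho\sqrt{\mu_{\max}}}{(T-T')\sqrt{2\eta\lambda}}+4\sqrt{\eta\lambda}\,\frac{\rho\,\mu_{\max}^{3/2}}{\mu_{\min}}+8\sqrt{\frac{\ln\frac2\delta}{T-T'}}\;\frac{\pi\rho\sqrt C\,\mu_{\max}}{\sqrt{\mu_{\min}}}+16\sqrt{\frac{\ln\frac2\delta}{T-T'}}\,\sqrt{\eta\lambda}\;\frac{C\rho\,\mu_{\max}^{3/2}}{\mu_{\min}},$$ where $\widetilde{\nabla L}(x):=\mathbb E_{\gamma\sim\nu}\Big[\nabla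 L_\gamma(\overline x)\,\min\Big\{\sqrt{\tfrac{2C\lambda}{\eta}}\,\tfrac{\|x\|^2}{\|\nabla L_\gamma(\overline x)\|},1\Big\}\Big]$. -/

import Mathlib

open MeasureTheory ProbabilityTheory

noncomputable section

/-- The direction `x / ‖x‖` of a nonzero vector. -/
def unitDir {d : ℕ} (x : EuclideanSpace ℝ (Fin d)) : EuclideanSpace ℝ (Fin d) :=
  ‖x‖⁻¹ • x

/-- The iterates of `√C`-clipped SGD with weight decay on the losses `L (γ 0), L (γ 1), …`:
with `g = ∇ L_{γ t} (x t)` and `N = min {√(2 C lam / η) ‖x t‖, ‖g‖}`,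
`x (t + 1) = (1 - η lam) x t - η N g / ‖g‖` (no gradient step if `g = 0`). -/
def clippedSGD {d : ℕ} {Γ : Type*} (L : Γ → EuclideanSpace ℝ (Fin d) → ℝ) (C η lam : ℝ)
    (x₀ : EuclideanSpace ℝ (Fin d)) (γ : ℕ → Γ) : ℕ → EuclideanSpace ℝ (Fin d)
  | 0 => x₀
  | t + 1 =>
    (1 - η * lam) • clippedSGD L C η lam x₀ γ t -
      (η * min (√(2 * C * lam / η) * ‖clippedSGD L C η lam x₀ γ t‖)
          ‖gradient (L (γ t)) (clippedSGD L C η lam x₀ γ t)‖) •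
        unitDir (gradient (L (γ t)) (clippedSGD L C η lam x₀ γ t))

/-- The `C`-clipped mean of a distribution `P` on `[0, ∞)`: the largest `μ ≥ 0` with
`E_{t ∼ P} min {t, C μ} = μ`. -/
def clippedMean (P : Measure ℝ) (C : ℝ) : ℝ :=
  sSup {μ : ℝ | 0 ≤ μ ∧ ∫ t, min t (C * μ) ∂P = μ}

/-- The `1/C`-median of a distribution `P` on `[0, ∞)`: the supremum of all `M ≥ 0` with
`P [t ≥ M] ≥ 1/C`. -/
def upperMedian (P : Measure ℝ) (C : ℝ) : ℝ :=
  sSup {M : ℝ | 0 ≤ M ∧ 1 / C ≤ P.real (Set.Ici M)}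

/-- The law `P_x` of `‖∇ L_γ (x)‖ ^ 2` for `γ ∼ ν`. -/
def sqGradLaw {d : ℕ} {Γ : Type*} [MeasurableSpace Γ] (L : Γ → EuclideanSpace ℝ (Fin d) → ℝ)
    (ν : Measure Γ) (x : EuclideanSpace ℝ (Fin d)) : Measure ℝ :=
  ν.map (fun γ => ‖gradient (L γ) x‖ ^ 2)

/-- Concentration from below with constant `α`: for every `x ≠ 0`, `α` times the `C`-clipped mean
of `P_x` is at most `E_{t ∼ P_x} [t 1{t < M}]`, where `M` is the `1/C`-median of `P_x`. -/
def ConcentratedFromBelow {d : ℕ} {Γ : Type*} [MeasurableSpace Γ]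
    (L : Γ → EuclideanSpace ℝ (Fin d) → ℝ) (ν : Measure Γ) (C α : ℝ) : Prop :=
  ∀ x : EuclideanSpace ℝ (Fin d), x ≠ 0 →
    α * clippedMean (sqGradLaw L ν x) C ≤
      ∫ t in Set.Iio (upperMedian (sqGradLaw L ν x) C), t ∂(sqGradLaw L ν x)

/-- The least `C`-clipped mean of `P_x` over the unit sphere. -/
def clippedMeanMin {d : ℕ} {Γ : Type*} [MeasurableSpace Γ]
    (L : Γ → EuclideanSpace ℝ (Fin d) → ℝ) (ν : Measure Γ) (C : ℝ) : ℝ :=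
  sInf ((fun x => clippedMean (sqGradLaw L ν x) C) ''
    Metric.sphere (0 : EuclideanSpace ℝ (Fin d)) 1)

/-- The largest `C`-clipped mean of `P_x` over the unit sphere. -/
def clippedMeanMax {d : ℕ} {Γ : Type*} [MeasurableSpace Γ]
    (L : Γ → EuclideanSpace ℝ (Fin d) → ℝ) (ν : Measure Γ) (C : ℝ) : ℝ :=
  sSup ((fun x => clippedMean (sqGradLaw L ν x) C) ''
    Metric.sphere (0 : EuclideanSpace ℝ (Fin d)) 1)

/-- The expected loss `E_γ L_γ`. -/
def meanLoss {d : ℕ} {Γ : Type*} [MeasurableSpace Γ] (L : Γ → EuclideanSpace ℝ (Fin d) → ℝ)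
    (ν : Measure Γ) (x : EuclideanSpace ℝ (Fin d)) : ℝ :=
  ∫ γ, L γ x ∂ν

/-- The largest operator norm of the Hessian of `f` over the unit sphere. -/
def sphereHessianBound {d : ℕ} (f : EuclideanSpace ℝ (Fin d) → ℝ) : ℝ :=
  sSup ((fun x => ‖fderiv ℝ (fderiv ℝ f) x‖) ''
    Metric.sphere (0 : EuclideanSpace ℝ (Fin d)) 1)

/-- The expected clipped gradient
`E_γ [∇ L_γ (x̄) min {√(2 C lam / η) ‖x‖ ^ 2 / ‖∇ L_γ (x̄)‖, 1}]`, where `x̄ = x / ‖x‖`. -/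
def expectedClippedGradient {d : ℕ} {Γ : Type*} [MeasurableSpace Γ]
    (L : Γ → EuclideanSpace ℝ (Fin d) → ℝ) (ν : Measure Γ) (C η lam : ℝ)
    (x : EuclideanSpace ℝ (Fin d)) : EuclideanSpace ℝ (Fin d) :=
  ∫ γ, (min (√(2 * C * lam / η) * ‖x‖ ^ 2 / ‖gradient (L γ) (unitDir x)‖) 1) •
    gradient (L γ) (unitDir x) ∂ν

end

/-! Write ε = ηλ and let R = √(2λ/η)‖x‖² be the effective radius. Scale invariance makes every
gradient orthogonal to x, so one step multiplies R exactly by (1-ε)² + 2εy, where y ∈ [0, C] is the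
squared clipped gradient at the unit direction divided by R². Hence log R² moves by about 4ε(y-1),
and its drift is decided by the mean of y, which is F(R²)/R² with F(m) = E min(s, Cm) under the law
of the squared gradient at that direction. The clipped mean μ is the largest fixed point of F. Since
min(s, Cm)/m is nonincreasing in m, the concentration hypothesis quantifies the crossing at μ: the
mean of y is at most 1 - α/3 once R² ≥ (3/2)μmax, and at least 1 + α/2 once R² ≤ (2/3)μmin
(`integral_min_le_sub`, `integral_min_ge_of_le_clippedMean`).

The radius bounds come from exponential Lyapunov functions exp(±θ log R²) with θ = α/(160εC). The
bound y ≤ C lets all second-order terms be dominated by affine functions of y, so these functions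
contract by exp(-αεθ) outside the band (`drift_upper`, `drift_lower`); inside it, one step cannot
leave by more than a factor 8/5. Markov's inequality at the factor 2 gives a tail of order
exp(-θ/5), and the step-size hypothesis makes θ at least 10 ln(T/δ²), enough for a union bound over
time.

The gradient bound uses the potential R(L(x) - c). Weight decay does not change L, and multiplying
the descent inequality by R gives the inner product ⟨∇L(x̄), g⟩ the constant weight √(2ε), so the
main term telescopes (`weightedLoss_step_le`). The changing weight costs 2ε(y-1)(L(x) - c), which is
controlled because L oscillates by at most πρ on the sphere. The second-order terms have mean
bounded through R²·E y ≤ max(R², μmax) (`mean_increment_le`). Azuma–Hoeffding, stopped from counting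
whenever R is too large, handles the fluctuations (`measureReal_lt_sum_le`); no uniform bound on the
individual gradients is required because clipping bounds them by √C·R. -/

theorem exp_le_one_add_add_sq {z : ℝ} (hz : |z| ≤ 1) : Real.exp z ≤ 1 + z + z ^ 2 := by
  have := Real.abs_exp_sub_one_sub_id_le hz
  have := le_abs_self (Real.exp z - 1 - z)
  linarith

theorem neg_log_one_add_le {w : ℝ} (hw : -(1 / 2) ≤ w) :
    -Real.log (1 + w) ≤ -w + 2 * w ^ 2 := by
  have h1 : 0 < 1 + w := by linarith
  have h2 := Real.one_sub_inv_le_log_of_pos h1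
  have h3 : (1 + w)⁻¹ ≤ 1 + (-w + 2 * w ^ 2) := by
    rw [inv_le_iff_one_le_mul₀ h1]
    nlinarith [mul_nonneg (sq_nonneg w) (by linarith : 0 ≤ w + 1 / 2)]
  linarith

/-- The logarithmic increment of the squared effective radius in one step, as a function of the
normalized squared clipped gradient norm `y`. -/
noncomputable def logIncrement (ε y : ℝ) : ℝ := 2 * Real.log ((1 - ε) ^ 2 + 2 * ε * y)

/-! ### Exponential estimates for one step of the log radius -/

section scalar

variable {ε C α θ y : ℝ}

theorem logIncrement_le (hε : 0 < ε) (hε1 : ε ≤ 1 / 2) (hy : 0 ≤ y) :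
    logIncrement ε y ≤ 4 * ε * (y - 1) + 2 * ε ^ 2 := by
  have h0 : 0 < (1 - ε) ^ 2 + 2 * ε * y := by
    have : 0 < 1 - ε := by linarith
    positivity
  have := Real.log_le_sub_one_of_pos h0
  unfold logIncrement
  nlinarith

/-- The quadratic error of the logarithm is made affine: y ≤ C gives (1 + y)² ≤ 3C(1 + y). Only the
mean of y is available later, so every bound of this section must be affine in y. -/
theorem neg_logIncrement_le (hε : 0 < ε) (hC : 1 < C) (hεC : 4 * (ε * C) ≤ 1)
    (hy : 0 ≤ y) (hyC : y ≤ C) :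
    -logIncrement ε y ≤ 4 * ε * ((1 - y) + 12 * (ε * C) * (1 + y)) := by
  have hε4 : 4 * ε ≤ 1 := by nlinarith
  have hw : -(1 / 2) ≤ -2 * ε + ε ^ 2 + 2 * ε * y := by nlinarith [mul_nonneg hε.le hy]
  have h := neg_log_one_add_le hw
  have e : 1 + (-2 * ε + ε ^ 2 + 2 * ε * y) = (1 - ε) ^ 2 + 2 * ε * y := by ring
  rw [e] at h
  have h2 : (-2 * ε + ε ^ 2 + 2 * ε * y) ^ 2 ≤ (2 * ε * (1 + y)) ^ 2 := by
    apply sq_le_sq'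
    · nlinarith [mul_nonneg hε.le hy]
    · nlinarith [mul_nonneg hε.le hy]
  have h3 : (1 + y) ^ 2 ≤ 3 * C * (1 + y) := by nlinarith
  have h4 : (2 * ε * (1 + y)) ^ 2 ≤ 4 * ε ^ 2 * (3 * C * (1 + y)) := by
    have : (2 * ε * (1 + y)) ^ 2 = 4 * ε ^ 2 * (1 + y) ^ 2 := by ring
    rw [this]; gcongr
  unfold logIncrement
  nlinarith

/-- Uses eᶻ ≤ 1 + z + z² with z = 4εθ(y - 1), where the condition on θ ensures |z| ≤ 1, and then (y
- 1)² ≤ Cy + 1 to stay affine in y. -/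
theorem exp_logIncrement_le (hε : 0 < ε) (hε1 : ε ≤ 1 / 2) (hC : 1 < C) (hθ : 0 ≤ θ)
    (hθC : 4 * (ε * θ * C) ≤ 1) (hy : 0 ≤ y) (hyC : y ≤ C) :
    Real.exp (θ * logIncrement ε y) ≤ Real.exp (2 * ε ^ 2 * θ) *
      (1 + 4 * (ε * θ) * (y - 1) + 16 * (ε * θ) ^ 2 * (C * y + 1)) := by
  have h1 : θ * logIncrement ε y ≤ 2 * ε ^ 2 * θ + 4 * (ε * θ) * (y - 1) := by
    have := mul_le_mul_of_nonneg_left (logIncrement_le hε hε1 hy) hθ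
    linarith
  refine (Real.exp_le_exp.2 h1).trans ?_
  rw [Real.exp_add]
  have ha : 0 ≤ ε * θ := by positivity
  gcongr
  have hz : |4 * (ε * θ) * (y - 1)| ≤ 1 := by
    rw [abs_le]
    constructor <;> nlinarith
  refine (exp_le_one_add_add_sq hz).trans ?_
  have : (4 * (ε * θ) * (y - 1)) ^ 2 = 16 * (ε * θ) ^ 2 * (y - 1) ^ 2 := by ring
  rw [this]
  gcongr
  nlinarith

/-- Here y stands for the mean of the ratio. The linear term gains (4/3)αεθ, and 160εθC = α limits
the quadratic term to a fifth of αεθ. -/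
theorem exp_logIncrement_mean_le (hε : 0 < ε) (hC : 1 < C) (hα : 0 < α)
    (hεα : 1000 * ε ≤ α) (hθ : 0 ≤ θ) (hθC : 160 * (ε * θ * C) = α) (hy : 0 ≤ y)
    (hyα : y ≤ 1 - α / 3) :
    Real.exp (2 * ε ^ 2 * θ) *
      (1 + 4 * (ε * θ) * (y - 1) + 16 * (ε * θ) ^ 2 * (C * y + 1)) ≤
      Real.exp (-(α * (ε * θ))) := by
  set a := ε * θ
  have ha : 0 ≤ a := by positivity
  -- The rate 11/10 exceeds the claimed rate 1 so that the surplus αa/10 absorbs the prefactor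
  -- exp(2ε²θ) = exp(2εa).
  have h1 : 1 + 4 * a * (y - 1) + 16 * a ^ 2 * (C * y + 1) ≤ Real.exp (-(11 / 10 * α * a)) := by
    refine le_trans ?_ (Real.add_one_le_exp _)
    have h2 : 16 * a ^ 2 * (C * y + 1) ≤ 2 / 10 * α * a := by
      have : C * y + 1 ≤ 2 * C := by nlinarith
      calc 16 * a ^ 2 * (C * y + 1) ≤ 16 * a ^ 2 * (2 * C) := by gcongr
        _ = 2 / 10 * (160 * (a * C)) * a := by ring
        _ = _ := by rw [hθC]
    nlinarith
  calc _ ≤ Real.exp (2 * ε ^ 2 * θ) * Real.exp (-(11 / 10 * α * a)) := by gcongr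
    _ = Real.exp (2 * ε * a - 11 / 10 * α * a) := by
      rw [← Real.exp_add]; congr 1; simp only [a]; ring
    _ ≤ _ := by
      apply Real.exp_le_exp.2
      nlinarith

theorem exp_neg_logIncrement_le (hε : 0 < ε) (hC : 1 < C) (hεC : 1000 * (ε * C) ≤ 1)
    (hθ : 0 ≤ θ) (hθC : 16 * (ε * θ * C) ≤ 1) (hy : 0 ≤ y) (hyC : y ≤ C) :
    Real.exp (-(θ * logIncrement ε y)) ≤
      1 + 4 * (ε * θ) * ((1 - y) + 12 * (ε * C) * (1 + y)) +
        40 * (ε * θ) ^ 2 * (C * (1 + y)) := by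
  have ha : 0 ≤ ε * θ := by positivity
  have hb : 0 ≤ ε * C := by positivity
  have h1 : -(θ * logIncrement ε y) ≤ 4 * (ε * θ) * ((1 - y) + 12 * (ε * C) * (1 + y)) := by
    have := mul_le_mul_of_nonneg_left
      (neg_logIncrement_le hε hC (by linarith) hy hyC) hθ
    linarith
  refine (Real.exp_le_exp.2 h1).trans ?_
  have hu : |(1 - y) + 12 * (ε * C) * (1 + y)| ≤ (1 + 1 / 10) * (1 + y) := by
    rw [abs_le]
    constructor <;> nlinarith [mul_nonneg hb hy]
  have hz : |4 * (ε * θ) * ((1 - y) + 12 * (ε * C) * (1 + y))| ≤ 1 := by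
    rw [abs_mul, abs_of_nonneg (by positivity)]
    calc _ ≤ 4 * (ε * θ) * ((1 + 1 / 10) * (1 + y)) := by gcongr
      _ ≤ 4 * (ε * θ) * (3 * C) := by gcongr 4 * (ε * θ) * ?_; nlinarith
      _ ≤ 1 := by nlinarith [mul_nonneg ha (by linarith : 0 ≤ C)]
  refine (exp_le_one_add_add_sq hz).trans ?_
  have hs : ((1 - y) + 12 * (ε * C) * (1 + y)) ^ 2 ≤ 5 / 2 * (C * (1 + y)) := by
    rw [← sq_abs]
    calc _ ≤ ((1 + 1 / 10) * (1 + y)) ^ 2 := by gcongr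
      _ ≤ _ := by nlinarith [mul_nonneg hy hy, mul_le_mul_of_nonneg_left hyC hy]
  nlinarith [mul_le_mul_of_nonneg_left hs (sq_nonneg (ε * θ))]

/-- Again y stands for a mean. After dividing by 4εθ, the gain is y - 1 ≥ α/2, and the two error
terms are small multiples of α(1 + y), leaving at least α/4. -/
theorem exp_neg_logIncrement_mean_le (hε : 0 < ε) (hC : 1 < C) (hα : 0 < α) (hα1 : α ≤ 1)
    (hεC : 1000 * (ε * C) ≤ α) (hθ : 0 ≤ θ) (hθC : 160 * (ε * θ * C) = α)
    (hyα : 1 + α / 2 ≤ y) :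
    1 + 4 * (ε * θ) * ((1 - y) + 12 * (ε * C) * (1 + y)) +
        40 * (ε * θ) ^ 2 * (C * (1 + y)) ≤ Real.exp (-(α * (ε * θ))) := by
  set a := ε * θ
  have ha : 0 ≤ a := by positivity
  refine le_trans ?_ (Real.add_one_le_exp _)
  have h2 : 40 * a ^ 2 * (C * (1 + y)) = 4 * a * (α / 16 * (1 + y)) := by
    rw [← hθC]; ring
  rw [h2]
  have h3 : (1 - y) + 12 * (ε * C) * (1 + y) + α / 16 * (1 + y) ≤ -(α / 4) := by
    have : 12 * (ε * C) * (1 + y) ≤ 12 * (α / 1000) * (1 + y) := by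
      gcongr
      · linarith
      · linarith
    nlinarith
  nlinarith

end scalar

/-! ### The clipped mean as the largest crossing of m ↦ E min(t, Cm) with the diagonal -/

section clippedMean

variable {P : Measure ℝ} [IsProbabilityMeasure P] {C m α : ℝ}

theorem integrable_min_const (h0 : ∀ᵐ t ∂P, 0 ≤ t) (a : ℝ) :
    Integrable (fun t => min t a) P := by
  refine Integrable.of_bound (by fun_prop) |a| ?_
  filter_upwards [h0] with t ht
  rw [Real.norm_eq_abs, abs_le]
  constructor
  · exact le_min (by linarith [abs_nonneg a]) (neg_abs_le a)
  · exact (min_le_right _ _).trans (le_abs_self a)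

theorem continuous_integral_min (h0 : ∀ᵐ t ∂P, 0 ≤ t) (C : ℝ) :
    Continuous (fun m => ∫ t, min t (C * m) ∂P) := by
  have : LipschitzWith ‖C‖₊ (fun m => ∫ t, min t (C * m) ∂P) := by
    refine LipschitzWith.of_dist_le_mul fun a b => ?_
    rw [Real.dist_eq, ← integral_sub (integrable_min_const h0 _) (integrable_min_const h0 _)]
    have key : ∀ᵐ t ∂P, ‖min t (C * a) - min t (C * b)‖ ≤ ‖C‖₊ * dist a b := ?_
    · simpa using norm_integral_le_of_norm_le_const key
    refine Filter.Eventually.of_forall fun t => ?_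
    have := abs_min_sub_min_le_max t (C * a) t (C * b)
    rw [sub_self, abs_zero, max_eq_right (abs_nonneg _), ← mul_sub, abs_mul] at this
    simpa [Real.dist_eq] using this
  exact this.continuous

theorem integral_min_mono (h0 : ∀ᵐ t ∂P, 0 ≤ t) {a b : ℝ} (hab : a ≤ b) :
    ∫ t, min t a ∂P ≤ ∫ t, min t b ∂P :=
  integral_mono (integrable_min_const h0 _) (integrable_min_const h0 _)
    fun _ => min_le_min_left _ hab

theorem exists_measureReal_Ici_lt (P : Measure ℝ) [IsProbabilityMeasure P] {c : ℝ}
    (hc : 0 < c) : ∃ A : ℝ, 0 ≤ A ∧ P.real (Set.Ici A) < c := by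
  have h := (tendsto_cdf_atTop P).eventually (lt_mem_nhds (by linarith : 1 - c < 1))
  obtain ⟨A, hA, hA0⟩ := (h.and (Filter.eventually_ge_atTop (0 : ℝ))).exists
  refine ⟨A + 1, by linarith, ?_⟩
  rw [cdf_eq_real] at hA
  have h1 : P.real (Set.Ici (A + 1)) ≤ P.real (Set.Iic A)ᶜ :=
    measureReal_mono fun x (hx : A + 1 ≤ x) => by
      simp only [Set.mem_compl_iff, Set.mem_Iic, not_le]; linarith
  rw [probReal_compl_eq_one_sub measurableSet_Iic] at h1
  linarith

/-- Cutting at a level whose tail mass is below 1/(2C) leaves slope at most 1/2 in m. So the map is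
eventually below the diagonal, which bounds the fixed points and provides the right endpoint for the
intermediate value theorem. -/
theorem exists_integral_min_le (h0 : ∀ᵐ t ∂P, 0 ≤ t) (hC : 1 < C) :
    ∃ A : ℝ, 0 ≤ A ∧ ∀ m, 0 ≤ m → ∫ t, min t (C * m) ∂P ≤ A + m / 2 := by
  obtain ⟨A, hA0, hA⟩ := exists_measureReal_Ici_lt P (c := 1 / (2 * C)) (by positivity)
  refine ⟨A, hA0, fun m hm => ?_⟩
  have hi : Integrable ((Set.Ici A).indicator fun _ : ℝ => C * m) P :=
    (integrable_const _).indicator measurableSet_Ici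
  calc ∫ t, min t (C * m) ∂P ≤ ∫ t, (A + (Set.Ici A).indicator (fun _ => C * m) t) ∂P := by
        refine integral_mono (integrable_min_const h0 _) ((integrable_const _).add hi) fun t => ?_
        by_cases ht : A ≤ t
        · simp only [Set.indicator, Set.mem_Ici, ht, if_true]
          linarith [min_le_right t (C * m)]
        · simp only [Set.indicator, Set.mem_Ici, ht, if_false]
          linarith [min_le_left t (C * m)]
    _ = A + P.real (Set.Ici A) * (C * m) := by
        rw [integral_add (integrable_const _) hi, integral_indicator_const _ measurableSet_Ici]
        simp
    _ ≤ A + 1 / (2 * C) * (C * m) := by gcongr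
    _ = A + m / 2 := by field_simp

theorem bddAbove_fixedPoints (h0 : ∀ᵐ t ∂P, 0 ≤ t) (hC : 1 < C) :
    BddAbove {μ : ℝ | 0 ≤ μ ∧ ∫ t, min t (C * μ) ∂P = μ} := by
  obtain ⟨A, _, hA⟩ := exists_integral_min_le h0 hC
  refine ⟨2 * A, fun μ ⟨hμ, h⟩ => ?_⟩
  have := hA μ hμ
  linarith

theorem clippedMean_mem (h0 : ∀ᵐ t ∂P, 0 ≤ t) (hC : 1 < C) :
    0 ≤ clippedMean P C ∧ ∫ t, min t (C * clippedMean P C) ∂P = clippedMean P C := by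
  have hne : {μ : ℝ | 0 ≤ μ ∧ ∫ t, min t (C * μ) ∂P = μ}.Nonempty := by
    refine ⟨0, le_rfl, ?_⟩
    rw [mul_zero]
    apply integral_eq_zero_of_ae
    filter_upwards [h0] with t ht using min_eq_right ht
  have hcl : IsClosed {μ : ℝ | 0 ≤ μ ∧ ∫ t, min t (C * μ) ∂P = μ} :=
    (isClosed_le continuous_const continuous_id).inter
      (isClosed_eq (continuous_integral_min h0 C) continuous_id)
  exact hcl.csSup_mem hne (bddAbove_fixedPoints h0 hC)

/-- The map is on or above the diagonal at m and below it far out, so some fixed point lies to the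
right of m. -/
theorem le_clippedMean (h0 : ∀ᵐ t ∂P, 0 ≤ t) (hC : 1 < C) (hm : 0 ≤ m)
    (h : m ≤ ∫ t, min t (C * m) ∂P) : m ≤ clippedMean P C := by
  obtain ⟨A, hA0, hA⟩ := exists_integral_min_le h0 hC
  set B := max m (2 * A)
  have hB : ∫ t, min t (C * B) ∂P ≤ B := by
    have := hA B (hm.trans (le_max_left _ _))
    have : 2 * A ≤ B := le_max_right _ _
    linarith
  obtain ⟨μ, hμ, hμ'⟩ := exists_mem_Icc_isFixedPt (f := fun m => ∫ t, min t (C * m) ∂P)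
    (continuous_integral_min h0 C).continuousOn (le_max_left m (2 * A)) h hB
  exact hμ.1.trans (le_csSup (bddAbove_fixedPoints h0 hC) ⟨hm.trans hμ.1, hμ'⟩)

/-- The supremum is attained: a closed half-line is the decreasing intersection of slightly larger
ones, and the measure is continuous along it. -/
theorem upperMedian_spec (P : Measure ℝ) [IsProbabilityMeasure P] (h0 : ∀ᵐ t ∂P, 0 ≤ t)
    (hC : 1 < C) :
    0 ≤ upperMedian P C ∧ 1 / C ≤ P.real (Set.Ici (upperMedian P C)) := by
  have hC0 : 0 < 1 / C := by positivity
  obtain ⟨A, hA0, hA⟩ := exists_measureReal_Ici_lt P hC0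
  have hbdd : BddAbove {M : ℝ | 0 ≤ M ∧ 1 / C ≤ P.real (Set.Ici M)} := by
    refine ⟨A, fun M ⟨_, h⟩ => ?_⟩
    by_contra! hlt
    have : P.real (Set.Ici M) ≤ P.real (Set.Ici A) :=
      measureReal_mono (Set.Ici_subset_Ici.2 hlt.le)
    linarith
  have hne : (0 : ℝ) ∈ {M : ℝ | 0 ≤ M ∧ 1 / C ≤ P.real (Set.Ici M)} := by
    refine ⟨le_rfl, ?_⟩
    have : P.real (Set.Ici 0) = 1 := by
      rw [measureReal_def, (mem_ae_iff_prob_eq_one measurableSet_Ici).1 h0, ENNReal.toReal_one]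
    rw [this, div_le_one (by linarith)]; exact hC.le
  refine ⟨le_csSup hbdd hne, ?_⟩
  have hlim : Filter.Tendsto (fun n : ℕ => P.real (Set.Ici (upperMedian P C - 1 / (n + 1 : ℝ))))
      Filter.atTop (nhds (P.real (Set.Ici (upperMedian P C)))) := by
    have heq : Set.Ici (upperMedian P C) =
        ⋂ n : ℕ, Set.Ici (upperMedian P C - 1 / (n + 1 : ℝ)) := by
      ext x
      simp only [Set.mem_Ici, Set.mem_iInter]
      constructor
      · intro h n
        have : (0 : ℝ) < 1 / (n + 1 : ℝ) := by positivity
        linarith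
      · intro h
        have hx : Filter.Tendsto (fun n : ℕ => x + 1 / ((n : ℝ) + 1)) Filter.atTop
            (nhds (x + 0)) :=
          tendsto_const_nhds.add tendsto_one_div_add_atTop_nhds_zero_nat
        have := ge_of_tendsto' hx fun n => (by linarith [h n] : upperMedian P C ≤ _)
        simpa using this
    have ht : Filter.Tendsto (fun n : ℕ => P (Set.Ici (upperMedian P C - 1 / (n + 1 : ℝ))))
        Filter.atTop (nhds (P (Set.Ici (upperMedian P C)))) := by
      rw [heq]
      refine tendsto_measure_iInter_atTop (fun n => measurableSet_Ici.nullMeasurableSet) ?_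
        ⟨0, measure_ne_top _ _⟩
      intro a b hab
      apply Set.Ici_subset_Ici.2
      gcongr
    exact (ENNReal.tendsto_toReal (measure_ne_top _ _)).comp ht
  refine ge_of_tendsto' hlim fun n => ?_
  have hpos : (0 : ℝ) < 1 / (n + 1 : ℝ) := by positivity
  obtain ⟨M, hM, hlt⟩ := exists_lt_of_lt_csSup ⟨0, hne⟩
    (sub_lt_self (upperMedian P C) hpos)
  exact hM.2.trans (measureReal_mono (Set.Ici_subset_Ici.2 hlt.le))

/-- Since min(t, Cm)/m is nonincreasing in m, the right side is nonnegative; for t < M ≤ Ca both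
minima equal t and the right side is exactly (b - a)t. -/
theorem sub_mul_le_of_upperMedian_le {a b t M : ℝ} (hC : 1 < C) (ha : 0 ≤ a) (hab : a ≤ b)
    (hM : M ≤ C * a) (ht : 0 ≤ t) :
    (b - a) * (Set.Iio M).indicator id t ≤ b * min t (C * a) - a * min t (C * b) := by
  have hb : 0 ≤ b := ha.trans hab
  by_cases h : t < M
  · have h1 : t ≤ C * a := by linarith
    have h2 : t ≤ C * b := h1.trans (by gcongr)
    simp only [Set.indicator, Set.mem_Iio, h, if_true, min_eq_left h1, min_eq_left h2, id]
    linarith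
  · simp only [Set.indicator, Set.mem_Iio, h, if_false, mul_zero]
    rcases le_total t (C * a) with h1 | h1
    · rw [min_eq_left h1]
      have := min_le_left t (C * b)
      nlinarith [mul_le_mul_of_nonneg_left this ha, mul_le_mul_of_nonneg_right hab ht]
    · rw [min_eq_right h1]
      have := mul_le_mul_of_nonneg_left (min_le_right t (C * b)) ha
      linarith

theorem integrable_indicator_Iio (h0 : ∀ᵐ t ∂P, 0 ≤ t) (M : ℝ) :
    Integrable ((Set.Iio M).indicator id) P := by
  refine Integrable.of_bound (by fun_prop (disch := exact measurableSet_Iio)) |M| ?_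
  filter_upwards [h0] with t ht
  by_cases h : t < M
  · simp only [Set.indicator, Set.mem_Iio, h, if_true, id, Real.norm_eq_abs, abs_of_nonneg ht]
    exact h.le.trans (le_abs_self M)
  · simp [Set.indicator, h]

theorem integral_min_sub_ge (h0 : ∀ᵐ t ∂P, 0 ≤ t) {a b M : ℝ} (hC : 1 < C) (ha : 0 ≤ a)
    (hab : a ≤ b) (hM : M ≤ C * a) :
    (b - a) * ∫ t in Set.Iio M, t ∂P ≤
      b * ∫ t, min t (C * a) ∂P - a * ∫ t, min t (C * b) ∂P := by
  have hi := integrable_indicator_Iio h0 M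
  have h1 := integrable_min_const h0 (C * a)
  have h2 := integrable_min_const h0 (C * b)
  have e : ∫ t in Set.Iio M, t ∂P = ∫ t, (Set.Iio M).indicator id t ∂P := by
    rw [integral_indicator measurableSet_Iio]; rfl
  rw [e, ← integral_const_mul, ← integral_const_mul, ← integral_const_mul,
    ← integral_sub (h1.const_mul _) (h2.const_mul _)]
  refine integral_mono_ae (hi.const_mul _) ((h1.const_mul _).sub (h2.const_mul _)) ?_
  filter_upwards [h0] with t ht using sub_mul_le_of_upperMedian_le hC ha hab hM ht

/-- The function min(·, Cm) is concave, so on [0, M] it lies above its chord of slope Cm/M, and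
beyond M it equals Cm. The mass at least 1/C beyond M produces the summand M. -/
theorem mul_integral_min_ge_of_lt (h0 : ∀ᵐ t ∂P, 0 ≤ t) {M : ℝ} (hC : 1 < C) (hm : 0 ≤ m)
    (hM : C * m ≤ M) (hP : 1 / C ≤ P.real (Set.Ici M)) :
    m * (C * ∫ t in Set.Iio M, t ∂P + M) ≤ M * ∫ t, min t (C * m) ∂P := by
  have hi := integrable_indicator_Iio h0 M
  have h1 := integrable_min_const h0 (C * m)
  have hj : Integrable ((Set.Ici M).indicator fun _ : ℝ => M) P :=
    (integrable_const _).indicator measurableSet_Ici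
  have e : ∫ t in Set.Iio M, t ∂P = ∫ t, (Set.Iio M).indicator id t ∂P := by
    rw [integral_indicator measurableSet_Iio]; rfl
  have hCm : 0 ≤ C * m := by positivity
  have hM0 : 0 ≤ M := hCm.trans hM
  calc m * (C * ∫ t in Set.Iio M, t ∂P + M)
      ≤ C * m * (∫ t in Set.Iio M, t ∂P + P.real (Set.Ici M) * M) := by
        have : M ≤ C * (P.real (Set.Ici M) * M) := by
          have : 1 ≤ C * P.real (Set.Ici M) := by
            rw [div_le_iff₀ (by linarith)] at hP; linarith
          nlinarith
        nlinarith
    _ = ∫ t, C * m * ((Set.Iio M).indicator id t + (Set.Ici M).indicator (fun _ => M) t) ∂P := by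
        rw [e, integral_const_mul, integral_add hi hj,
          integral_indicator_const _ measurableSet_Ici, smul_eq_mul]
    _ ≤ ∫ t, M * min t (C * m) ∂P := by
        refine integral_mono_ae ((hi.add hj).const_mul _) (h1.const_mul _) ?_
        filter_upwards [h0] with t ht
        by_cases h : t < M
        · simp only [Set.indicator, Set.mem_Iio, Set.mem_Ici, h, if_true, not_le.2 h, if_false,
            id, add_zero]
          rcases le_total t (C * m) with h' | h'
          · rw [min_eq_left h']; gcongr
          · rw [min_eq_right h']; nlinarith
        · simp only [Set.indicator, Set.mem_Iio, Set.mem_Ici, h, if_false, not_lt.1 h, if_true]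
          rw [min_eq_right (hM.trans (not_lt.1 h))]
          linarith
    _ = _ := integral_const_mul _ _

/-- At m = M/C the mass beyond M alone already puts the map on or above the diagonal. -/
theorem upperMedian_le (h0 : ∀ᵐ t ∂P, 0 ≤ t) (hC : 1 < C) :
    upperMedian P C ≤ C * clippedMean P C := by
  obtain ⟨hM0, hM⟩ := upperMedian_spec P h0 hC
  set M := upperMedian P C
  have hC0 : 0 < C := by linarith
  rcases hM0.eq_or_lt with h | hMpos
  · rw [← h]
    exact mul_nonneg hC0.le (clippedMean_mem h0 hC).1
  have h := mul_integral_min_ge_of_lt h0 (m := M / C) hC (by positivity)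
    (by rw [mul_div_cancel₀ _ hC0.ne']) hM
  have he : 0 ≤ ∫ t in Set.Iio M, t ∂P := by
    apply integral_nonneg_of_ae
    exact ae_restrict_of_ae h0
  have h2 : M / C ≤ ∫ t, min t (C * (M / C)) ∂P := by
    refine le_of_mul_le_mul_left ?_ hMpos
    refine le_trans ?_ h
    have : 0 ≤ M / C * (C * ∫ t in Set.Iio M, t ∂P) := by positivity
    nlinarith
  have := le_clippedMean h0 hC (by positivity) h2
  rw [div_le_iff₀ hC0] at this
  linarith

/-- The restoring force from above: compare the levels μ and m, use that μ is a fixed point, and let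
the concentration hypothesis bound the part of the law below the median. That part is not clipped at
either level because the median is at most Cμ. -/
theorem integral_min_le_sub (h0 : ∀ᵐ t ∂P, 0 ≤ t) (hC : 1 < C) (hμ : 0 < clippedMean P C)
    (hα : α * clippedMean P C ≤ ∫ t in Set.Iio (upperMedian P C), t ∂P)
    (hm : clippedMean P C ≤ m) :
    ∫ t, min t (C * m) ∂P ≤ m - α * (m - clippedMean P C) := by
  have h := integral_min_sub_ge h0 hC hμ.le hm (upperMedian_le h0 hC)
  rw [(clippedMean_mem h0 hC).2] at h
  have h2 := mul_le_mul_of_nonneg_left hα (by linarith : 0 ≤ m - clippedMean P C)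
  refine le_of_mul_le_mul_left ?_ hμ
  linarith

/-- The restoring force from below, in two regimes. If Cm has passed the median, the comparison with
the fixed point gives m + α(μ - m), and μ - m ≥ m/2. If not, the chord bound applies, and the median
being at most Cμ turns the concentration hypothesis into the stronger factor 1 + α. -/
theorem integral_min_ge_of_le_clippedMean (h0 : ∀ᵐ t ∂P, 0 ≤ t) (hC : 1 < C) (h0α : 0 ≤ α)
    (hμ : 0 < clippedMean P C)
    (hα : α * clippedMean P C ≤ ∫ t in Set.Iio (upperMedian P C), t ∂P)
    (hm0 : 0 < m) (hm : 3 / 2 * m ≤ clippedMean P C) :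
    m * (1 + α / 2) ≤ ∫ t, min t (C * m) ∂P := by
  have hC0 : 0 < C := by linarith
  rcases le_total (upperMedian P C) (C * m) with hM | hM
  · have h := integral_min_sub_ge h0 hC hm0.le (by linarith) hM (b := clippedMean P C)
    rw [(clippedMean_mem h0 hC).2] at h
    have h2 := mul_le_mul_of_nonneg_left hα (by linarith : 0 ≤ clippedMean P C - m)
    refine le_of_mul_le_mul_left ?_ hμ
    have h3 : 0 ≤ α * clippedMean P C * (clippedMean P C - 3 / 2 * m) :=
      mul_nonneg (by positivity) (by linarith)
    nlinarith
  · have h := mul_integral_min_ge_of_lt h0 hC hm0.le hM (upperMedian_spec P h0 hC).2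
    have hMpos : 0 < upperMedian P C := lt_of_lt_of_le (by positivity) hM
    have hle := upperMedian_le h0 hC
    refine le_of_mul_le_mul_left ?_ hMpos
    refine le_trans ?_ h
    have h3 : α * upperMedian P C ≤ C * ∫ t in Set.Iio (upperMedian P C), t ∂P :=
      calc α * upperMedian P C ≤ α * (C * clippedMean P C) := by gcongr
        _ = C * (α * clippedMean P C) := by ring
        _ ≤ _ := by gcongr
    have h4 : 0 ≤ α * upperMedian P C := by positivity
    nlinarith [mul_le_mul_of_nonneg_left h3 hm0.le, mul_nonneg hm0.le h4]

/-- Doubling the level μ cannot lower the clipped expectation, while concentration caps it at 2μ -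
αμ. -/
theorem concentration_le_one (h0 : ∀ᵐ t ∂P, 0 ≤ t) (hC : 1 < C)
    (hμ : 0 < clippedMean P C)
    (hα : α * clippedMean P C ≤ ∫ t in Set.Iio (upperMedian P C), t ∂P) : α ≤ 1 := by
  have h := integral_min_sub_ge h0 (a := clippedMean P C) (b := 2 * clippedMean P C) hC hμ.le
    (by linarith) (upperMedian_le h0 hC)
  rw [(clippedMean_mem h0 hC).2] at h
  have h2 := integral_min_mono h0 (a := C * clippedMean P C) (b := C * (2 * clippedMean P C))
    (by gcongr; linarith)
  rw [(clippedMean_mem h0 hC).2] at h2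
  have h3 : 2 * clippedMean P C - clippedMean P C = clippedMean P C := by ring
  rw [h3] at h
  have h4 : clippedMean P C * (α * clippedMean P C) ≤ clippedMean P C * (1 * clippedMean P C) := by
    nlinarith
  exact le_of_mul_le_mul_right (le_of_mul_le_mul_left h4 hμ) hμ

theorem integral_min_le_max (h0 : ∀ᵐ t ∂P, 0 ≤ t) (hC : 1 < C) (h0α : 0 ≤ α)
    (hμ : 0 < clippedMean P C)
    (hα : α * clippedMean P C ≤ ∫ t in Set.Iio (upperMedian P C), t ∂P) (m : ℝ) :
    ∫ t, min t (C * m) ∂P ≤ max m (clippedMean P C) := by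
  rcases le_total (clippedMean P C) m with h | h
  · have := integral_min_le_sub h0 hC hμ hα h
    refine le_trans ?_ (le_max_left _ _)
    nlinarith [mul_nonneg h0α (sub_nonneg.2 h)]
  · refine le_trans ?_ (le_max_right _ _)
    conv_rhs => rw [← (clippedMean_mem h0 hC).2]
    exact integral_min_mono h0 (by gcongr)

end clippedMean

/-- Invariance of a function under positive rescaling of its nonzero argument. -/
def ScaleInvariant {E F : Type*} [AddCommGroup E] [Module ℝ E] (f : E → F) : Prop :=
  ∀ c : ℝ, 0 < c → ∀ x, x ≠ 0 → f (c • x) = f x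

/-! ### Calculus of scale-invariant functions -/

section scaleInvariant

variable {E : Type*} [NormedAddCommGroup E] [InnerProductSpace ℝ E] {f : E → ℝ} {x u : E}
  {c ρ : ℝ}

theorem ScaleInvariant.fderiv_smul (hf : ScaleInvariant f) (hc : 0 < c) (hx : x ≠ 0) :
    fderiv ℝ f (c • x) = c⁻¹ • fderiv ℝ f x := by
  have h : (f <| c • ·) =ᶠ[nhds x] f := by
    filter_upwards [isOpen_compl_singleton.mem_nhds hx] with y hy using hf c hc y hy
  rw [← h.fderiv_eq, fderiv_comp_smul, smul_smul, inv_mul_cancel₀ hc.ne', one_smul]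

theorem ScaleInvariant.fderiv_fderiv_smul (hf : ScaleInvariant f) (hc : 0 < c) (hx : x ≠ 0) :
    fderiv ℝ (fderiv ℝ f) (c • x) = (c⁻¹ * c⁻¹) • fderiv ℝ (fderiv ℝ f) x := by
  have h : (fderiv ℝ f <| c • ·) =ᶠ[nhds x] c⁻¹ • fderiv ℝ f := by
    filter_upwards [isOpen_compl_singleton.mem_nhds hx] with y hy using hf.fderiv_smul hc hy
  have h2 := h.fderiv_eq (𝕜 := ℝ)
  rw [fderiv_const_smul_field (𝕜 := ℝ) (R := ℝ) (F := E →L[ℝ] ℝ) c⁻¹] at h2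
  have h3 : c⁻¹ • fderiv ℝ (fderiv ℝ f) x = c • fderiv ℝ (fderiv ℝ f) (c • x) :=
    h2.symm.trans (fderiv_comp_smul c)
  rw [← smul_smul, h3, smul_smul, inv_mul_cancel₀ hc.ne', one_smul]

theorem ScaleInvariant.fderiv_apply_self (hf : ScaleInvariant f) (hx : x ≠ 0)
    (hd : DifferentiableAt ℝ f x) : fderiv ℝ f x x = 0 := by
  have h1 : HasDerivAt (fun s : ℝ => f (s • x)) (fderiv ℝ f x x) 1 := by
    have hs : HasDerivAt (fun s : ℝ => s • x) ((1 : ℝ) • x) 1 := (hasDerivAt_id 1).smul_const x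
    rw [one_smul] at hs
    have hd' : HasFDerivAt f (fderiv ℝ f x) ((1 : ℝ) • x) := by
      rw [one_smul]; exact hd.hasFDerivAt
    exact hd'.comp_hasDerivAt 1 hs
  have h2 : (fun s : ℝ => f (s • x)) =ᶠ[nhds 1] fun _ => f x := by
    filter_upwards [lt_mem_nhds (zero_lt_one' ℝ)] with s hs using hf s hs x hx
  exact h1.unique ((hasDerivAt_const (1 : ℝ) (f x)).congr_of_eventuallyEq h2)

/-- Euler's identity for the derivative, which is homogeneous of degree -1: differentiate s ↦ s⁻¹ •
Df(x) at s = 1. -/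
theorem ScaleInvariant.fderiv_fderiv_apply_self (hf : ScaleInvariant f) (hx : x ≠ 0)
    (hd : DifferentiableAt ℝ (fderiv ℝ f) x) :
    fderiv ℝ (fderiv ℝ f) x x = -fderiv ℝ f x := by
  have h1 : HasDerivAt (fun s : ℝ => fderiv ℝ f (s • x)) (fderiv ℝ (fderiv ℝ f) x x) 1 := by
    have hs : HasDerivAt (fun s : ℝ => s • x) ((1 : ℝ) • x) 1 := (hasDerivAt_id 1).smul_const x
    rw [one_smul] at hs
    have hd' : HasFDerivAt (fderiv ℝ f) (fderiv ℝ (fderiv ℝ f) x) ((1 : ℝ) • x) := by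
      rw [one_smul]; exact hd.hasFDerivAt
    exact hd'.comp_hasDerivAt 1 hs
  have h2 : (fun s : ℝ => fderiv ℝ f (s • x)) =ᶠ[nhds 1] fun s => s⁻¹ • fderiv ℝ f x := by
    filter_upwards [lt_mem_nhds (zero_lt_one' ℝ)] with s hs using hf.fderiv_smul hs hx
  have h3 : HasDerivAt (fun s : ℝ => s⁻¹ • fderiv ℝ f x) (-fderiv ℝ f x) 1 := by
    have := (hasDerivAt_inv (one_ne_zero' ℝ)).smul_const (fderiv ℝ f x)
    simpa using this
  exact h1.unique (h3.congr_of_eventuallyEq h2)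

theorem ContDiffOn.differentiableAt_off_zero {n : WithTop ℕ∞} (h : ContDiffOn ℝ n f {0}ᶜ)
    (hn : n ≠ 0) (hx : x ≠ 0) : DifferentiableAt ℝ f x :=
  (h.contDiffAt (isOpen_compl_singleton.mem_nhds hx)).differentiableAt hn

theorem ContDiffOn.fderiv_off_zero (h : ContDiffOn ℝ 2 f {0}ᶜ) :
    ContDiffOn ℝ 1 (fderiv ℝ f) {0}ᶜ :=
  h.fderiv_of_isOpen isOpen_compl_singleton (by norm_num)

theorem ContDiffOn.differentiableAt_fderiv_off_zero (h : ContDiffOn ℝ 2 f {0}ᶜ) (hx : x ≠ 0) :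
    DifferentiableAt ℝ (fderiv ℝ f) x :=
  (h.fderiv_off_zero.contDiffAt (isOpen_compl_singleton.mem_nhds hx)).differentiableAt one_ne_zero

theorem norm_smul_unit_eq (hx : x ≠ 0) : ‖(‖x‖⁻¹ • x : E)‖ = 1 := by
  rw [norm_smul, norm_inv, norm_norm, inv_mul_cancel₀ (norm_ne_zero_iff.2 hx)]

set_option maxSynthPendingDepth 3 in
theorem ScaleInvariant.norm_fderiv_fderiv_le (hf : ScaleInvariant f)
    (hρ : ∀ z : E, ‖z‖ = 1 → ‖fderiv ℝ (fderiv ℝ f) z‖ ≤ ρ) (hx : x ≠ 0) :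
    ‖fderiv ℝ (fderiv ℝ f) x‖ ≤ ρ / ‖x‖ ^ 2 := by
  have hpos : 0 < ‖x‖ := norm_pos_iff.2 hx
  have h := hρ _ (norm_smul_unit_eq hx)
  rw [hf.fderiv_fderiv_smul (inv_pos.2 hpos) hx, inv_inv, norm_smul, norm_mul,
    norm_norm] at h
  rw [le_div_iff₀ (by positivity)]
  linarith

/-- Euler's identity expresses the gradient as minus the Hessian applied to x, so the Hessian bound
on the sphere controls first derivatives too. -/
theorem ScaleInvariant.norm_fderiv_le (hf : ScaleInvariant f) (h2 : ContDiffOn ℝ 2 f {0}ᶜ)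
    (hρ : ∀ z : E, ‖z‖ = 1 → ‖fderiv ℝ (fderiv ℝ f) z‖ ≤ ρ) (hx : x ≠ 0) :
    ‖fderiv ℝ f x‖ ≤ ρ / ‖x‖ := by
  have hpos : 0 < ‖x‖ := norm_pos_iff.2 hx
  rw [← norm_neg, ← hf.fderiv_fderiv_apply_self hx (h2.differentiableAt_fderiv_off_zero hx)]
  calc _ ≤ ‖fderiv ℝ (fderiv ℝ f) x‖ * ‖x‖ := ContinuousLinearMap.le_opNorm _ _
    _ ≤ ρ / ‖x‖ ^ 2 * ‖x‖ := by gcongr; exact hf.norm_fderiv_fderiv_le hρ hx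
    _ = ρ / ‖x‖ := by field_simp

theorem norm_le_norm_add_smul_of_inner_eq_zero (hxu : inner ℝ x u = 0) (s : ℝ) :
    ‖x‖ ≤ ‖x + s • u‖ := by
  have : ‖x + s • u‖ ^ 2 = ‖x‖ ^ 2 + ‖s • u‖ ^ 2 := by
    have := norm_add_sq_eq_norm_sq_add_norm_sq_real (x := x) (y := s • u)
      (by rw [inner_smul_right, hxu, mul_zero])
    nlinarith
  refine le_of_sq_le_sq ?_ (norm_nonneg _)
  nlinarith [sq_nonneg ‖s • u‖]

theorem hasDerivAt_add_smul (x u : E) (s : ℝ) : HasDerivAt (fun s : ℝ => x + s • u) u s := by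
  simpa using ((hasDerivAt_id s).smul_const u).const_add x

theorem ScaleInvariant.abs_sub_le_of_orthogonal (hf : ScaleInvariant f)
    (h2 : ContDiffOn ℝ 2 f {0}ᶜ) (hρ : ∀ z : E, ‖z‖ = 1 → ‖fderiv ℝ (fderiv ℝ f) z‖ ≤ ρ)
    (hρ0 : 0 ≤ ρ) (hx : x ≠ 0) (hxu : inner ℝ x u = 0) :
    |f (x + u) - f x| ≤ ρ / ‖x‖ * ‖u‖ := by
  have hpos : 0 < ‖x‖ := norm_pos_iff.2 hx
  have hne : ∀ s : ℝ, x + s • u ≠ 0 := fun s =>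
    norm_pos_iff.1 (hpos.trans_le (norm_le_norm_add_smul_of_inner_eq_zero hxu s))
  have hd : ∀ s ∈ Set.Icc (0 : ℝ) 1, HasDerivWithinAt (fun s : ℝ => f (x + s • u))
      (fderiv ℝ f (x + s • u) u) (Set.Icc 0 1) s := fun s _ =>
    ((h2.differentiableAt_off_zero two_ne_zero (hne s)).hasFDerivAt.comp_hasDerivAt s
      (hasDerivAt_add_smul x u s)).hasDerivWithinAt
  have h := Convex.norm_image_sub_le_of_norm_hasDerivWithin_le (C := ρ / ‖x‖ * ‖u‖) hd
    (fun s _ => ?_) (convex_Icc 0 1) (Set.left_mem_Icc.2 zero_le_one)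
    (Set.right_mem_Icc.2 zero_le_one)
  · simpa using h
  · refine (ContinuousLinearMap.le_opNorm _ _).trans ?_
    gcongr
    refine (hf.norm_fderiv_le h2 hρ (hne s)).trans ?_
    gcongr
    exact norm_le_norm_add_smul_of_inner_eq_zero hxu s

theorem ScaleInvariant.norm_fderiv_sub_le_of_orthogonal (hf : ScaleInvariant f)
    (h2 : ContDiffOn ℝ 2 f {0}ᶜ) (hρ : ∀ z : E, ‖z‖ = 1 → ‖fderiv ℝ (fderiv ℝ f) z‖ ≤ ρ)
    (hρ0 : 0 ≤ ρ) (hx : x ≠ 0) (hxu : inner ℝ x u = 0) {s : ℝ} (hs : 0 ≤ s) :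
    ‖fderiv ℝ f (x + s • u) - fderiv ℝ f x‖ ≤ ρ / ‖x‖ ^ 2 * ‖u‖ * s := by
  have hpos : 0 < ‖x‖ := norm_pos_iff.2 hx
  have hne : ∀ s : ℝ, x + s • u ≠ 0 := fun s =>
    norm_pos_iff.1 (hpos.trans_le (norm_le_norm_add_smul_of_inner_eq_zero hxu s))
  have hd : ∀ r ∈ Set.Icc (0 : ℝ) s, HasDerivWithinAt (fun s : ℝ => fderiv ℝ f (x + s • u))
      (fderiv ℝ (fderiv ℝ f) (x + r • u) u) (Set.Icc 0 s) r := fun r _ =>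
    ((h2.differentiableAt_fderiv_off_zero (hne r)).hasFDerivAt.comp_hasDerivAt r
      (hasDerivAt_add_smul x u r)).hasDerivWithinAt
  have h := Convex.norm_image_sub_le_of_norm_hasDerivWithin_le (C := ρ / ‖x‖ ^ 2 * ‖u‖) hd
    (fun r _ => ?_) (convex_Icc 0 s) (Set.left_mem_Icc.2 hs) (Set.right_mem_Icc.2 hs)
  · simpa [abs_of_nonneg hs] using h
  · refine (ContinuousLinearMap.le_opNorm _ _).trans ?_
    gcongr
    refine (hf.norm_fderiv_fderiv_le hρ (hne r)).trans ?_
    gcongr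
    exact norm_le_norm_add_smul_of_inner_eq_zero hxu r

/-- A displacement orthogonal to x never decreases the norm, so the whole segment avoids the origin
and the Hessian on it is at most ρ/‖x‖². The usual quadratic upper bound then holds with this
constant. -/
theorem ScaleInvariant.descent (hf : ScaleInvariant f)
    (h2 : ContDiffOn ℝ 2 f {0}ᶜ) (hρ : ∀ z : E, ‖z‖ = 1 → ‖fderiv ℝ (fderiv ℝ f) z‖ ≤ ρ)
    (hρ0 : 0 ≤ ρ) (hx : x ≠ 0) (hxu : inner ℝ x u = 0) :
    f (x + u) ≤ f x + fderiv ℝ f x u + ρ / ‖x‖ ^ 2 * ‖u‖ ^ 2 / 2 := by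
  have hpos : 0 < ‖x‖ := norm_pos_iff.2 hx
  have hne : ∀ s : ℝ, x + s • u ≠ 0 := fun s =>
    norm_pos_iff.1 (hpos.trans_le (norm_le_norm_add_smul_of_inner_eq_zero hxu s))
  set B := ρ / ‖x‖ ^ 2 * ‖u‖ ^ 2
  have hd : ∀ s : ℝ, HasDerivAt
      (fun s : ℝ => f (x + s • u) - s * fderiv ℝ f x u - s ^ 2 * (B / 2))
      (fderiv ℝ f (x + s • u) u - fderiv ℝ f x u - s * B) s := fun s => by
    have h1 := (h2.differentiableAt_off_zero two_ne_zero (hne s)).hasFDerivAt.comp_hasDerivAt s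
      (hasDerivAt_add_smul x u s)
    have h3 := (hasDerivAt_id s).mul_const (fderiv ℝ f x u)
    have h4 := ((hasDerivAt_id s).pow 2).mul_const (B / 2)
    exact ((h1.sub h3).sub h4).congr_deriv (by simp; ring)
  have hanti : AntitoneOn (fun s : ℝ => f (x + s • u) - s * fderiv ℝ f x u - s ^ 2 * (B / 2))
      (Set.Icc 0 1) := by
    refine antitoneOn_of_deriv_nonpos (convex_Icc 0 1)
      (fun s _ => (hd s).continuousAt.continuousWithinAt)
      (fun s _ => (hd s).differentiableAt.differentiableWithinAt) fun s hs => ?_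
    rw [interior_Icc] at hs
    rw [(hd s).deriv]
    have h := hf.norm_fderiv_sub_le_of_orthogonal h2 hρ hρ0 hx hxu hs.1.le
    have h5 : fderiv ℝ f (x + s • u) u - fderiv ℝ f x u ≤ s * B := by
      rw [← sub_apply]
      calc _ ≤ ‖(fderiv ℝ f (x + s • u) - fderiv ℝ f x) u‖ := Real.le_norm_self _
        _ ≤ ‖fderiv ℝ f (x + s • u) - fderiv ℝ f x‖ * ‖u‖ := ContinuousLinearMap.le_opNorm _ _
        _ ≤ ρ / ‖x‖ ^ 2 * ‖u‖ * s * ‖u‖ := by gcongr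
        _ = s * B := by simp only [B]; ring
    linarith
  have := hanti (Set.left_mem_Icc.2 zero_le_one) (Set.right_mem_Icc.2 zero_le_one) zero_le_one
  simp only [one_smul, zero_smul, add_zero, one_mul, zero_mul, one_pow, sub_zero] at this
  norm_num at this
  linarith

theorem norm_cos_smul_add_sin_smul {a b : E} (ha : ‖a‖ = 1) (hb : ‖b‖ = 1)
    (hab : inner ℝ a b = 0) (φ : ℝ) : ‖Real.cos φ • a + Real.sin φ • b‖ = 1 := by
  have h := norm_add_sq_eq_norm_sq_add_norm_sq_real (x := Real.cos φ • a) (y := Real.sin φ • b)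
    (by rw [inner_smul_left, inner_smul_right, hab]; simp)
  rw [norm_smul, norm_smul, ha, hb, mul_one, mul_one, Real.norm_eq_abs, Real.norm_eq_abs,
    abs_mul_abs_self, abs_mul_abs_self] at h
  have : ‖Real.cos φ • a + Real.sin φ • b‖ ^ 2 = 1 := by
    nlinarith [Real.sin_sq_add_cos_sq φ]
  exact (pow_eq_one_iff_of_nonneg (norm_nonneg _) two_ne_zero).1 this

theorem ScaleInvariant.abs_sub_le_on_great_circle (hf : ScaleInvariant f)
    (h2 : ContDiffOn ℝ 2 f {0}ᶜ) (hρ : ∀ z : E, ‖z‖ = 1 → ‖fderiv ℝ (fderiv ℝ f) z‖ ≤ ρ)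
    {a b : E} (ha : ‖a‖ = 1) (hb : ‖b‖ = 1) (hab : inner ℝ a b = 0) {φ : ℝ} (hφ : 0 ≤ φ) :
    |f (Real.cos φ • a + Real.sin φ • b) - f a| ≤ ρ * φ := by
  have hnorm := norm_cos_smul_add_sin_smul ha hb hab
  have hne : ∀ s : ℝ, Real.cos s • a + Real.sin s • b ≠ 0 := fun s =>
    norm_ne_zero_iff.1 (by rw [hnorm]; exact one_ne_zero)
  have hp : ∀ s : ℝ, HasDerivAt (fun s : ℝ => Real.cos s • a + Real.sin s • b)
      (Real.cos s • b + Real.sin s • (-a)) s := fun s => by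
    exact (((Real.hasDerivAt_cos s).smul_const a).add
      ((Real.hasDerivAt_sin s).smul_const b)).congr_deriv (by simp [add_comm])
  have hd : ∀ s ∈ Set.Icc (0 : ℝ) φ, HasDerivWithinAt
      (fun s : ℝ => f (Real.cos s • a + Real.sin s • b))
      (fderiv ℝ f (Real.cos s • a + Real.sin s • b) (Real.cos s • b + Real.sin s • (-a)))
      (Set.Icc 0 φ) s := fun s _ =>
    ((h2.differentiableAt_off_zero two_ne_zero (hne s)).hasFDerivAt.comp_hasDerivAt s
      (hp s)).hasDerivWithinAt
  have h := Convex.norm_image_sub_le_of_norm_hasDerivWithin_le (C := ρ) hd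
    (fun s _ => ?_) (convex_Icc 0 φ) (Set.left_mem_Icc.2 hφ) (Set.right_mem_Icc.2 hφ)
  · simpa [abs_of_nonneg hφ] using h
  · refine (ContinuousLinearMap.le_opNorm _ _).trans ?_
    have h3 : ‖Real.cos s • b + Real.sin s • (-a)‖ = 1 :=
      norm_cos_smul_add_sin_smul hb (by rwa [norm_neg])
        (by rw [inner_neg_right, real_inner_comm, hab, neg_zero]) s
    rw [h3, mul_one]
    refine (hf.norm_fderiv_le h2 hρ (hne s)).trans ?_
    rw [hnorm, div_one]

/-- The auxiliary vector e is used only when w = ±a, where the component of w orthogonal to a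
vanishes and does not select a plane. -/
theorem exists_great_circle {a w e : E} (ha : ‖a‖ = 1) (hw : ‖w‖ = 1) (he : e ≠ 0)
    (hae : inner ℝ a e = 0) : ∃ b : E, ‖b‖ = 1 ∧ inner ℝ a b = 0 ∧
      ∃ φ : ℝ, 0 ≤ φ ∧ φ ≤ Real.pi ∧ w = Real.cos φ • a + Real.sin φ • b := by
  set r : ℝ := inner ℝ a w
  have hr : |r| ≤ 1 := by simpa [ha, hw] using abs_real_inner_le_norm a w
  have hr' := abs_le.1 hr
  set v := w - r • a
  have hav : inner ℝ a v = 0 := by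
    simp only [v, inner_sub_right, inner_smul_right, real_inner_self_eq_norm_sq, ha]
    simp [r]
  have hvn : ‖v‖ ^ 2 = 1 - r ^ 2 := by
    have h := norm_sub_sq_real w (r • a)
    rw [inner_smul_right, real_inner_comm, norm_smul, hw, ha] at h
    simp only [v, h, Real.norm_eq_abs, mul_one, sq_abs]
    ring
  have hsin : Real.sin (Real.arccos r) = ‖v‖ := by
    rw [Real.sin_arccos, ← hvn, Real.sqrt_sq (norm_nonneg _)]
  have hcos : Real.cos (Real.arccos r) = r := Real.cos_arccos hr'.1 hr'.2
  by_cases hv : v = 0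
  · refine ⟨‖e‖⁻¹ • e, norm_smul_unit_eq he, by rw [inner_smul_right, hae, mul_zero],
      Real.arccos r, Real.arccos_nonneg r, Real.arccos_le_pi r, ?_⟩
    rw [hsin, hcos, hv, norm_zero, zero_smul, add_zero]
    exact sub_eq_zero.1 hv
  · refine ⟨‖v‖⁻¹ • v, norm_smul_unit_eq hv, by rw [inner_smul_right, hav, mul_zero],
      Real.arccos r, Real.arccos_nonneg r, Real.arccos_le_pi r, ?_⟩
    rw [hsin, hcos, smul_smul, mul_inv_cancel₀ (norm_ne_zero_iff.2 hv), one_smul]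
    simp [v]

/-- Two unit vectors are joined by an arc of length at most π, along which the gradient is at most
ρ. -/
theorem ScaleInvariant.abs_sub_le_pi (hf : ScaleInvariant f)
    (h2 : ContDiffOn ℝ 2 f {0}ᶜ) (hρ : ∀ z : E, ‖z‖ = 1 → ‖fderiv ℝ (fderiv ℝ f) z‖ ≤ ρ)
    (hρ0 : 0 ≤ ρ) {a w e : E} (ha : ‖a‖ = 1) (hw : ‖w‖ = 1) (he : e ≠ 0)
    (hae : inner ℝ a e = 0) : |f w - f a| ≤ ρ * Real.pi := by
  obtain ⟨b, hb, hab, φ, hφ0, hφ, rfl⟩ := exists_great_circle ha hw he hae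
  refine (hf.abs_sub_le_on_great_circle h2 hρ ha hb hab hφ0).trans ?_
  gcongr

theorem ScaleInvariant.gradient_smul [CompleteSpace E] (hf : ScaleInvariant f) (hc : 0 < c)
    (hx : x ≠ 0) : gradient f (c • x) = c⁻¹ • gradient f x := by
  simp only [gradient, hf.fderiv_smul hc hx]
  exact LinearIsometryEquiv.map_smulₛₗ _ _ _

theorem inner_gradient_eq_fderiv [CompleteSpace E] (f : E → ℝ) (x u : E) :
    inner ℝ (gradient f x) u = fderiv ℝ f x u := by
  simp [gradient]

theorem norm_gradient_eq_norm_fderiv [CompleteSpace E] (f : E → ℝ) (x : E) :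
    ‖gradient f x‖ = ‖fderiv ℝ f x‖ := by
  simp [gradient]

theorem ScaleInvariant.inner_gradient_self [CompleteSpace E] (hf : ScaleInvariant f)
    (hx : x ≠ 0) (hd : DifferentiableAt ℝ f x) : inner ℝ (gradient f x) x = 0 := by
  rw [inner_gradient_eq_fderiv, hf.fderiv_apply_self hx hd]

theorem continuousOn_gradient [CompleteSpace E] (h : ContDiffOn ℝ 1 f {0}ᶜ) :
    ContinuousOn (gradient f) {0}ᶜ :=
  (InnerProductSpace.toDual ℝ E).symm.continuous.comp_continuousOn
    (h.continuousOn_fderiv_of_isOpen isOpen_compl_singleton le_rfl)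

end scaleInvariant

theorem norm_fderiv_fderiv_le_sphereHessianBound {d : ℕ} {f : EuclideanSpace ℝ (Fin d) → ℝ}
    (h2 : ContDiffOn ℝ 2 f {0}ᶜ) {z : EuclideanSpace ℝ (Fin d)} (hz : ‖z‖ = 1) :
    ‖fderiv ℝ (fderiv ℝ f) z‖ ≤ sphereHessianBound f := by
  have hc : ContinuousOn (fun x => ‖fderiv ℝ (fderiv ℝ f) x‖)
      (Metric.sphere (0 : EuclideanSpace ℝ (Fin d)) 1) :=
    (h2.fderiv_off_zero.continuousOn_fderiv_of_isOpen isOpen_compl_singleton le_rfl).norm.mono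
      fun x hx => by
        simp only [Set.mem_compl_iff, Set.mem_singleton_iff]
        rintro rfl
        simp at hx
  exact le_csSup ((isCompact_sphere 0 1).image_of_continuousOn hc).bddAbove
    ⟨z, by simpa using hz, rfl⟩

/-- The gradient of `L γ` at the direction of `x`, extended by `0` at `x = 0`. -/
noncomputable def unitGradient {d : ℕ} {Γ : Type*} (L : Γ → EuclideanSpace ℝ (Fin d) → ℝ)
    (x : EuclideanSpace ℝ (Fin d)) (γ : Γ) : EuclideanSpace ℝ (Fin d) :=
  if x = 0 then 0 else gradient (L γ) (unitDir x)

/-- The clipped gradient at the direction of `x`; its mean is `expectedClippedGradient`. -/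
noncomputable def clippedGradient {d : ℕ} {Γ : Type*} (L : Γ → EuclideanSpace ℝ (Fin d) → ℝ)
    (C η lam : ℝ) (x : EuclideanSpace ℝ (Fin d)) (γ : Γ) : EuclideanSpace ℝ (Fin d) :=
  (min (√(2 * C * lam / η) * ‖x‖ ^ 2 / ‖unitGradient L x γ‖) 1) • unitGradient L x γ

/-- One step of clipped SGD with weight decay. -/
noncomputable def sgdStep {d : ℕ} {Γ : Type*} (L : Γ → EuclideanSpace ℝ (Fin d) → ℝ)
    (C η lam : ℝ) (x : EuclideanSpace ℝ (Fin d)) (γ : Γ) : EuclideanSpace ℝ (Fin d) :=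
  (1 - η * lam) • x - (η / ‖x‖) • clippedGradient L C η lam x γ

/-- The effective radius `√(2 lam / η) ‖x‖ ^ 2`. -/
noncomputable def effRadius {E : Type*} [Norm E] (η lam : ℝ) (x : E) : ℝ :=
  √(2 * lam / η) * ‖x‖ ^ 2

/-- The standing assumptions on the losses and the parameters. -/
structure ClippedSetting {d : ℕ} {Γ : Type*} [MeasurableSpace Γ]
    (L : Γ → EuclideanSpace ℝ (Fin d) → ℝ) (ν : Measure Γ) (C α η lam : ℝ) : Prop where
  scaleInvariant : ∀ γ, ScaleInvariant (L γ)
  contDiffOn : ∀ γ, ContDiffOn ℝ 1 (L γ) {0}ᶜ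
  measurable : ∀ x, x ≠ 0 → Measurable (fun γ => L γ x)
  contDiffOn_mean : ContDiffOn ℝ 2 (meanLoss L ν) {0}ᶜ
  one_lt : 1 < C
  α_pos : 0 < α
  η_pos : 0 < η
  lam_pos : 0 < lam
  concentrated : ConcentratedFromBelow L ν C α
  min_pos : 0 < clippedMeanMin L ν C
  small : 1000000 * (η * lam * C) ≤ α

/-! ### Measurability of gradients and of the iteration map -/

section measurability

variable {d : ℕ} {Γ : Type*} [MeasurableSpace Γ] {L : Γ → EuclideanSpace ℝ (Fin d) → ℝ}

/-- Directional derivatives are limits of difference quotients, and the gradient is assembled from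
its coordinates. -/
theorem measurable_gradient_apply (hc : ∀ γ, ContDiffOn ℝ 1 (L γ) {0}ᶜ)
    (hm : ∀ x, x ≠ 0 → Measurable (fun γ => L γ x)) {x : EuclideanSpace ℝ (Fin d)}
    (hx : x ≠ 0) : Measurable (fun γ => gradient (L γ) x) := by
  have key : ∀ e, Measurable (fun γ => fderiv ℝ (L γ) x e) := by
    intro e
    -- No measurability is given at the origin, which a point x + e/n may hit. Setting the value
    -- there to 0 does not change the loss near x.
    set L' : Γ → EuclideanSpace ℝ (Fin d) → ℝ := fun γ z => if z = 0 then 0 else L γ z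
    have hL' : ∀ z, Measurable (fun γ => L' γ z) := by
      intro z
      by_cases hz : z = 0
      · simp [L', hz]
      · simpa [L', hz] using hm z hz
    have hlim : ∀ γ, Filter.Tendsto (fun n : ℕ => (n : ℝ) • (L' γ (x + (n : ℝ)⁻¹ • e) - L' γ x))
        Filter.atTop (nhds (fderiv ℝ (L γ) x e)) := by
      intro γ
      have heq : L' γ =ᶠ[nhds x] L γ := by
        filter_upwards [isOpen_compl_singleton.mem_nhds hx] with y hy
        exact if_neg hy
      have hd := ((hc γ).differentiableAt_off_zero one_ne_zero hx).hasFDerivAt.congr_of_eventuallyEq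
        heq
      exact (hd.lim_real e).comp tendsto_natCast_atTop_atTop
    refine measurable_of_tendsto_metrizable (fun n => ?_) (tendsto_pi_nhds.2 hlim)
    exact ((hL' _).sub (hL' _)).const_smul (n : ℝ)
  have heq : (fun γ => gradient (L γ) x) = fun γ => ∑ i,
      (fderiv ℝ (L γ) x (EuclideanSpace.basisFun (Fin d) ℝ i)) •
        EuclideanSpace.basisFun (Fin d) ℝ i := by
    funext γ
    conv_lhs => rw [← (EuclideanSpace.basisFun (Fin d) ℝ).sum_repr' (gradient (L γ) x)]
    refine Finset.sum_congr rfl fun i _ => ?_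
    rw [real_inner_comm, inner_gradient_eq_fderiv]
  rw [heq]
  exact Finset.measurable_sum _ fun i _ => (key _).smul_const _

theorem measurable_unitDir : Measurable (unitDir : EuclideanSpace ℝ (Fin d) → _) := by
  unfold unitDir
  fun_prop

theorem unitDir_ne_zero {x : EuclideanSpace ℝ (Fin d)} (hx : x ≠ 0) : unitDir x ≠ 0 :=
  smul_ne_zero (inv_ne_zero (norm_ne_zero_iff.2 hx)) hx

theorem norm_unitDir {x : EuclideanSpace ℝ (Fin d)} (hx : x ≠ 0) : ‖unitDir x‖ = 1 :=
  norm_smul_unit_eq hx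

theorem norm_smul_unitDir {x : EuclideanSpace ℝ (Fin d)} (hx : x ≠ 0) :
    ‖x‖ • unitDir x = x := by
  rw [unitDir, smul_smul, mul_inv_cancel₀ (norm_ne_zero_iff.2 hx), one_smul]

/-- A Carathéodory argument on nonzero vectors: the gradient is continuous in the point and
measurable in the sample, hence jointly measurable. -/
theorem measurable_unitGradient (hc : ∀ γ, ContDiffOn ℝ 1 (L γ) {0}ᶜ)
    (hm : ∀ x, x ≠ 0 → Measurable (fun γ => L γ x)) :
    Measurable (fun p : EuclideanSpace ℝ (Fin d) × Γ => unitGradient L p.1 p.2) := by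
  have h : Measurable (Function.uncurry fun (z : {z : EuclideanSpace ℝ (Fin d) // z ≠ 0}) (γ : Γ) =>
      gradient (L γ) z.1) := by
    refine measurable_uncurry_of_continuous_of_measurable (fun γ => ?_) fun z => ?_
    · exact continuousOn_iff_continuous_domRestrict.1 (continuousOn_gradient (hc γ))
    · exact measurable_gradient_apply hc hm z.2
  have hs : MeasurableSet {p : EuclideanSpace ℝ (Fin d) × Γ | p.1 = 0} :=
    measurable_fst (measurableSet_singleton 0)
  unfold unitGradient
  refine Measurable.dite (s := {p : EuclideanSpace ℝ (Fin d) × Γ | p.1 = 0})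
    (f := fun _ => 0) (g := fun p => gradient (L p.1.2) (unitDir p.1.1)) measurable_const ?_ hs
  have hmap : Measurable fun p : ({p : EuclideanSpace ℝ (Fin d) × Γ | p.1 = 0}ᶜ : Set _) =>
      ((⟨unitDir p.1.1, unitDir_ne_zero p.2⟩ : {z : EuclideanSpace ℝ (Fin d) // z ≠ 0}),
        p.1.2) :=
    ((measurable_unitDir.comp (measurable_fst.comp measurable_subtype_coe)).subtype_mk).prodMk
      (measurable_snd.comp measurable_subtype_coe)
  exact h.comp hmap

theorem measurable_clippedGradient (hc : ∀ γ, ContDiffOn ℝ 1 (L γ) {0}ᶜ)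
    (hm : ∀ x, x ≠ 0 → Measurable (fun γ => L γ x)) (C η lam : ℝ) :
    Measurable (fun p : EuclideanSpace ℝ (Fin d) × Γ => clippedGradient L C η lam p.1 p.2) := by
  have := measurable_unitGradient hc hm
  unfold clippedGradient
  fun_prop

theorem measurable_sgdStep (hc : ∀ γ, ContDiffOn ℝ 1 (L γ) {0}ᶜ)
    (hm : ∀ x, x ≠ 0 → Measurable (fun γ => L γ x)) (C η lam : ℝ) :
    Measurable (fun p : EuclideanSpace ℝ (Fin d) × Γ => sgdStep L C η lam p.1 p.2) := by
  have := measurable_clippedGradient hc hm C η lam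
  unfold sgdStep
  fun_prop

end measurability

/-! ### Clipping in terms of the effective radius -/

section step

variable {d : ℕ} {Γ : Type*} {L : Γ → EuclideanSpace ℝ (Fin d) → ℝ}
  {C η lam : ℝ} {x : EuclideanSpace ℝ (Fin d)}

theorem effRadius_sq (hη : 0 < η) (hlam : 0 < lam) (x : EuclideanSpace ℝ (Fin d)) :
    effRadius η lam x ^ 2 = 2 * lam / η * ‖x‖ ^ 4 := by
  rw [effRadius, mul_pow, Real.sq_sqrt (by positivity)]
  ring

theorem effRadius_pos (hη : 0 < η) (hlam : 0 < lam) (hx : x ≠ 0) : 0 < effRadius η lam x := by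
  have := norm_pos_iff.2 hx
  unfold effRadius
  positivity

theorem measurable_effRadius :
    Measurable (effRadius η lam : EuclideanSpace ℝ (Fin d) → ℝ) := by
  unfold effRadius
  fun_prop

theorem norm_clippedGradient (hη : 0 < η) (hlam : 0 < lam) (hC : 1 < C)
    (x : EuclideanSpace ℝ (Fin d)) (γ : Γ) :
    ‖clippedGradient L C η lam x γ‖ = min (√C * effRadius η lam x) ‖unitGradient L x γ‖ := by
  have e : √(2 * C * lam / η) * ‖x‖ ^ 2 = √C * effRadius η lam x := by
    rw [effRadius, ← mul_assoc, ← Real.sqrt_mul (by linarith)]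
    congr 2
    ring
  have h0 : 0 ≤ √C * effRadius η lam x := by unfold effRadius; positivity
  rw [clippedGradient, norm_smul, e]
  rcases (norm_nonneg (unitGradient L x γ)).eq_or_lt with h | h
  · rw [← h, mul_zero, min_eq_right h0]
  · rw [Real.norm_eq_abs, abs_of_nonneg (by positivity), min_mul_of_nonneg _ _ h.le, one_mul,
      div_mul_cancel₀ _ h.ne']

theorem norm_clippedGradient_sq (hη : 0 < η) (hlam : 0 < lam) (hC : 1 < C)
    (x : EuclideanSpace ℝ (Fin d)) (γ : Γ) :
    ‖clippedGradient L C η lam x γ‖ ^ 2 =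
      min (‖unitGradient L x γ‖ ^ 2) (C * effRadius η lam x ^ 2) := by
  have h0 : 0 ≤ √C * effRadius η lam x := by unfold effRadius; positivity
  have e : C * effRadius η lam x ^ 2 = (√C * effRadius η lam x) ^ 2 := by
    rw [mul_pow, Real.sq_sqrt (by linarith)]
  rw [norm_clippedGradient hη hlam hC, e, min_comm]
  rcases le_total (√C * effRadius η lam x) ‖unitGradient L x γ‖ with h | h
  · rw [min_eq_right h, min_eq_right (pow_le_pow_left₀ h0 h 2)]
  · rw [min_eq_left h, min_eq_left (pow_le_pow_left₀ (norm_nonneg _) h 2)]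

end step

/-- The squared norm of the clipped gradient relative to the squared effective radius. -/
noncomputable def clippedRatio {d : ℕ} {Γ : Type*} (L : Γ → EuclideanSpace ℝ (Fin d) → ℝ)
    (C η lam : ℝ) (x : EuclideanSpace ℝ (Fin d)) (γ : Γ) : ℝ :=
  ‖clippedGradient L C η lam x γ‖ ^ 2 / effRadius η lam x ^ 2

theorem clippedRatio_nonneg {d : ℕ} {Γ : Type*} {L : Γ → EuclideanSpace ℝ (Fin d) → ℝ}
    {C η lam : ℝ} (x : EuclideanSpace ℝ (Fin d)) (γ : Γ) : 0 ≤ clippedRatio L C η lam x γ := by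
  unfold clippedRatio
  positivity

/-! ### Recursion for the effective radius and the mean of the clipped ratio -/

namespace ClippedSetting

variable {d : ℕ} {Γ : Type*} [MeasurableSpace Γ] {L : Γ → EuclideanSpace ℝ (Fin d) → ℝ}
  {ν : Measure Γ} {C α η lam : ℝ} {x : EuclideanSpace ℝ (Fin d)}

theorem eps_pos (S : ClippedSetting L ν C α η lam) : 0 < η * lam :=
  mul_pos S.η_pos S.lam_pos

theorem inner_clippedGradient (S : ClippedSetting L ν C α η lam) (hx : x ≠ 0) (γ : Γ) :
    inner ℝ x (clippedGradient L C η lam x γ) = 0 := by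
  have h := (S.scaleInvariant γ).inner_gradient_self (unitDir_ne_zero hx)
    ((S.contDiffOn γ).differentiableAt_off_zero one_ne_zero (unitDir_ne_zero hx))
  have h2 : inner ℝ x (gradient (L γ) (unitDir x)) =
      ‖x‖ * inner ℝ (gradient (L γ) (unitDir x)) (unitDir x) := by
    rw [real_inner_comm, ← inner_smul_right, norm_smul_unitDir hx]
  rw [clippedGradient, unitGradient, if_neg hx, inner_smul_right, h2, h, mul_zero, mul_zero]

theorem norm_sgdStep_sq (S : ClippedSetting L ν C α η lam) (hx : x ≠ 0) (γ : Γ) :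
    ‖sgdStep L C η lam x γ‖ ^ 2 = (1 - η * lam) ^ 2 * ‖x‖ ^ 2 +
      η ^ 2 / ‖x‖ ^ 2 * ‖clippedGradient L C η lam x γ‖ ^ 2 := by
  rw [sgdStep, norm_sub_sq_real, inner_smul_left, inner_smul_right,
    S.inner_clippedGradient hx, norm_smul, norm_smul, mul_pow, mul_pow, Real.norm_eq_abs,
    Real.norm_eq_abs, sq_abs, sq_abs, div_pow]
  simp

theorem clippedRatio_le (S : ClippedSetting L ν C α η lam) (hx : x ≠ 0) (γ : Γ) :
    clippedRatio L C η lam x γ ≤ C := by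
  have := effRadius_pos S.η_pos S.lam_pos hx
  rw [clippedRatio, div_le_iff₀ (by positivity),
    norm_clippedGradient_sq S.η_pos S.lam_pos S.one_lt]
  exact min_le_right _ _

/-- Orthogonality removes the cross term in the squared norm. The factor √(2λ/η) is chosen so that
the gradient contributes exactly 2ε times the clipped ratio, hence equilibrium sits near ratio 1. -/
theorem effRadius_sgdStep (S : ClippedSetting L ν C α η lam) (hx : x ≠ 0) (γ : Γ) :
    effRadius η lam (sgdStep L C η lam x γ) = effRadius η lam x *
      ((1 - η * lam) ^ 2 + 2 * (η * lam) * clippedRatio L C η lam x γ) := by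
  have hη := S.η_pos
  have hlam := S.lam_pos
  have hn := norm_pos_iff.2 hx
  have hR := effRadius_pos hη hlam hx
  have e : √(2 * lam / η) ^ 2 = 2 * lam / η := Real.sq_sqrt (by positivity)
  have hs : √(2 * lam / η) ≠ 0 := by positivity
  have e1 : effRadius η lam (sgdStep L C η lam x γ) =
      √(2 * lam / η) * ‖sgdStep L C η lam x γ‖ ^ 2 := rfl
  rw [e1, S.norm_sgdStep_sq hx, clippedRatio]
  unfold effRadius
  field_simp
  rw [e]
  field_simp

theorem one_lt_inv_eps (S : ClippedSetting L ν C α η lam) (hα1 : α ≤ 1) :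
    1000000 * (η * lam) ≤ 1 := by
  have := S.small
  have := S.one_lt
  nlinarith [S.eps_pos]

theorem sgdStep_ne_zero (S : ClippedSetting L ν C α η lam) (hα1 : α ≤ 1) (hx : x ≠ 0) (γ : Γ) :
    sgdStep L C η lam x γ ≠ 0 := by
  have h1 := S.one_lt_inv_eps hα1
  have hn := norm_pos_iff.2 hx
  have h2 : 0 < 1 - η * lam := by linarith
  have h : 0 < ‖sgdStep L C η lam x γ‖ ^ 2 := by
    rw [S.norm_sgdStep_sq hx]
    positivity
  intro h0
  rw [h0] at h
  simp at h

theorem log_effRadius_sgdStep (S : ClippedSetting L ν C α η lam) (hα1 : α ≤ 1) (hx : x ≠ 0)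
    (γ : Γ) : Real.log (effRadius η lam (sgdStep L C η lam x γ) ^ 2) =
      Real.log (effRadius η lam x ^ 2) +
        logIncrement (η * lam) (clippedRatio L C η lam x γ) := by
  have h1 := S.one_lt_inv_eps hα1
  have hR := effRadius_pos S.η_pos S.lam_pos hx
  have h2 : 0 < 1 - η * lam := by linarith
  have h3 : 0 ≤ clippedRatio L C η lam x γ := clippedRatio_nonneg x γ
  have h4 := S.eps_pos
  have h5 : 0 < (1 - η * lam) ^ 2 + 2 * (η * lam) * clippedRatio L C η lam x γ := by positivity
  rw [S.effRadius_sgdStep hx, mul_pow, Real.log_mul (by positivity) (by positivity),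
    Real.log_pow ((1 - η * lam) ^ 2 + _), logIncrement, Nat.cast_ofNat]

/-- The gradient is homogeneous of degree -1, so passing to the unit direction replaces the
threshold proportional to ‖x‖ by one proportional to ‖x‖². -/
theorem sgdStep_eq (S : ClippedSetting L ν C α η lam) (hx : x ≠ 0) (γ : Γ) :
    (1 - η * lam) • x - (η * min (√(2 * C * lam / η) * ‖x‖) ‖gradient (L γ) x‖) •
      unitDir (gradient (L γ) x) = sgdStep L C η lam x γ := by
  have hn := norm_pos_iff.2 hx
  have hg : gradient (L γ) x = ‖x‖⁻¹ • gradient (L γ) (unitDir x) := by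
    conv_lhs => rw [← norm_smul_unitDir hx]
    exact (S.scaleInvariant γ).gradient_smul hn (unitDir_ne_zero hx)
  rw [sgdStep, clippedGradient, unitGradient, if_neg hx, hg]
  set G := gradient (L γ) (unitDir x)
  rcases eq_or_ne G 0 with h0 | h0
  · rw [h0]; simp [unitDir]
  have hG := norm_pos_iff.2 h0
  rw [unitDir, smul_smul, smul_smul, smul_smul, norm_smul, norm_inv, norm_norm]
  congr 2
  have e1 : √(2 * C * lam / η) * ‖x‖ = ‖x‖⁻¹ * (√(2 * C * lam / η) * ‖x‖ ^ 2) := by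
    field_simp
  have e2 : min (√(2 * C * lam / η) * ‖x‖ ^ 2 / ‖G‖) 1 =
      min (√(2 * C * lam / η) * ‖x‖ ^ 2) ‖G‖ / ‖G‖ := by
    rw [← min_div_div_right hG.le, div_self hG.ne']
  rw [e1, e2, ← mul_min_of_nonneg _ _ (inv_nonneg.2 hn.le)]
  field_simp

theorem clippedSGD_ne_zero (S : ClippedSetting L ν C α η lam) (hα1 : α ≤ 1) (hx : x ≠ 0)
    (γ : ℕ → Γ) (t : ℕ) : clippedSGD L C η lam x γ t ≠ 0 := by
  induction t with
  | zero => exact hx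
  | succ t ih =>
    rw [clippedSGD, S.sgdStep_eq ih]
    exact S.sgdStep_ne_zero hα1 ih _

theorem clippedSGD_succ (S : ClippedSetting L ν C α η lam) (hα1 : α ≤ 1) (hx : x ≠ 0)
    (γ : ℕ → Γ) (t : ℕ) : clippedSGD L C η lam x γ (t + 1) =
      sgdStep L C η lam (clippedSGD L C η lam x γ t) (γ t) := by
  rw [clippedSGD, S.sgdStep_eq (S.clippedSGD_ne_zero hα1 hx γ t)]

theorem measurable_gradient (S : ClippedSetting L ν C α η lam) (hx : x ≠ 0) :
    Measurable (fun γ => gradient (L γ) x) :=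
  measurable_gradient_apply S.contDiffOn S.measurable hx

theorem measurable_sqGrad (S : ClippedSetting L ν C α η lam) (hx : x ≠ 0) :
    Measurable (fun γ => ‖gradient (L γ) x‖ ^ 2) :=
  (S.measurable_gradient hx).norm.pow_const 2

theorem isProbabilityMeasure_sqGradLaw [IsProbabilityMeasure ν]
    (S : ClippedSetting L ν C α η lam) (hx : x ≠ 0) :
    IsProbabilityMeasure (sqGradLaw L ν x) :=
  Measure.isProbabilityMeasure_map (S.measurable_sqGrad hx).aemeasurable

theorem ae_nonneg_sqGradLaw (S : ClippedSetting L ν C α η lam) (hx : x ≠ 0) :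
    ∀ᵐ t ∂(sqGradLaw L ν x), 0 ≤ t := by
  rw [sqGradLaw, ae_map_iff (S.measurable_sqGrad hx).aemeasurable measurableSet_Ici]
  exact Filter.Eventually.of_forall fun γ => sq_nonneg _

theorem integral_min_sqGradLaw (S : ClippedSetting L ν C α η lam) (hx : x ≠ 0) (a : ℝ) :
    ∫ t, min t a ∂(sqGradLaw L ν x) = ∫ γ, min (‖gradient (L γ) x‖ ^ 2) a ∂ν := by
  rw [sqGradLaw, integral_map (S.measurable_sqGrad hx).aemeasurable]
  exact (by fun_prop : Measurable fun t : ℝ => min t a).aestronglyMeasurable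

/-- Needed because a supremum of an unbounded set would be a junk value, and no uniform gradient
bound is assumed. If the clipped means μₙ were unbounded along points converging on the sphere, the
functions min(‖∇L‖², Cμₙ)/μₙ would have mean 1, be dominated by C, and tend pointwise to 0. -/
theorem bddAbove_clippedMean [IsProbabilityMeasure ν] (S : ClippedSetting L ν C α η lam) :
    BddAbove ((fun x => clippedMean (sqGradLaw L ν x) C) ''
      Metric.sphere (0 : EuclideanSpace ℝ (Fin d)) 1) := by
  by_contra hb
  rw [not_bddAbove_iff] at hb
  have hb' : ∀ n : ℕ, ∃ x ∈ Metric.sphere (0 : EuclideanSpace ℝ (Fin d)) 1,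
      (n : ℝ) < clippedMean (sqGradLaw L ν x) C := by
    intro n
    obtain ⟨_, ⟨x, hx, rfl⟩, h⟩ := hb n
    exact ⟨x, hx, h⟩
  choose u hu hμ using hb'
  obtain ⟨z, hz, φ, hφ, hlim⟩ := (isCompact_sphere _ _).tendsto_subseq hu
  have hne : ∀ y ∈ Metric.sphere (0 : EuclideanSpace ℝ (Fin d)) 1, y ≠ 0 := by
    rintro y hy rfl
    simp at hy
  set μ : ℕ → ℝ := fun n => clippedMean (sqGradLaw L ν (u (φ n))) C
  have hμlim : Filter.Tendsto μ Filter.atTop Filter.atTop := by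
    refine Filter.tendsto_atTop_mono (fun n => (hμ (φ n)).le) ?_
    exact tendsto_natCast_atTop_atTop.comp hφ.tendsto_atTop
  have hμpos : ∀ n, 0 < μ n := fun n => (Nat.cast_nonneg _).trans_lt (hμ (φ n))
  have hC0 : 0 < C := by linarith [S.one_lt]
  have hone : ∀ n, ∫ γ, min (‖gradient (L γ) (u (φ n))‖ ^ 2) (C * μ n) / μ n ∂ν = 1 := by
    intro n
    have hx := hne _ (hu (φ n))
    have := S.isProbabilityMeasure_sqGradLaw hx
    have h := (clippedMean_mem (S.ae_nonneg_sqGradLaw hx) S.one_lt).2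
    rw [S.integral_min_sqGradLaw hx] at h
    rw [integral_div, h, div_self (hμpos n).ne']
  have hzero : Filter.Tendsto
      (fun n => ∫ γ, min (‖gradient (L γ) (u (φ n))‖ ^ 2) (C * μ n) / μ n ∂ν)
      Filter.atTop (nhds (∫ _, (0 : ℝ) ∂ν)) := by
    refine tendsto_integral_of_dominated_convergence (fun _ => C) (fun n => ?_)
      (integrable_const _) (fun n => ?_) ?_
    · exact (((S.measurable_sqGrad (hne _ (hu (φ n)))).min measurable_const).div_const
        _).aestronglyMeasurable
    · refine Filter.Eventually.of_forall fun γ => ?_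
      have := hμpos n
      rw [Real.norm_eq_abs, abs_of_nonneg (by positivity), div_le_iff₀ this]
      exact min_le_right _ _
    · refine Filter.Eventually.of_forall fun γ => ?_
      have h1 : Filter.Tendsto (fun n => ‖gradient (L γ) (u (φ n))‖ ^ 2) Filter.atTop
          (nhds (‖gradient (L γ) z‖ ^ 2)) := by
        have := (continuousOn_gradient (S.contDiffOn γ)).continuousAt
          (isOpen_compl_singleton.mem_nhds (hne z hz))
        exact ((this.tendsto.comp hlim).norm.pow 2)
      have h2 := h1.div_atTop hμlim
      refine squeeze_zero (fun n => ?_) (fun n => ?_) h2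
      · have := hμpos n
        positivity
      · have := hμpos n
        gcongr
        exact min_le_left _ _
  simp only [hone, integral_zero] at hzero
  exact one_ne_zero (tendsto_nhds_unique tendsto_const_nhds hzero)

theorem clippedMean_mem_Icc [IsProbabilityMeasure ν] (S : ClippedSetting L ν C α η lam)
    (hx : ‖x‖ = 1) : clippedMean (sqGradLaw L ν x) C ∈
      Set.Icc (clippedMeanMin L ν C) (clippedMeanMax L ν C) := by
  have hmem : clippedMean (sqGradLaw L ν x) C ∈ (fun x => clippedMean (sqGradLaw L ν x) C) ''
      Metric.sphere (0 : EuclideanSpace ℝ (Fin d)) 1 := ⟨x, by simpa using hx, rfl⟩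
  refine ⟨csInf_le ⟨0, ?_⟩ hmem, le_csSup S.bddAbove_clippedMean hmem⟩
  rintro _ ⟨z, hz, rfl⟩
  have hz0 : z ≠ 0 := by
    rintro rfl
    simp at hz
  have := S.isProbabilityMeasure_sqGradLaw hz0
  exact (clippedMean_mem (S.ae_nonneg_sqGradLaw hz0) S.one_lt).1

theorem clippedMean_pos [IsProbabilityMeasure ν] (S : ClippedSetting L ν C α η lam)
    (hx : ‖x‖ = 1) : 0 < clippedMean (sqGradLaw L ν x) C :=
  S.min_pos.trans_le (S.clippedMean_mem_Icc hx).1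

theorem alpha_le_one [IsProbabilityMeasure ν] (S : ClippedSetting L ν C α η lam)
    (hx : x ≠ 0) : α ≤ 1 := by
  have hu := unitDir_ne_zero hx
  have := S.isProbabilityMeasure_sqGradLaw hu
  exact concentration_le_one (S.ae_nonneg_sqGradLaw hu) S.one_lt
    (S.clippedMean_pos (norm_unitDir hx)) (S.concentrated _ hu)

theorem measurable_clippedGradient (S : ClippedSetting L ν C α η lam)
    (x : EuclideanSpace ℝ (Fin d)) : Measurable (clippedGradient L C η lam x) :=
  Measurable.of_uncurry_left (f := clippedGradient L C η lam)
    (_root_.measurable_clippedGradient S.contDiffOn S.measurable C η lam)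

theorem measurable_clippedRatio (S : ClippedSetting L ν C α η lam) :
    Measurable (fun p : EuclideanSpace ℝ (Fin d) × Γ => clippedRatio L C η lam p.1 p.2) := by
  have h1 := _root_.measurable_clippedGradient S.contDiffOn S.measurable C η lam
  have h2 := measurable_effRadius (d := d) (η := η) (lam := lam)
  unfold clippedRatio
  fun_prop

theorem integrable_clippedRatio [IsProbabilityMeasure ν] (S : ClippedSetting L ν C α η lam)
    (hx : x ≠ 0) : Integrable (clippedRatio L C η lam x) ν := by
  refine Integrable.of_bound
    (Measurable.of_uncurry_left (f := clippedRatio L C η lam)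
      S.measurable_clippedRatio).aestronglyMeasurable C ?_
  refine Filter.Eventually.of_forall fun γ => ?_
  rw [Real.norm_eq_abs, abs_of_nonneg (clippedRatio_nonneg x γ)]
  exact S.clippedRatio_le hx γ

/-- The bridge to the clipped mean: the squared effective radius plays the role of the level m. -/
theorem integral_clippedRatio (S : ClippedSetting L ν C α η lam) (hx : x ≠ 0) :
    effRadius η lam x ^ 2 * ∫ γ, clippedRatio L C η lam x γ ∂ν =
      ∫ t, min t (C * effRadius η lam x ^ 2) ∂(sqGradLaw L ν (unitDir x)) := by
  have hR := effRadius_pos S.η_pos S.lam_pos hx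
  rw [S.integral_min_sqGradLaw (unitDir_ne_zero hx), ← integral_const_mul]
  congr 1
  funext γ
  rw [clippedRatio, mul_div_cancel₀ _ (by positivity),
    norm_clippedGradient_sq S.η_pos S.lam_pos S.one_lt, unitGradient, if_neg hx]

theorem integral_clippedRatio_le [IsProbabilityMeasure ν] (S : ClippedSetting L ν C α η lam)
    (hx : x ≠ 0) (h : 3 / 2 * clippedMeanMax L ν C ≤ effRadius η lam x ^ 2) :
    ∫ γ, clippedRatio L C η lam x γ ∂ν ≤ 1 - α / 3 := by
  have hu := unitDir_ne_zero hx
  have hR := effRadius_pos S.η_pos S.lam_pos hx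
  have := S.isProbabilityMeasure_sqGradLaw hu
  have hμ := S.clippedMean_pos (norm_unitDir hx)
  have hle := (S.clippedMean_mem_Icc (norm_unitDir hx)).2
  have h1 := integral_min_le_sub (S.ae_nonneg_sqGradLaw hu) S.one_lt hμ (S.concentrated _ hu)
    (m := effRadius η lam x ^ 2) (by linarith)
  rw [← S.integral_clippedRatio hx] at h1
  refine le_of_mul_le_mul_left ?_ (pow_pos hR 2)
  have hα := S.α_pos
  nlinarith [mul_le_mul_of_nonneg_left (hle.trans (by linarith :
    clippedMeanMax L ν C ≤ 2 / 3 * effRadius η lam x ^ 2)) hα.le]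

theorem integral_clippedRatio_ge [IsProbabilityMeasure ν] (S : ClippedSetting L ν C α η lam)
    (hx : x ≠ 0) (h : 3 / 2 * effRadius η lam x ^ 2 ≤ clippedMeanMin L ν C) :
    1 + α / 2 ≤ ∫ γ, clippedRatio L C η lam x γ ∂ν := by
  have hu := unitDir_ne_zero hx
  have hR := effRadius_pos S.η_pos S.lam_pos hx
  have := S.isProbabilityMeasure_sqGradLaw hu
  have hμ := S.clippedMean_pos (norm_unitDir hx)
  have hle := (S.clippedMean_mem_Icc (norm_unitDir hx)).1
  have h1 := integral_min_ge_of_le_clippedMean (S.ae_nonneg_sqGradLaw hu) S.one_lt S.α_pos.le hμ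
    (S.concentrated _ hu) (pow_pos hR 2) (h.trans hle)
  rw [← S.integral_clippedRatio hx] at h1
  exact le_of_mul_le_mul_left h1 (pow_pos hR 2)

theorem mul_integral_clippedRatio_le_max [IsProbabilityMeasure ν]
    (S : ClippedSetting L ν C α η lam) (hx : x ≠ 0) :
    effRadius η lam x ^ 2 * ∫ γ, clippedRatio L C η lam x γ ∂ν ≤
      max (effRadius η lam x ^ 2) (clippedMeanMax L ν C) := by
  have hu := unitDir_ne_zero hx
  have := S.isProbabilityMeasure_sqGradLaw hu
  have hμ := S.clippedMean_pos (norm_unitDir hx)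
  have hle := (S.clippedMean_mem_Icc (norm_unitDir hx)).2
  rw [S.integral_clippedRatio hx]
  exact (integral_min_le_max (S.ae_nonneg_sqGradLaw hu) S.one_lt S.α_pos.le hμ
    (S.concentrated _ hu) _).trans (max_le_max le_rfl hle)

/-- All gradients at x are orthogonal to x. If no nonzero orthogonal vector existed they would all
vanish, and so would the clipped mean; thus positivity of the least clipped mean rules out dimension
one. -/
theorem exists_orthogonal [IsProbabilityMeasure ν] (S : ClippedSetting L ν C α η lam)
    (hx : ‖x‖ = 1) : ∃ e : EuclideanSpace ℝ (Fin d), e ≠ 0 ∧ inner ℝ x e = 0 := by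
  have hx0 : x ≠ 0 := norm_ne_zero_iff.1 (by rw [hx]; exact one_ne_zero)
  have hμ := S.clippedMean_pos hx
  have := S.isProbabilityMeasure_sqGradLaw hx0
  have hfix := (clippedMean_mem (S.ae_nonneg_sqGradLaw hx0) S.one_lt).2
  by_contra! hno
  have hz : ∀ γ, gradient (L γ) x = 0 := by
    intro γ
    by_contra hne
    apply hno _ hne
    rw [real_inner_comm]
    exact (S.scaleInvariant γ).inner_gradient_self hx0
      ((S.contDiffOn γ).differentiableAt_off_zero one_ne_zero hx0)
  rw [S.integral_min_sqGradLaw hx0] at hfix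
  have hC : 0 ≤ C * clippedMean (sqGradLaw L ν x) C := by
    have := S.one_lt
    positivity
  simp only [hz, norm_zero, ne_eq, OfNat.ofNat_ne_zero, not_false_eq_true, zero_pow,
    min_eq_left hC, integral_zero] at hfix
  linarith

end ClippedSetting

/-! ### Recursions driven by independent noise: exponential drift and Azuma–Hoeffding -/

section recursion

variable {Ω Γ β : Type*} [MeasurableSpace Γ] [MeasurableSpace β] {γ : ℕ → Ω → Γ} {Φ : ℕ → β × Γ → β} {Y : ℕ → Ω → β}
  {y₀ : β}

theorem exists_measurable_of_recursion (hΦ : ∀ n, Measurable (Φ n)) (h0 : ∀ ω, Y 0 ω = y₀)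
    (hY : ∀ n ω, Y (n + 1) ω = Φ n (Y n ω, γ n ω)) (n : ℕ) :
    ∃ F : (Finset.range n → Γ) → β, Measurable F ∧ ∀ ω, Y n ω = F fun i => γ i ω := by
  induction n with
  | zero => exact ⟨fun _ => y₀, measurable_const, h0⟩
  | succ n ih =>
    obtain ⟨F, hF, hYF⟩ := ih
    refine ⟨fun h => Φ n (F fun i => h ⟨i, Finset.mem_range.2
      ((Finset.mem_range.1 i.2).trans n.lt_succ_self)⟩, h ⟨n, Finset.self_mem_range_succ n⟩),
      ?_, fun ω => ?_⟩
    · exact (hΦ n).comp ((hF.comp (measurable_pi_lambda _ fun i => measurable_pi_apply _)).prodMk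
        (measurable_pi_apply _))
    · rw [hY, hYF]

variable [MeasurableSpace Ω] {P : Measure Ω} {ν : Measure Γ}

theorem measurable_of_recursion (hγ : ∀ n, Measurable (γ n)) (hΦ : ∀ n, Measurable (Φ n))
    (h0 : ∀ ω, Y 0 ω = y₀) (hY : ∀ n ω, Y (n + 1) ω = Φ n (Y n ω, γ n ω)) (n : ℕ) :
    Measurable (Y n) := by
  obtain ⟨F, hF, hYF⟩ := exists_measurable_of_recursion hΦ h0 hY n
  rw [show Y n = fun ω => F fun i => γ i ω from funext hYF]
  exact hF.comp (measurable_pi_lambda _ fun i => hγ i)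

theorem indepFun_of_recursion (hγ : ∀ n, Measurable (γ n)) (hind : iIndepFun γ P)
    (hΦ : ∀ n, Measurable (Φ n)) (h0 : ∀ ω, Y 0 ω = y₀)
    (hY : ∀ n ω, Y (n + 1) ω = Φ n (Y n ω, γ n ω)) (n : ℕ) :
    IndepFun (Y n) (γ n) P := by
  obtain ⟨F, hF, hYF⟩ := exists_measurable_of_recursion hΦ h0 hY n
  have h := hind.indepFun_finset (Finset.range n) {n} (by simp) hγ
  have h2 := h.comp hF (measurable_pi_apply (⟨n, Finset.mem_singleton_self n⟩ : ({n} : Finset ℕ)))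
  rw [show Y n = fun ω => F fun i => γ i ω from funext hYF]
  exact h2

/-- Plays the role of conditioning on the past: the current state depends only on earlier samples,
so its joint law with the next sample is a product and Tonelli applies. The one-step bound is
required only at states that the path visits. -/
theorem lintegral_comp_le_of_recursion [IsProbabilityMeasure P] [IsProbabilityMeasure ν]
    (hγ : ∀ n, Measurable (γ n)) (hind : iIndepFun γ P) (hν : ∀ n, P.map (γ n) = ν)
    (hΦ : ∀ n, Measurable (Φ n)) (h0 : ∀ ω, Y 0 ω = y₀)
    (hY : ∀ n ω, Y (n + 1) ω = Φ n (Y n ω, γ n ω)) (n : ℕ)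
    {F : β × Γ → ENNReal} (hF : Measurable F) {G : β → ENNReal}
    (hFG : ∀ ω, ∫⁻ c, F (Y n ω, c) ∂ν ≤ G (Y n ω)) :
    ∫⁻ ω, F (Y n ω, γ n ω) ∂P ≤ ∫⁻ ω, G (Y n ω) ∂P := by
  have hm := measurable_of_recursion hγ hΦ h0 hY n
  have hi := (indepFun_iff_map_prod_eq_prod_map_map hm.aemeasurable (hγ n).aemeasurable).1
    (indepFun_of_recursion hγ hind hΦ h0 hY n)
  have := Measure.isProbabilityMeasure_map (μ := P) hm.aemeasurable
  rw [hν n] at hi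
  calc ∫⁻ ω, F (Y n ω, γ n ω) ∂P
      = ∫⁻ p, F p ∂(P.map fun ω => (Y n ω, γ n ω)) := (lintegral_map hF (hm.prodMk (hγ n))).symm
    _ = ∫⁻ y, ∫⁻ c, F (y, c) ∂ν ∂(P.map (Y n)) := by rw [hi, lintegral_prod _ hF.aemeasurable]
    _ = ∫⁻ ω, ∫⁻ c, F (Y n ω, c) ∂ν ∂P := lintegral_map hF.lintegral_prod_right' hm
    _ ≤ _ := lintegral_mono hFG

/-- Iterates the drift. The decay of the additive constants is discarded, so they accumulate to
n·exp(θb); the logarithm in the step-size hypothesis pays for this. -/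
theorem lintegral_exp_le_of_drift [IsProbabilityMeasure P] [IsProbabilityMeasure ν]
    (hγ : ∀ n, Measurable (γ n)) (hind : iIndepFun γ P) (hν : ∀ n, P.map (γ n) = ν)
    (hΦ : ∀ n, Measurable (Φ n)) (h0 : ∀ ω, Y 0 ω = y₀)
    (hY : ∀ n ω, Y (n + 1) ω = Φ n (Y n ω, γ n ω))
    {v : β → ℝ} (hv : Measurable v) {θ r b : ℝ} (hr : 0 ≤ r)
    (hdrift : ∀ n ω, ∫⁻ c, ENNReal.ofReal (Real.exp (θ * v (Φ n (Y n ω, c)))) ∂ν ≤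
      ENNReal.ofReal (Real.exp (-r)) * ENNReal.ofReal (Real.exp (θ * v (Y n ω))) +
        ENNReal.ofReal (Real.exp (θ * b))) (n : ℕ) :
    ∫⁻ ω, ENNReal.ofReal (Real.exp (θ * v (Y n ω))) ∂P ≤
      ENNReal.ofReal (Real.exp (θ * v y₀ - n * r) + n * Real.exp (θ * b)) := by
  induction n with
  | zero => simp [h0]
  | succ n ih =>
    have hm := measurable_of_recursion hγ hΦ h0 hY n
    calc ∫⁻ ω, ENNReal.ofReal (Real.exp (θ * v (Y (n + 1) ω))) ∂P
        = ∫⁻ ω, ENNReal.ofReal (Real.exp (θ * v (Φ n (Y n ω, γ n ω)))) ∂P := by simp only [hY]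
      _ ≤ ∫⁻ ω, (ENNReal.ofReal (Real.exp (-r)) * ENNReal.ofReal (Real.exp (θ * v (Y n ω))) +
            ENNReal.ofReal (Real.exp (θ * b))) ∂P :=
          lintegral_comp_le_of_recursion hγ hind hν hΦ h0 hY n
            (F := fun p => ENNReal.ofReal (Real.exp (θ * v (Φ n p))))
            (G := fun y => ENNReal.ofReal (Real.exp (-r)) * ENNReal.ofReal (Real.exp (θ * v y)) +
              ENNReal.ofReal (Real.exp (θ * b)))
            (((hv.comp (hΦ n)).const_mul θ).exp.ennreal_ofReal) (hdrift n)
      _ = ENNReal.ofReal (Real.exp (-r)) * ∫⁻ ω, ENNReal.ofReal (Real.exp (θ * v (Y n ω))) ∂P +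
            ENNReal.ofReal (Real.exp (θ * b)) := by
          have hm2 : Measurable fun ω => ENNReal.ofReal (Real.exp (θ * v (Y n ω))) :=
            ((hv.comp hm).const_mul θ).exp.ennreal_ofReal
          rw [lintegral_add_right _ measurable_const, lintegral_const_mul _ hm2]
          simp
      _ ≤ ENNReal.ofReal (Real.exp (-r)) *
            ENNReal.ofReal (Real.exp (θ * v y₀ - n * r) + n * Real.exp (θ * b)) +
            ENNReal.ofReal (Real.exp (θ * b)) := by gcongr
      _ = ENNReal.ofReal (Real.exp (-r) * (Real.exp (θ * v y₀ - n * r) + n * Real.exp (θ * b)) +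
            Real.exp (θ * b)) := by
          rw [← ENNReal.ofReal_mul (Real.exp_pos _).le,
            ← ENNReal.ofReal_add (by positivity) (by positivity)]
      _ ≤ _ := by
          apply ENNReal.ofReal_le_ofReal
          have e : Real.exp (-r) * Real.exp (θ * v y₀ - n * r) =
              Real.exp (θ * v y₀ - ((n + 1 : ℕ) : ℝ) * r) := by
            rw [← Real.exp_add]; congr 1; push_cast; ring
          have h1 : Real.exp (-r) ≤ 1 := Real.exp_le_one_iff.2 (by linarith)
          have h2 : Real.exp (-r) * (n * Real.exp (θ * b)) ≤ 1 * (n * Real.exp (θ * b)) := by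
            gcongr
          rw [mul_add, e]
          push_cast
          linarith

theorem measureReal_le_of_lintegral_exp [IsProbabilityMeasure P] {g : Ω → ℝ} (hg : Measurable g)
    {a B : ℝ} (hB : 0 ≤ B)
    (h : ∫⁻ ω, ENNReal.ofReal (Real.exp (g ω)) ∂P ≤ ENNReal.ofReal B) :
    P.real {ω | a ≤ g ω} ≤ B * Real.exp (-a) := by
  have hm := mul_meas_ge_le_lintegral (μ := P) hg.exp.ennreal_ofReal
    (ENNReal.ofReal (Real.exp a))
  have hsub : P {ω | a ≤ g ω} ≤
      P {ω | ENNReal.ofReal (Real.exp a) ≤ ENNReal.ofReal (Real.exp (g ω))} :=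
    measure_mono fun ω (hω : a ≤ g ω) => ENNReal.ofReal_le_ofReal (Real.exp_le_exp.2 hω)
  have h2 : ENNReal.ofReal (Real.exp a) * P {ω | a ≤ g ω} ≤ ENNReal.ofReal B :=
    (mul_le_mul_right hsub _).trans (hm.trans h)
  have h3 := ENNReal.toReal_mono ENNReal.ofReal_ne_top h2
  rw [ENNReal.toReal_mul, ENNReal.toReal_ofReal (Real.exp_pos a).le, ENNReal.toReal_ofReal hB] at h3
  rw [Real.exp_neg, ← div_eq_mul_inv, le_div_iff₀ (Real.exp_pos a), measureReal_def]
  linarith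

theorem lintegral_exp_sub_integral_le [IsProbabilityMeasure ν] {g : Γ → ℝ} (hg : Measurable g)
    {a B : ℝ} (hB : 0 ≤ B) (h : ∀ c, g c ∈ Set.Icc a (a + B)) (s : ℝ) :
    ∫⁻ c, ENNReal.ofReal (Real.exp (s * (g c - ∫ c', g c' ∂ν))) ∂ν ≤
      ENNReal.ofReal (Real.exp (s ^ 2 * B ^ 2 / 8)) := by
  have hs := hasSubgaussianMGF_of_mem_Icc (μ := ν) hg.aemeasurable
    (Filter.Eventually.of_forall h)
  rw [← ofReal_integral_eq_lintegral_ofReal (hs.integrable_exp_mul s)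
    (Filter.Eventually.of_forall fun c => (Real.exp_pos _).le)]
  apply ENNReal.ofReal_le_ofReal
  refine (hs.mgf_le s).trans (le_of_eq ?_)
  congr 1
  simp only [add_sub_cancel_left, NNReal.coe_pow, NNReal.coe_div, coe_nnnorm, Real.norm_eq_abs,
    abs_of_nonneg hB, NNReal.coe_ofNat]
  ring

/-- Azuma–Hoeffding for the centred increments `ζ (Y k) (γ k) - E ζ (Y k) ·` of a recursion driven
by independent noise, restricted to the times `k ≥ m` at which `Y k` lies in `D`. -/
theorem lintegral_exp_sum_le [IsProbabilityMeasure P] [IsProbabilityMeasure ν]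
    (hγ : ∀ n, Measurable (γ n)) (hind : iIndepFun γ P) (hν : ∀ n, P.map (γ n) = ν)
    (hΦ : ∀ n, Measurable (Φ n)) (h0 : ∀ ω, Y 0 ω = y₀)
    (hY : ∀ n ω, Y (n + 1) ω = Φ n (Y n ω, γ n ω))
    {ζ : β → Γ → ℝ} (hζ : Measurable (Function.uncurry ζ)) {D : Set β} (hD : MeasurableSet D)
    {B : ℝ} (hB : 0 ≤ B) (hbd : ∀ y ∈ D, ∃ a, ∀ c, ζ y c ∈ Set.Icc a (a + B)) (m : ℕ) (s : ℝ)
    (n : ℕ) :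
    ∫⁻ ω, ENNReal.ofReal (Real.exp (s * ∑ k ∈ Finset.range n, if m ≤ k then
        D.indicator (fun y => ζ y (γ k ω) - ∫ c, ζ y c ∂ν) (Y k ω) else 0)) ∂P ≤
      ENNReal.ofReal (Real.exp ((n - m : ℕ) * (s ^ 2 * B ^ 2 / 8))) := by
  have hint : Measurable fun y => ∫ c, ζ y c ∂ν :=
    (hζ.stronglyMeasurable.integral_prod_right (ν := ν)).measurable
  have hξ : Measurable fun p : β × Γ =>
      D.indicator (fun y => ζ y p.2 - ∫ c, ζ y c ∂ν) p.1 := by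
    have : (fun p : β × Γ => D.indicator (fun y => ζ y p.2 - ∫ c, ζ y c ∂ν) p.1) =
        (Prod.fst ⁻¹' D).indicator fun p : β × Γ => ζ p.1 p.2 - ∫ c, ζ p.1 c ∂ν := by
      funext p
      by_cases hp : p.1 ∈ D
      · simp [Set.indicator, hp]
      · simp [Set.indicator, hp]
    rw [this]
    exact (hζ.sub (hint.comp measurable_fst)).indicator (measurable_fst hD)
  set S : ℕ → Ω → ℝ := fun n ω => ∑ k ∈ Finset.range n, if m ≤ k then
    D.indicator (fun y => ζ y (γ k ω) - ∫ c, ζ y c ∂ν) (Y k ω) else 0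
  -- Adjoining the running sum to the state gives another recursion driven by the same noise, so the
  -- one-step lemma applies to the pair.
  set Ψ : ℕ → (β × ℝ) × Γ → β × ℝ := fun n p => (Φ n (p.1.1, p.2), p.1.2 + if m ≤ n then
    D.indicator (fun y => ζ y p.2 - ∫ c, ζ y c ∂ν) p.1.1 else 0)
  have hincr : ∀ n, Measurable fun p : (β × ℝ) × Γ => if m ≤ n then
      D.indicator (fun y => ζ y p.2 - ∫ c, ζ y c ∂ν) p.1.1 else 0 := by
    intro n
    by_cases h : m ≤ n
    · simp only [h, if_true]
      exact hξ.comp ((measurable_fst.comp measurable_fst).prodMk measurable_snd)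
    · simp only [h, if_false]
      exact measurable_const
  have hΨ : ∀ n, Measurable (Ψ n) := fun n =>
    ((hΦ n).comp ((measurable_fst.comp measurable_fst).prodMk measurable_snd)).prodMk
      ((measurable_snd.comp measurable_fst).add (hincr n))
  have hZ0 : ∀ ω, (fun n ω => (Y n ω, S n ω)) 0 ω = (y₀, 0) := fun ω => by simp [h0, S]
  have hZ : ∀ n ω, (fun n ω => (Y n ω, S n ω)) (n + 1) ω =
      Ψ n ((fun n ω => (Y n ω, S n ω)) n ω, γ n ω) := by
    intro n ω
    simp only [hY, Ψ, S, Finset.sum_range_succ]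
  induction n with
  | zero => simp
  | succ n ih =>
    set q : ℝ := if m ≤ n then s ^ 2 * B ^ 2 / 8 else 0
    have hS : ∀ ω, S (n + 1) ω = S n ω + if m ≤ n then
        D.indicator (fun y => ζ y (γ n ω) - ∫ c, ζ y c ∂ν) (Y n ω) else 0 :=
      fun ω => Finset.sum_range_succ _ _
    have hq0 : 0 ≤ q := by
      simp only [q]; split_ifs <;> positivity
    have hstep : ∫⁻ ω, ENNReal.ofReal (Real.exp (s * S (n + 1) ω)) ∂P ≤
        ∫⁻ ω, ENNReal.ofReal (Real.exp (s * S n ω)) * ENNReal.ofReal (Real.exp q) ∂P := by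
      simp only [hS]
      refine lintegral_comp_le_of_recursion (Y := fun n ω => (Y n ω, S n ω)) hγ hind hν hΨ hZ0 hZ n
        (F := fun p => ENNReal.ofReal (Real.exp (s * (p.1.2 + if m ≤ n then
          D.indicator (fun y => ζ y p.2 - ∫ c, ζ y c ∂ν) p.1.1 else 0))))
        (G := fun z => ENNReal.ofReal (Real.exp (s * z.2)) * ENNReal.ofReal (Real.exp q))
        ?_ fun ω => ?_
      · exact (((measurable_snd.comp measurable_fst).add (hincr n)).const_mul s).exp.ennreal_ofReal
      · simp only [mul_add, Real.exp_add]
        simp only [ENNReal.ofReal_mul (Real.exp_pos _).le]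
        rw [lintegral_const_mul']
        swap
        · exact ENNReal.ofReal_ne_top
        gcongr
        by_cases h : m ≤ n
        · by_cases hy : Y n ω ∈ D
          · obtain ⟨a, ha⟩ := hbd _ hy
            simp only [h, if_true, Set.indicator, hy, q]
            exact lintegral_exp_sub_integral_le hζ.of_uncurry_left hB ha s
          · simp only [h, if_true, Set.indicator, hy, if_false, mul_zero, Real.exp_zero]
            simpa using hq0
        · simp [h, q]
    refine hstep.trans ?_
    rw [lintegral_mul_const' _ _ ENNReal.ofReal_ne_top]
    refine (mul_le_mul_left ih _).trans ?_
    rw [← ENNReal.ofReal_mul (Real.exp_pos _).le, ← Real.exp_add]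
    apply ENNReal.ofReal_le_ofReal
    apply Real.exp_le_exp.2
    by_cases h : m ≤ n
    · rw [Nat.succ_sub h]
      simp only [q, h, if_true]
      push_cast
      linarith
    · have h1 : n - m = 0 := by omega
      have h2 : n + 1 - m = 0 := by omega
      simp [q, h, h1, h2]

theorem measureReal_le_sum_le [IsProbabilityMeasure P] [IsProbabilityMeasure ν]
    (hγ : ∀ n, Measurable (γ n)) (hind : iIndepFun γ P) (hν : ∀ n, P.map (γ n) = ν)
    (hΦ : ∀ n, Measurable (Φ n)) (h0 : ∀ ω, Y 0 ω = y₀)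
    (hY : ∀ n ω, Y (n + 1) ω = Φ n (Y n ω, γ n ω))
    {ζ : β → Γ → ℝ} (hζ : Measurable (Function.uncurry ζ)) {D : Set β} (hD : MeasurableSet D)
    {B : ℝ} (hB : 0 < B) (hbd : ∀ y ∈ D, ∃ a, ∀ c, ζ y c ∈ Set.Icc a (a + B)) {m n : ℕ}
    (hmn : m < n) {δ : ℝ} (hδ : 0 < δ) (hδ1 : δ ≤ 1) :
    P.real {ω | B * √(((n : ℝ) - m) * Real.log (1 / δ)) ≤ ∑ k ∈ Finset.range n, if m ≤ k then
        D.indicator (fun y => ζ y (γ k ω) - ∫ c, ζ y c ∂ν) (Y k ω) else 0} ≤ δ := by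
  set S : Ω → ℝ := fun ω => ∑ k ∈ Finset.range n, if m ≤ k then
    D.indicator (fun y => ζ y (γ k ω) - ∫ c, ζ y c ∂ν) (Y k ω) else 0
  have hN : (0 : ℝ) < (n : ℝ) - m := sub_pos.2 (Nat.cast_lt.2 hmn)
  have hℓ : 0 ≤ Real.log (1 / δ) := Real.log_nonneg (by rw [le_div_iff₀ hδ]; linarith)
  set N : ℝ := (n : ℝ) - m
  set ℓ := Real.log (1 / δ)
  have hsq : √(N * ℓ) ^ 2 = N * ℓ := Real.sq_sqrt (by positivity)
  -- The minimiser of N s²B²/8 - sB√(Nℓ). The optimal exponent is -2ℓ, of which only -ℓ is used.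
  set s : ℝ := 4 * √(N * ℓ) / (N * B)
  have hs : 0 ≤ s := by positivity
  have hmeasS : Measurable S := by
    refine Finset.measurable_sum _ fun k _ => ?_
    by_cases h : m ≤ k
    · simp only [h, if_true]
      have hYk := measurable_of_recursion hγ hΦ h0 hY k
      have hint : Measurable fun y => ∫ c, ζ y c ∂ν :=
        (hζ.stronglyMeasurable.integral_prod_right (ν := ν)).measurable
      exact ((hζ.comp (hYk.prodMk (hγ k))).sub (hint.comp hYk)).indicator (hYk hD)
    · simp only [h, if_false]
      exact measurable_const
  have h := measureReal_le_of_lintegral_exp (hmeasS.const_mul s)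
    (a := s * (B * √(N * ℓ))) (Real.exp_pos _).le
    (lintegral_exp_sum_le hγ hind hν hΦ h0 hY hζ hD hB.le hbd m s n)
  have hsub : P.real {ω | B * √(N * ℓ) ≤ S ω} ≤ P.real {ω | s * (B * √(N * ℓ)) ≤ s * S ω} :=
    measureReal_mono fun ω (hω : B * √(N * ℓ) ≤ S ω) => mul_le_mul_of_nonneg_left hω hs
  refine hsub.trans (h.trans ?_)
  rw [← Real.exp_add, Nat.cast_sub hmn.le]
  have e1 : N * (s ^ 2 * B ^ 2 / 8) = 2 * ℓ := by
    simp only [s, div_pow, mul_pow, hsq]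
    field_simp
    ring
  have e2 : s * (B * √(N * ℓ)) = 4 * ℓ := by
    have : s * (B * √(N * ℓ)) = 4 * √(N * ℓ) ^ 2 / N := by
      simp only [s]
      field_simp
    rw [this, hsq]
    field_simp
  calc Real.exp (((n : ℝ) - m) * (s ^ 2 * B ^ 2 / 8) + -(s * (B * √(N * ℓ))))
      = Real.exp (-(2 * ℓ)) := by
        rw [show ((n : ℝ) - m) * (s ^ 2 * B ^ 2 / 8) = N * (s ^ 2 * B ^ 2 / 8) from rfl, e1, e2]
        congr 1
        ring
    _ ≤ Real.exp (-ℓ) := Real.exp_le_exp.2 (by linarith)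
    _ = δ := by
        simp only [ℓ]
        rw [one_div, Real.log_inv, neg_neg, Real.exp_log hδ]

/-- The strict inequality admits B = 0, which occurs when ρ = 0: the centred increments then vanish
identically on D. -/
theorem measureReal_lt_sum_le [IsProbabilityMeasure P] [IsProbabilityMeasure ν]
    (hγ : ∀ n, Measurable (γ n)) (hind : iIndepFun γ P) (hν : ∀ n, P.map (γ n) = ν)
    (hΦ : ∀ n, Measurable (Φ n)) (h0 : ∀ ω, Y 0 ω = y₀)
    (hY : ∀ n ω, Y (n + 1) ω = Φ n (Y n ω, γ n ω))
    {ζ : β → Γ → ℝ} (hζ : Measurable (Function.uncurry ζ)) {D : Set β} (hD : MeasurableSet D)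
    {B : ℝ} (hB : 0 ≤ B) (hbd : ∀ y ∈ D, ∃ a, ∀ c, ζ y c ∈ Set.Icc a (a + B)) {m n : ℕ}
    (hmn : m < n) {δ : ℝ} (hδ : 0 < δ) (hδ1 : δ ≤ 1) :
    P.real {ω | B * √(((n : ℝ) - m) * Real.log (1 / δ)) < ∑ k ∈ Finset.range n, if m ≤ k then
        D.indicator (fun y => ζ y (γ k ω) - ∫ c, ζ y c ∂ν) (Y k ω) else 0} ≤ δ := by
  rcases hB.eq_or_lt with rfl | hpos
  · have hzero : ∀ k ω, D.indicator (fun y => ζ y (γ k ω) - ∫ c, ζ y c ∂ν) (Y k ω) = 0 := by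
      intro k ω
      by_cases hy : Y k ω ∈ D
      · obtain ⟨a, ha⟩ := hbd _ hy
        have hconst : ∀ c, ζ (Y k ω) c = a := fun c =>
          le_antisymm (by simpa using (ha c).2) (ha c).1
        simp [hy, hconst]
      · simp [hy]
    simp [hzero, hδ.le]
  · refine le_trans ?_
      (measureReal_le_sum_le hγ hind hν hΦ h0 hY hζ hD hpos hbd hmn hδ hδ1)
    refine measureReal_mono fun ω hω => ?_
    rw [Set.mem_ofPred_eq] at hω ⊢
    exact hω.le

end recursion

/-! ### Drift of the log radius outside the target band, and its tail -/

theorem lintegral_ofReal_le_of_le_affine {Γ : Type*} [MeasurableSpace Γ] {ν : Measure Γ}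
    [IsProbabilityMeasure ν] {f y : Γ → ℝ} (hy : Integrable y ν) {p q e : ℝ} (hf : ∀ c, 0 ≤ f c)
    (h : ∀ c, f c ≤ p + q * y c) (he : p + q * ∫ c, y c ∂ν ≤ e) :
    ∫⁻ c, ENNReal.ofReal (f c) ∂ν ≤ ENNReal.ofReal e := by
  have hi : Integrable (fun c => p + q * y c) ν := (integrable_const _).add (hy.const_mul _)
  calc ∫⁻ c, ENNReal.ofReal (f c) ∂ν ≤ ∫⁻ c, ENNReal.ofReal (p + q * y c) ∂ν :=
        lintegral_mono fun c => ENNReal.ofReal_le_ofReal (h c)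
    _ = ENNReal.ofReal (∫ c, (p + q * y c) ∂ν) :=
        (ofReal_integral_eq_lintegral_ofReal hi
          (Filter.Eventually.of_forall fun c => (hf c).trans (h c))).symm
    _ ≤ _ := by
        apply ENNReal.ofReal_le_ofReal
        rw [integral_add (integrable_const _) (hy.const_mul _), integral_const_mul]
        simpa using he

theorem log_three_halves_add_le {a : ℝ} (ha : a ≤ 1 / 16) :
    Real.log (3 / 2) + a ≤ Real.log (8 / 5) := by
  have h := Real.one_sub_inv_le_log_of_pos (by norm_num : (0 : ℝ) < 16 / 15)
  have e : Real.log (8 / 5) = Real.log (3 / 2) + Real.log (16 / 15) := by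
    rw [← Real.log_mul (by norm_num) (by norm_num)]
    norm_num
  norm_num at h
  linarith

namespace ClippedSetting

variable {d : ℕ} {Γ : Type*} [MeasurableSpace Γ] {L : Γ → EuclideanSpace ℝ (Fin d) → ℝ}
  {ν : Measure Γ} [IsProbabilityMeasure ν] {C α η lam θ : ℝ} {x : EuclideanSpace ℝ (Fin d)}

theorem max_pos (S : ClippedSetting L ν C α η lam) (hx : x ≠ 0) : 0 < clippedMeanMax L ν C :=
  (S.clippedMean_pos (norm_unitDir hx)).trans_le (S.clippedMean_mem_Icc (norm_unitDir hx)).2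

theorem lintegral_exp_logIncrement_le (S : ClippedSetting L ν C α η lam) (hx : x ≠ 0)
    (hθ : 0 ≤ θ) (hθC : 160 * (η * lam * θ * C) = α)
    (h : 3 / 2 * clippedMeanMax L ν C ≤ effRadius η lam x ^ 2) :
    ∫⁻ γ, ENNReal.ofReal (Real.exp (θ *
      logIncrement (η * lam) (clippedRatio L C η lam x γ))) ∂ν ≤
      ENNReal.ofReal (Real.exp (-(α * (η * lam * θ)))) := by
  have hε := S.eps_pos
  have hα1 := S.alpha_le_one hx
  have hε1 := S.one_lt_inv_eps hα1
  have hs := S.small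
  have hC := S.one_lt
  refine lintegral_ofReal_le_of_le_affine (S.integrable_clippedRatio hx)
    (p := Real.exp (2 * (η * lam) ^ 2 * θ) *
      (1 - 4 * (η * lam * θ) + 16 * (η * lam * θ) ^ 2))
    (q := Real.exp (2 * (η * lam) ^ 2 * θ) *
      (4 * (η * lam * θ) + 16 * (η * lam * θ) ^ 2 * C))
    (fun γ => (Real.exp_pos _).le) (fun γ => ?_) ?_
  · refine (exp_logIncrement_le hε (by linarith) hC hθ (by linarith) (clippedRatio_nonneg x γ)
      (S.clippedRatio_le hx γ)).trans (le_of_eq (by ring))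
  · refine le_trans (le_of_eq (by ring)) (exp_logIncrement_mean_le hε hC S.α_pos ?_ hθ hθC
      (integral_nonneg (clippedRatio_nonneg x)) (S.integral_clippedRatio_le hx h))
    nlinarith

theorem lintegral_exp_neg_logIncrement_le (S : ClippedSetting L ν C α η lam) (hx : x ≠ 0)
    (hθ : 0 ≤ θ) (hθC : 160 * (η * lam * θ * C) = α)
    (h : 3 / 2 * effRadius η lam x ^ 2 ≤ clippedMeanMin L ν C) :
    ∫⁻ γ, ENNReal.ofReal (Real.exp (-(θ *
      logIncrement (η * lam) (clippedRatio L C η lam x γ)))) ∂ν ≤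
      ENNReal.ofReal (Real.exp (-(α * (η * lam * θ)))) := by
  have hε := S.eps_pos
  have hα1 := S.alpha_le_one hx
  have hs := S.small
  have hC := S.one_lt
  have hα := S.α_pos
  refine lintegral_ofReal_le_of_le_affine (S.integrable_clippedRatio hx)
    (p := 1 + 4 * (η * lam * θ) * (1 + 12 * (η * lam * C)) + 40 * (η * lam * θ) ^ 2 * C)
    (q := 4 * (η * lam * θ) * (-1 + 12 * (η * lam * C)) + 40 * (η * lam * θ) ^ 2 * C)
    (fun γ => (Real.exp_pos _).le) (fun γ => ?_) ?_
  · refine (exp_neg_logIncrement_le hε hC (by linarith) hθ (by linarith) (clippedRatio_nonneg x γ)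
      (S.clippedRatio_le hx γ)).trans (le_of_eq (by ring))
  · exact le_trans (le_of_eq (by ring)) (exp_neg_logIncrement_mean_le hε hC hα hα1
      (by linarith) hθ hθC (S.integral_clippedRatio_ge hx h))

/-- Above the level (3/2)μmax the exponential contracts and the additive term is unnecessary. Below
it, the log increment is at most 1/16, so a single step stays below (8/5)μmax and the additive term
suffices alone. -/
theorem drift_upper (S : ClippedSetting L ν C α η lam) (hx : x ≠ 0)
    (hθ : 0 ≤ θ) (hθC : 160 * (η * lam * θ * C) = α) :
    ∫⁻ γ, ENNReal.ofReal (Real.exp (θ * (Real.log (effRadius η lam (sgdStep L C η lam x γ) ^ 2) -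
      Real.log (clippedMeanMax L ν C)))) ∂ν ≤
      ENNReal.ofReal (Real.exp (-(α * (η * lam * θ)))) * ENNReal.ofReal (Real.exp
        (θ * (Real.log (effRadius η lam x ^ 2) - Real.log (clippedMeanMax L ν C)))) +
      ENNReal.ofReal (Real.exp (θ * Real.log (8 / 5))) := by
  have hα1 := S.alpha_le_one hx
  have hR := effRadius_pos S.η_pos S.lam_pos hx
  have hμ := S.max_pos hx
  rcases le_or_gt (3 / 2 * clippedMeanMax L ν C) (effRadius η lam x ^ 2) with h | h
  · refine le_trans ?_ le_self_add
    have e : ∀ γ, θ * (Real.log (effRadius η lam (sgdStep L C η lam x γ) ^ 2) -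
        Real.log (clippedMeanMax L ν C)) =
        θ * logIncrement (η * lam) (clippedRatio L C η lam x γ) +
          θ * (Real.log (effRadius η lam x ^ 2) - Real.log (clippedMeanMax L ν C)) := fun γ => by
      rw [S.log_effRadius_sgdStep hα1 hx]; ring
    simp only [e, Real.exp_add, ENNReal.ofReal_mul (Real.exp_pos _).le]
    rw [lintegral_mul_const' _ _ ENNReal.ofReal_ne_top]
    gcongr
    exact S.lintegral_exp_logIncrement_le hx hθ hθC h
  · refine le_trans ?_ le_add_self
    calc _ ≤ ∫⁻ _, ENNReal.ofReal (Real.exp (θ * Real.log (8 / 5))) ∂ν := by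
          refine lintegral_mono fun γ => ENNReal.ofReal_le_ofReal (Real.exp_le_exp.2
            (mul_le_mul_of_nonneg_left ?_ hθ))
          rw [S.log_effRadius_sgdStep hα1 hx]
          have h1 : Real.log (effRadius η lam x ^ 2) ≤
              Real.log (3 / 2) + Real.log (clippedMeanMax L ν C) := by
            rw [← Real.log_mul (by norm_num) hμ.ne']
            exact Real.log_le_log (by positivity) h.le
          have hε := S.eps_pos
          have hε1 := S.one_lt_inv_eps hα1
          have h2 := logIncrement_le hε (by linarith) (clippedRatio_nonneg (L := L) (C := C) (η := η) (lam := lam) x γ)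
          have h3 := mul_le_mul_of_nonneg_left (S.clippedRatio_le hx γ) hε.le
          have h4 := log_three_halves_add_le
            (a := logIncrement (η * lam) (clippedRatio L C η lam x γ))
            (by nlinarith [S.small])
          linarith
      _ = _ := by simp

/-- The mirror image of `drift_upper`, with contraction when R² is at most (2/3)μmin. -/
theorem drift_lower (S : ClippedSetting L ν C α η lam) (hx : x ≠ 0)
    (hθ : 0 ≤ θ) (hθC : 160 * (η * lam * θ * C) = α) :
    ∫⁻ γ, ENNReal.ofReal (Real.exp (θ * (Real.log (clippedMeanMin L ν C) -
      Real.log (effRadius η lam (sgdStep L C η lam x γ) ^ 2)))) ∂ν ≤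
      ENNReal.ofReal (Real.exp (-(α * (η * lam * θ)))) * ENNReal.ofReal (Real.exp
        (θ * (Real.log (clippedMeanMin L ν C) - Real.log (effRadius η lam x ^ 2)))) +
      ENNReal.ofReal (Real.exp (θ * Real.log (8 / 5))) := by
  have hα1 := S.alpha_le_one hx
  have hR := effRadius_pos S.η_pos S.lam_pos hx
  have hμ := S.min_pos
  rcases le_or_gt (3 / 2 * effRadius η lam x ^ 2) (clippedMeanMin L ν C) with h | h
  · refine le_trans ?_ le_self_add
    have e : ∀ γ, θ * (Real.log (clippedMeanMin L ν C) -
        Real.log (effRadius η lam (sgdStep L C η lam x γ) ^ 2)) =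
        -(θ * logIncrement (η * lam) (clippedRatio L C η lam x γ)) +
          θ * (Real.log (clippedMeanMin L ν C) - Real.log (effRadius η lam x ^ 2)) := fun γ => by
      rw [S.log_effRadius_sgdStep hα1 hx]; ring
    simp only [e, Real.exp_add, ENNReal.ofReal_mul (Real.exp_pos _).le]
    rw [lintegral_mul_const' _ _ ENNReal.ofReal_ne_top]
    gcongr
    exact S.lintegral_exp_neg_logIncrement_le hx hθ hθC h
  · refine le_trans ?_ le_add_self
    calc _ ≤ ∫⁻ _, ENNReal.ofReal (Real.exp (θ * Real.log (8 / 5))) ∂ν := by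
          refine lintegral_mono fun γ => ENNReal.ofReal_le_ofReal (Real.exp_le_exp.2
            (mul_le_mul_of_nonneg_left ?_ hθ))
          rw [S.log_effRadius_sgdStep hα1 hx]
          have h1 : Real.log (clippedMeanMin L ν C) ≤
              Real.log (3 / 2) + Real.log (effRadius η lam x ^ 2) := by
            rw [← Real.log_mul (by norm_num) (by positivity)]
            exact Real.log_le_log hμ h.le
          have hε := S.eps_pos
          have hε1 := S.one_lt_inv_eps hα1
          have hy := clippedRatio_nonneg (L := L) (C := C) (η := η) (lam := lam) x γ
          have hC := S.one_lt
          have hs := S.small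
          have hb : 0 ≤ η * lam * C := by positivity
          have h2 := neg_logIncrement_le hε hC (by linarith) hy (S.clippedRatio_le hx γ)
          have h3 := mul_le_mul_of_nonneg_left (S.clippedRatio_le hx γ) hε.le
          have h4 := log_three_halves_add_le
            (a := -logIncrement (η * lam) (clippedRatio L C η lam x γ)) (by
              refine h2.trans ?_
              have h5 : 12 * (η * lam * C) * (1 + clippedRatio L C η lam x γ) ≤
                  1 * (1 + clippedRatio L C η lam x γ) := by
                gcongr
                linarith
              nlinarith)
          linarith
      _ = _ := by simp

end ClippedSetting

/-- Markov's inequality at level 2, against the level 8/5 of the additive terms: the gap log(5/4) ≥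
1/5 is the rate in the conclusion. -/
theorem tail_le_of_drift {Ω Γ β : Type*} [MeasurableSpace Γ] [MeasurableSpace β]
    [MeasurableSpace Ω] {P : Measure Ω} {ν : Measure Γ} [IsProbabilityMeasure P]
    [IsProbabilityMeasure ν] {γ : ℕ → Ω → Γ} {Φ : ℕ → β × Γ → β} {Y : ℕ → Ω → β} {y₀ : β}
    (hγ : ∀ n, Measurable (γ n)) (hind : iIndepFun γ P) (hν : ∀ n, P.map (γ n) = ν)
    (hΦ : ∀ n, Measurable (Φ n)) (h0 : ∀ ω, Y 0 ω = y₀)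
    (hY : ∀ n ω, Y (n + 1) ω = Φ n (Y n ω, γ n ω))
    {v : β → ℝ} (hv : Measurable v) {θ c : ℝ} (hc : 0 ≤ c) (hθ : 0 ≤ θ)
    (hdrift : ∀ n ω, ∫⁻ c, ENNReal.ofReal (Real.exp (θ * v (Φ n (Y n ω, c)))) ∂ν ≤
      ENNReal.ofReal (Real.exp (-(c * θ))) * ENNReal.ofReal (Real.exp (θ * v (Y n ω))) +
        ENNReal.ofReal (Real.exp (θ * Real.log (8 / 5)))) {n : ℕ} (hn : v y₀ + 1 ≤ n * c) :
    P.real {ω | Real.log 2 < v (Y n ω)} ≤ (n + 1) * Real.exp (-(θ / 5)) := by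
  have h := lintegral_exp_le_of_drift hγ hind hν hΦ h0 hY hv (mul_nonneg hc hθ) hdrift n
  have hm := measurable_of_recursion hγ hΦ h0 hY n
  have h2 := measureReal_le_of_lintegral_exp ((hv.comp hm).const_mul θ) (a := θ * Real.log 2)
    (by positivity) h
  have hsub : P.real {ω | Real.log 2 < v (Y n ω)} ≤
      P.real {ω | θ * Real.log 2 ≤ θ * (v ∘ Y n) ω} :=
    measureReal_mono fun ω (hω : Real.log 2 < v (Y n ω)) =>
      mul_le_mul_of_nonneg_left hω.le hθ
  refine hsub.trans (h2.trans ?_)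
  have hlog2 : 0 ≤ Real.log 2 := Real.log_nonneg (by norm_num)
  have hlog : Real.log (8 / 5) - Real.log 2 ≤ -(1 / 5) := by
    rw [← Real.log_div (by norm_num) (by norm_num)]
    have := Real.log_le_sub_one_of_pos (by norm_num : (0 : ℝ) < 8 / 5 / 2)
    norm_num at this ⊢
    linarith
  rw [add_mul, mul_assoc, ← Real.exp_add, ← Real.exp_add]
  -- The extra 1 in `hn` leaves a factor exp(-θ) after the starting value has been forgotten.
  have e1 : Real.exp (θ * v y₀ - n * (c * θ) + -(θ * Real.log 2)) ≤ Real.exp (-(θ / 5)) := by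
    apply Real.exp_le_exp.2
    nlinarith [mul_nonneg hθ hlog2, mul_le_mul_of_nonneg_left hn hθ]
  have e2 : Real.exp (θ * Real.log (8 / 5) + -(θ * Real.log 2)) ≤ Real.exp (-(θ / 5)) := by
    apply Real.exp_le_exp.2
    nlinarith [mul_le_mul_of_nonneg_left hlog hθ]
  have e3 := mul_le_mul_of_nonneg_left e2 (Nat.cast_nonneg (α := ℝ) n)
  linarith

theorem exp_neg_div_five_le {θ T δ : ℝ} (hδ : 0 < δ) (hT : 0 < T) (h : 10 * Real.log (T / δ ^ 2) ≤ θ) :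
    Real.exp (-(θ / 5)) ≤ (δ ^ 2 / T) ^ 2 := by
  have hpos : 0 < δ ^ 2 / T := by positivity
  rw [← Real.exp_log (pow_pos hpos 2), Real.log_pow]
  apply Real.exp_le_exp.2
  have : Real.log (δ ^ 2 / T) = -Real.log (T / δ ^ 2) := by rw [← Real.log_inv, inv_div]
  rw [this]
  push_cast
  linarith

namespace ClippedSetting

variable {d : ℕ} {Γ : Type*} [MeasurableSpace Γ] {L : Γ → EuclideanSpace ℝ (Fin d) → ℝ}
  {ν : Measure Γ} [IsProbabilityMeasure ν] {C α η lam θ : ℝ} {x₀ : EuclideanSpace ℝ (Fin d)}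
  {Ω : Type*} [MeasurableSpace Ω] {P : Measure Ω} [IsProbabilityMeasure P] {γ : ℕ → Ω → Γ}

/-- With high probability the squared effective radius stays within a factor `2` of the range of
the clipped means from time `T'` on. -/
theorem measureReal_exists_effRadius_le (S : ClippedSetting L ν C α η lam) (hx : x₀ ≠ 0)
    (hγ : ∀ n, Measurable (γ n)) (hind : iIndepFun γ P) (hν : ∀ n, P.map (γ n) = ν)
    (hθC : 160 * (η * lam * θ * C) = α) {δ : ℝ} (hδ : 0 < δ) (hδ1 : δ < 1 / 5) {T T' : ℕ}
    (hθ : 10 * Real.log (T / δ ^ 2) ≤ θ) (hTT : T' < T)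
    (hT' : max (Real.log (effRadius η lam x₀ ^ 2) - Real.log (clippedMeanMax L ν C))
      (Real.log (clippedMeanMin L ν C) - Real.log (effRadius η lam x₀ ^ 2)) + 1 ≤
      T' * (α * (η * lam))) :
    P.real {ω | ∃ t ∈ Finset.Ico T' T,
      Real.log 2 < Real.log (effRadius η lam (clippedSGD L C η lam x₀ (fun s => γ s ω) t) ^ 2) -
        Real.log (clippedMeanMax L ν C) ∨
      Real.log 2 < Real.log (clippedMeanMin L ν C) -
        Real.log (effRadius η lam (clippedSGD L C η lam x₀ (fun s => γ s ω) t) ^ 2)} ≤ 2 * δ := by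
  have hα1 := S.alpha_le_one hx
  have hα := S.α_pos
  have hε := S.eps_pos
  have hT : (1 : ℝ) ≤ T := by exact_mod_cast (by omega : 1 ≤ T)
  have hθ0 : 0 ≤ θ := by
    refine le_trans (mul_nonneg (by norm_num) (Real.log_nonneg ?_)) hθ
    rw [le_div_iff₀ (by positivity)]
    nlinarith
  set Y : ℕ → Ω → EuclideanSpace ℝ (Fin d) :=
    fun t ω => clippedSGD L C η lam x₀ (fun s => γ s ω) t
  have hne : ∀ n ω, Y n ω ≠ 0 := fun n ω => S.clippedSGD_ne_zero hα1 hx _ n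
  have hY : ∀ n ω, Y (n + 1) ω = (fun (_ : ℕ) (p : EuclideanSpace ℝ (Fin d) × Γ) =>
      sgdStep L C η lam p.1 p.2) n (Y n ω, γ n ω) := fun n ω => S.clippedSGD_succ hα1 hx _ n
  have hΦ : ∀ n, Measurable ((fun (_ : ℕ) (p : EuclideanSpace ℝ (Fin d) × Γ) =>
      sgdStep L C η lam p.1 p.2) n) := fun _ => measurable_sgdStep S.contDiffOn S.measurable C η lam
  have hmR : Measurable fun x : EuclideanSpace ℝ (Fin d) =>
      Real.log (effRadius η lam x ^ 2) :=
    (measurable_effRadius.pow_const 2).log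
  have hcθ : α * (η * lam) * θ = α * (η * lam * θ) := by ring
  have hU : ∀ t ∈ Finset.Ico T' T, P.real {ω | Real.log 2 < Real.log (effRadius η lam (Y t ω) ^ 2)
      - Real.log (clippedMeanMax L ν C)} ≤ T * (δ ^ 2 / T) ^ 2 := by
    intro t ht
    rw [Finset.mem_Ico] at ht
    have h1 : (T' : ℝ) ≤ t := by exact_mod_cast ht.1
    have h2 : (t : ℝ) + 1 ≤ T := by exact_mod_cast ht.2
    refine (tail_le_of_drift hγ hind hν hΦ (y₀ := x₀) (fun ω => rfl) hY (hmR.sub_const _)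
      (c := α * (η * lam)) (by positivity) hθ0 (fun n ω => ?_) ?_).trans ?_
    · rw [hcθ]; exact S.drift_upper (hne n ω) hθ0 hθC
    · have := le_max_left (Real.log (effRadius η lam x₀ ^ 2) - Real.log (clippedMeanMax L ν C))
        (Real.log (clippedMeanMin L ν C) - Real.log (effRadius η lam x₀ ^ 2))
      have : (T' : ℝ) * (α * (η * lam)) ≤ t * (α * (η * lam)) := by gcongr
      linarith
    · have := exp_neg_div_five_le hδ (by linarith) hθ
      gcongr
  have hL : ∀ t ∈ Finset.Ico T' T, P.real {ω | Real.log 2 < Real.log (clippedMeanMin L ν C) -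
      Real.log (effRadius η lam (Y t ω) ^ 2)} ≤ T * (δ ^ 2 / T) ^ 2 := by
    intro t ht
    rw [Finset.mem_Ico] at ht
    have h1 : (T' : ℝ) ≤ t := by exact_mod_cast ht.1
    have h2 : (t : ℝ) + 1 ≤ T := by exact_mod_cast ht.2
    refine (tail_le_of_drift hγ hind hν hΦ (y₀ := x₀) (fun ω => rfl) hY (hmR.const_sub _)
      (c := α * (η * lam)) (by positivity) hθ0 (fun n ω => ?_) ?_).trans ?_
    · rw [hcθ]; exact S.drift_lower (hne n ω) hθ0 hθC
    · have := le_max_right (Real.log (effRadius η lam x₀ ^ 2) - Real.log (clippedMeanMax L ν C))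
        (Real.log (clippedMeanMin L ν C) - Real.log (effRadius η lam x₀ ^ 2))
      have : (T' : ℝ) * (α * (η * lam)) ≤ t * (α * (η * lam)) := by gcongr
      linarith
    · have := exp_neg_div_five_le hδ (by linarith) hθ
      gcongr
  have hset : {ω | ∃ t ∈ Finset.Ico T' T,
      Real.log 2 < Real.log (effRadius η lam (Y t ω) ^ 2) - Real.log (clippedMeanMax L ν C) ∨
      Real.log 2 < Real.log (clippedMeanMin L ν C) - Real.log (effRadius η lam (Y t ω) ^ 2)} =
      ⋃ t ∈ Finset.Ico T' T, ({ω | Real.log 2 < Real.log (effRadius η lam (Y t ω) ^ 2) -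
        Real.log (clippedMeanMax L ν C)} ∪ {ω | Real.log 2 < Real.log (clippedMeanMin L ν C) -
          Real.log (effRadius η lam (Y t ω) ^ 2)}) := by
    ext ω
    simp
  rw [hset]
  calc _ ≤ ∑ t ∈ Finset.Ico T' T, _ := measureReal_biUnion_finset_le _ _
    -- Two tails at each of at most T times, with n + 1 ≤ T in each tail; the square in (δ²/T)²
    -- cancels both factors T.
    _ ≤ ∑ t ∈ Finset.Ico T' T, 2 * (T * (δ ^ 2 / T) ^ 2) :=
        Finset.sum_le_sum fun t ht => (measureReal_union_le _ _).trans
          (by linarith [hU t ht, hL t ht])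
    _ ≤ T * (2 * (T * (δ ^ 2 / T) ^ 2)) := by
        rw [Finset.sum_const, nsmul_eq_mul, Nat.card_Ico]
        gcongr
        omega
    _ = 2 * δ ^ 4 := by field_simp
    _ ≤ 2 * δ := by
        have : δ ^ 4 ≤ δ ^ 1 := pow_le_pow_of_le_one hδ.le (by linarith) (by norm_num)
        linarith

end ClippedSetting

/-! ### One-step descent of the radius-weighted loss -/

/-- A discrete product rule for R(f - c). The change of the weight contributes 2ε(f₀ - c)(y - 1);
the term in ε² and the product of the changes in weight and loss are absorbed by the slack in
101/100 and 1/100. -/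
theorem one_step_bound {ε y ρ R f₀ f₁ c p : ℝ} (hε : 0 < ε) (hε1 : 1000000 * ε ≤ 1) (hy : 0 ≤ y)
    (hρ : 0 ≤ ρ) (hR : 0 < R) (hc : |f₀ - c| ≤ 2 * ρ)
    (hlip : |f₁ - f₀| ≤ ρ * (2 / 1000))
    (hdesc : p ≤ (1 - ε) * (R * (f₀ - f₁ + ρ * (ε * y) * (1001 / 1000)))) :
    p ≤ (1 - ε) * (R * (f₀ - c) - R * ((1 - ε) ^ 2 + 2 * ε * y) * (f₁ - c) +
      ε * (R * (ρ * (y * (101 / 100)) + 2 * (f₀ - c) * (y - 1) + ρ * (1 / 100)))) := by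
  refine hdesc.trans (mul_le_mul_of_nonneg_left ?_ (by linarith))
  have e : R * (f₀ - c) - R * ((1 - ε) ^ 2 + 2 * ε * y) * (f₁ - c) +
      ε * (R * (ρ * (y * (101 / 100)) + 2 * (f₀ - c) * (y - 1) + ρ * (1 / 100))) =
      R * (f₀ - f₁ + (ε * (ρ * (y * (101 / 100)) + ρ * (1 / 100)) - ε ^ 2 * (f₀ - c) -
        (-2 * ε + ε ^ 2 + 2 * ε * y) * (f₁ - f₀))) := by ring
  rw [e]
  refine mul_le_mul_of_nonneg_left ?_ hR.le
  have h1 : ε ^ 2 * (f₀ - c) ≤ ε * (ρ * (2 / 1000000)) := by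
    have := (le_abs_self _).trans hc
    nlinarith [mul_nonneg hε.le hρ]
  have h2 : (-2 * ε + ε ^ 2 + 2 * ε * y) * (f₁ - f₀) ≤ 2 * ε * (1 + y) * (ρ * (2 / 1000)) := by
    refine (le_abs_self _).trans ?_
    rw [abs_mul]
    have h3 : |-2 * ε + ε ^ 2 + 2 * ε * y| ≤ 2 * ε * (1 + y) := by
      have := mul_nonneg hε.le hy
      rw [abs_le]
      constructor <;> nlinarith
    exact mul_le_mul h3 hlip (abs_nonneg _) (by positivity)
  have h4 : 0 ≤ ε * ρ := by positivity
  nlinarith [mul_nonneg h4 hy]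

theorem scaleInvariant_meanLoss {d : ℕ} {Γ : Type*} [MeasurableSpace Γ]
    {L : Γ → EuclideanSpace ℝ (Fin d) → ℝ} (ν : Measure Γ) (h : ∀ γ, ScaleInvariant (L γ)) :
    ScaleInvariant (meanLoss L ν) := fun c hc x hx => by
  simp only [meanLoss, h _ c hc x hx]

/-- The upper bound for the one-step change of the shifted, radius-weighted loss
`effRadius x * (meanLoss x - c)`. -/
noncomputable def weightedLossIncrement {d : ℕ} {Γ : Type*} [MeasurableSpace Γ]
    (L : Γ → EuclideanSpace ℝ (Fin d) → ℝ) (ν : Measure Γ) (C η lam ρ c : ℝ)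
    (x : EuclideanSpace ℝ (Fin d)) (γ : Γ) : ℝ :=
  (1 - η * lam) * (η * lam * (effRadius η lam x *
    (ρ * (clippedRatio L C η lam x γ * (101 / 100)) +
      2 * (meanLoss L ν x - c) * (clippedRatio L C η lam x γ - 1) + ρ * (1 / 100)))) -
  √(2 * (η * lam)) *
    inner ℝ (gradient (meanLoss L ν) (unitDir x)) (clippedGradient L C η lam x γ)

theorem sgdStep_eq_smul {d : ℕ} {Γ : Type*} {L : Γ → EuclideanSpace ℝ (Fin d) → ℝ} {C η lam : ℝ}
    {x : EuclideanSpace ℝ (Fin d)} (hε1 : η * lam < 1) (γ : Γ) :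
    sgdStep L C η lam x γ = (1 - η * lam) •
      (x + (-(η / (‖x‖ * (1 - η * lam)))) • clippedGradient L C η lam x γ) := by
  have h : 1 - η * lam ≠ 0 := by linarith
  rw [sgdStep, smul_add, smul_smul, sub_eq_add_neg, ← neg_smul]
  congr 2
  rw [mul_neg, mul_div_assoc', mul_comm ‖x‖, mul_div_mul_left _ _ h]

namespace ClippedSetting

variable {d : ℕ} {Γ : Type*} [MeasurableSpace Γ] {L : Γ → EuclideanSpace ℝ (Fin d) → ℝ}
  {ν : Measure Γ} {C α η lam ρ c : ℝ} {x : EuclideanSpace ℝ (Fin d)}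

theorem scaleInvariant_mean (S : ClippedSetting L ν C α η lam) :
    ScaleInvariant (meanLoss L ν) :=
  scaleInvariant_meanLoss ν S.scaleInvariant

theorem norm_gradient_meanLoss_le (S : ClippedSetting L ν C α η lam)
    (hρ : ∀ z : EuclideanSpace ℝ (Fin d), ‖z‖ = 1 →
      ‖fderiv ℝ (fderiv ℝ (meanLoss L ν)) z‖ ≤ ρ) (hx : x ≠ 0) :
    ‖gradient (meanLoss L ν) (unitDir x)‖ ≤ ρ := by
  have := S.scaleInvariant_mean.norm_fderiv_le S.contDiffOn_mean hρ (unitDir_ne_zero hx)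
  rwa [norm_unitDir hx, div_one, ← norm_gradient_eq_norm_fderiv] at this

theorem norm_clippedGradient_le (S : ClippedSetting L ν C α η lam)
    (x : EuclideanSpace ℝ (Fin d)) (γ : Γ) :
    ‖clippedGradient L C η lam x γ‖ ≤ √C * effRadius η lam x := by
  rw [norm_clippedGradient S.η_pos S.lam_pos S.one_lt]
  exact min_le_left _ _

theorem integrable_clippedGradient [IsProbabilityMeasure ν] (S : ClippedSetting L ν C α η lam)
    (x : EuclideanSpace ℝ (Fin d)) : Integrable (clippedGradient L C η lam x) ν :=
  Integrable.of_bound (S.measurable_clippedGradient x).aestronglyMeasurable _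
    (Filter.Eventually.of_forall (S.norm_clippedGradient_le x))

theorem integral_clippedGradient (hx : x ≠ 0) :
    ∫ γ, clippedGradient L C η lam x γ ∂ν = expectedClippedGradient L ν C η lam x := by
  simp only [clippedGradient, unitGradient, if_neg hx, expectedClippedGradient]

/-- The reason for weighting the loss by the radius: the effective learning rate η/‖x‖² becomes a
constant independent of the state. -/
theorem effRadius_mul_div (S : ClippedSetting L ν C α η lam) (hx : x ≠ 0) :
    effRadius η lam x * (η / ‖x‖ ^ 2) = √(2 * (η * lam)) := by
  have hn := norm_pos_iff.2 hx
  have hη := S.η_pos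
  rw [effRadius, mul_assoc, mul_div_cancel₀ _ (by positivity)]
  rw [← Real.sqrt_sq hη.le, ← Real.sqrt_mul' _ (by positivity), Real.sqrt_sq hη.le]
  congr 1
  field_simp

theorem norm_sq_div_norm_sq (S : ClippedSetting L ν C α η lam) (hx : x ≠ 0) (γ : Γ) (s : ℝ) :
    (‖(-(η / (‖x‖ * s))) • clippedGradient L C η lam x γ‖ / ‖x‖) ^ 2 =
      2 * (η * lam * clippedRatio L C η lam x γ) / s ^ 2 := by
  have hn := norm_pos_iff.2 hx
  have hη := S.η_pos
  have hlam := S.lam_pos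
  rw [norm_smul, norm_neg, div_pow, mul_pow, Real.norm_eq_abs, sq_abs, clippedRatio,
    effRadius_sq hη hlam]
  rcases eq_or_ne s 0 with rfl | hs
  · simp
  field_simp

/-- After dividing out 1 - ε, which L does not see, the step is a displacement u orthogonal to x, so
the descent inequality applies. Multiplication by 1 - ε undoes the same factor in the denominator of
u. -/
theorem weightedLoss_step_le [IsProbabilityMeasure ν] (S : ClippedSetting L ν C α η lam)
    (hρ : ∀ z : EuclideanSpace ℝ (Fin d), ‖z‖ = 1 →
      ‖fderiv ℝ (fderiv ℝ (meanLoss L ν)) z‖ ≤ ρ) (hρ0 : 0 ≤ ρ) (hx : x ≠ 0)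
    (hc : |meanLoss L ν x - c| ≤ 2 * ρ) (γ : Γ) :
    0 ≤ (1 - η * lam) * (effRadius η lam x * (meanLoss L ν x - c) -
      effRadius η lam (sgdStep L C η lam x γ) * (meanLoss L ν (sgdStep L C η lam x γ) - c)) +
      weightedLossIncrement L ν C η lam ρ c x γ := by
  have hα1 := S.alpha_le_one hx
  have hε := S.eps_pos
  have hε1 := S.one_lt_inv_eps hα1
  have hn := norm_pos_iff.2 hx
  have hη := S.η_pos
  have hR := effRadius_pos hη S.lam_pos hx
  have hy := clippedRatio_nonneg (L := L) (C := C) (η := η) (lam := lam) x γ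
  have hyC := mul_le_mul_of_nonneg_left (S.clippedRatio_le hx γ) hε.le
  have hs := S.small
  have hf := S.scaleInvariant_mean
  have h1ε : 0 < 1 - η * lam := by linarith
  set u := (-(η / (‖x‖ * (1 - η * lam)))) • clippedGradient L C η lam x γ with hu
  have hxu : inner ℝ x u = 0 := by
    rw [hu, inner_smul_right, S.inner_clippedGradient hx, mul_zero]
  have hxu0 : x + u ≠ 0 := by
    have := norm_le_norm_add_smul_of_inner_eq_zero hxu 1
    rw [one_smul] at this
    exact norm_pos_iff.1 (hn.trans_le this)
  have hstep : meanLoss L ν (sgdStep L C η lam x γ) = meanLoss L ν (x + u) := by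
    rw [sgdStep_eq_smul (by linarith), hf _ h1ε _ hxu0]
  have hu2 := S.norm_sq_div_norm_sq hx γ (1 - η * lam)
  rw [← hu] at hu2
  have hinv : 1 / (1 - η * lam) ^ 2 ≤ 1001 / 1000 := by
    rw [div_le_iff₀ (by positivity)]
    nlinarith
  have hu3 : (‖u‖ / ‖x‖) ^ 2 ≤
      2 * (η * lam * clippedRatio L C η lam x γ) * (1001 / 1000) := by
    rw [hu2, div_eq_mul_one_div]
    gcongr
  have hlip : |meanLoss L ν (x + u) - meanLoss L ν x| ≤ ρ * (2 / 1000) := by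
    refine (hf.abs_sub_le_of_orthogonal S.contDiffOn_mean hρ hρ0 hx hxu).trans ?_
    rw [div_mul_eq_mul_div, mul_div_assoc]
    refine mul_le_mul_of_nonneg_left ?_ hρ0
    refine le_of_sq_le_sq (?_ : (‖u‖ / ‖x‖) ^ 2 ≤ (2 / 1000) ^ 2) (by norm_num)
    nlinarith
  have hdesc := hf.descent S.contDiffOn_mean hρ hρ0 hx hxu
  have hd : effRadius η lam x * fderiv ℝ (meanLoss L ν) x u * (1 - η * lam) =
      -(√(2 * (η * lam)) * inner ℝ (gradient (meanLoss L ν) (unitDir x))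
        (clippedGradient L C η lam x γ)) := by
    have e1 : fderiv ℝ (meanLoss L ν) x = ‖x‖⁻¹ • fderiv ℝ (meanLoss L ν) (unitDir x) := by
      conv_lhs => rw [← norm_smul_unitDir hx]
      exact hf.fderiv_smul hn (unitDir_ne_zero hx)
    rw [← S.effRadius_mul_div hx, inner_gradient_eq_fderiv, e1, hu, map_smul]
    simp only [FunLike.coe_smul, Pi.smul_apply, smul_eq_mul]
    field_simp
  have hquad : ρ / ‖x‖ ^ 2 * ‖u‖ ^ 2 / 2 ≤
      ρ * (η * lam * clippedRatio L C η lam x γ) * (1001 / 1000) := by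
    have : ρ / ‖x‖ ^ 2 * ‖u‖ ^ 2 / 2 = ρ * (‖u‖ / ‖x‖) ^ 2 / 2 := by rw [div_pow]; ring
    rw [this]
    nlinarith [mul_le_mul_of_nonneg_left hu3 hρ0]
  have h := one_step_bound (p := √(2 * (η * lam)) *
    inner ℝ (gradient (meanLoss L ν) (unitDir x)) (clippedGradient L C η lam x γ))
    hε hε1 hy hρ0 hR hc hlip (by
      have h2 := mul_le_mul_of_nonneg_left (hdesc.trans (add_le_add_right hquad _))
        (mul_nonneg h1ε.le hR.le)
      linarith)
  rw [S.effRadius_sgdStep hx, hstep, weightedLossIncrement]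
  linarith

end ClippedSetting

/-! ### Numerical bounds for the second-order terms and the final average -/

/-- Up to a common factor, this is the coefficient of the clipped ratio in the weighted increment;
it determines the range entering Azuma–Hoeffding. -/
theorem abs_linear_coeff_le {ρ ℓ : ℝ} (hρ : 0 ≤ ρ) (h1 : -(184 / 100 * ρ) ≤ ℓ)
    (h2 : ℓ ≤ 1302 / 1000 * ρ) : |101 / 100 * ρ + 2 * ℓ| ≤ 4 * ρ := by
  rw [abs_le]
  constructor <;> linarith

/-- Bound for the mean of the second-order terms, where `a = √μmax`, `b = √μmin`. -/
theorem mean_increment_le {R ρ ℓ y a b : ℝ} (hR : 0 < R) (hρ : 0 ≤ ρ)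
    (h1 : -(184 / 100 * ρ) ≤ ℓ) (h2 : ℓ ≤ 1302 / 1000 * ρ) (hy : 0 ≤ y) (hb : 0 < b)
    (hab : b ≤ a) (hRa : R ^ 2 ≤ 2 * a ^ 2) (hRb : b ^ 2 / 2 ≤ R ^ 2)
    (hmax : R ^ 2 * y ≤ max (R ^ 2) (a ^ 2)) :
    R * (ρ * (y * (101 / 100)) + 2 * ℓ * (y - 1) + ρ * (1 / 100)) ≤
      4 * √2 * (ρ * a ^ 3 / b ^ 2) := by
  have ha : 0 < a := hb.trans_le hab
  have hs2 : √2 ^ 2 = 2 := Real.sq_sqrt (by norm_num)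
  have hs0 : 0 < √2 := by positivity
  have hab2 : b ^ 2 ≤ a ^ 2 := by gcongr
  have hQ : a ≤ a ^ 3 / b ^ 2 := by
    rw [le_div_iff₀ (by positivity)]
    nlinarith [mul_le_mul_of_nonneg_left hab2 ha.le]
  -- For y ≤ 1 the bracket is at most 4ρ and R ≤ √2·a finishes. For y > 1 the maximum hypothesis
  -- forces R²y ≤ a², and Ry is bounded by dividing by R ≥ b/√2.
  rcases le_or_gt y 1 with h | h
  · have hR' : R ≤ √2 * a := by
      refine le_of_sq_le_sq ?_ (by positivity)
      rw [mul_pow, hs2]; exact hRa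
    have h3 : ρ * (y * (101 / 100)) + 2 * ℓ * (y - 1) + ρ * (1 / 100) ≤ 4 * ρ := by
      nlinarith [mul_le_mul_of_nonneg_right h1 (by linarith : 0 ≤ 1 - y), mul_nonneg hρ hy,
        mul_nonneg hρ (by linarith : 0 ≤ 1 - y)]
    calc _ ≤ R * (4 * ρ) := by gcongr
      _ ≤ √2 * a * (4 * ρ) := by gcongr
      _ = 4 * √2 * (ρ * a) := by ring
      _ ≤ 4 * √2 * (ρ * (a ^ 3 / b ^ 2)) := by gcongr
      _ = _ := by ring
  · have hya : R ^ 2 * y ≤ a ^ 2 := by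
      rcases le_max_iff.1 hmax with h' | h'
      · have : 0 < R ^ 2 := by positivity
        nlinarith
      · exact h'
    have hR' : b ≤ √2 * R := by
      refine le_of_sq_le_sq ?_ (by positivity)
      rw [mul_pow, hs2]; linarith
    have h3 : ρ * (y * (101 / 100)) + 2 * ℓ * (y - 1) + ρ * (1 / 100) ≤ 4 * ρ * y := by
      nlinarith [mul_le_mul_of_nonneg_right h2 (by linarith : 0 ≤ y - 1), mul_nonneg hρ hy,
        mul_nonneg hρ (by linarith : 0 ≤ y - 1)]
    have h4 : R * y ≤ √2 * (a ^ 3 / b ^ 2) := by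
      rw [mul_div_assoc', le_div_iff₀ (by positivity)]
      calc R * y * b ^ 2 = (R * y * b) * b := by ring
        _ ≤ (R * y * (√2 * R)) * a := by gcongr
        _ = √2 * a * (R ^ 2 * y) := by ring
        _ ≤ √2 * a * a ^ 2 := by gcongr
        _ = _ := by ring
    calc _ ≤ R * (4 * ρ * y) := by gcongr
      _ = 4 * ρ * (R * y) := by ring
      _ ≤ 4 * ρ * (√2 * (a ^ 3 / b ^ 2)) := by gcongr
      _ = _ := by ring

/-- The final estimate: `q` is the sum of inner products, `F₀`, `F₁` the initial and final shifted
losses, `s` the sum of the centred increments. -/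
theorem average_le {ε C ρ a b n ℓ ℓ' q s R₀ R₁ F₀ F₁ : ℝ} (hε : 0 < ε) (hε1 : ε < 1) (hC : 0 < C)
    (hρ : 0 ≤ ρ) (hb : 0 < b) (hab : b ≤ a) (hn : 0 < n) (hℓ' : ℓ ≤ ℓ')
    (hR₀ : 0 ≤ R₀) (hR₀a : R₀ ≤ √2 * a) (hR₁ : 0 ≤ R₁) (hR₁a : R₁ ≤ 11 / 10 * (√2 * a))
    (hF₀ : F₀ ≤ 1302 / 1000 * ρ) (hF₁ : -(184 / 100 * ρ) ≤ F₁)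
    (hs : s ≤ (2 * (√(2 * ε) * (ρ * (√C * (√2 * a)))) + 8 * (ρ * (ε * C) * (√2 * a))) * √(n * ℓ))
    (h : √(2 * ε) * q ≤ (1 - ε) * (R₀ * F₀ - R₁ * F₁) + s +
      n * (ε * (4 * √2 * (ρ * a ^ 3 / b ^ 2)))) :
    1 / n * q ≤ Real.pi ^ 2 * ρ * a / (n * √(2 * ε)) + 4 * √ε * (ρ * a ^ 3 / b ^ 2) +
      √(ℓ' / n) * 8 * (Real.pi * ρ * √C * a ^ 2 / b) +
      √(ℓ' / n) * 16 * √ε * (C * ρ * a ^ 3 / b ^ 2) := by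
  have ha : 0 < a := hb.trans_le hab
  have hs2 : √2 ^ 2 = 2 := Real.sq_sqrt (by norm_num)
  have hs20 : 0 < √2 := by positivity
  have hs2' : √2 ≤ 3 / 2 := by
    refine le_of_sq_le_sq ?_ (by norm_num)
    rw [hs2]; norm_num
  have hsε : 0 < √ε := by positivity
  have hsε2 : √ε ^ 2 = ε := Real.sq_sqrt hε.le
  have h2ε : √(2 * ε) = √2 * √ε := Real.sqrt_mul (by norm_num) _
  have hπ := Real.pi_gt_three
  have hQ : a ≤ a ^ 3 / b ^ 2 := by
    rw [le_div_iff₀ (by positivity)]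
    have : b ^ 2 ≤ a ^ 2 := by gcongr
    nlinarith [mul_le_mul_of_nonneg_left this ha.le]
  have hQ' : a ≤ a ^ 2 / b := by
    rw [le_div_iff₀ hb]
    nlinarith
  have hρa : 0 ≤ ρ * a := by positivity
  have hπ2 : 9 ≤ Real.pi ^ 2 := by nlinarith
  have hbdry : (1 - ε) * (R₀ * F₀ - R₁ * F₁) ≤ Real.pi ^ 2 * ρ * a := by
    have e1 : R₀ * F₀ ≤ √2 * a * (1302 / 1000 * ρ) := by
      refine (mul_le_mul_of_nonneg_left hF₀ hR₀).trans ?_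
      gcongr
    have e2 : -(R₁ * F₁) ≤ 11 / 10 * (√2 * a) * (184 / 100 * ρ) := by
      have := mul_le_mul_of_nonneg_left (neg_le.1 hF₁) hR₁
      refine le_trans (by linarith) (this.trans ?_)
      gcongr
    -- With √2 ≤ 3/2 the coefficient is below 5; 9 is used because it is a convenient lower bound of
    -- π².
    have e3 : R₀ * F₀ - R₁ * F₁ ≤ 9 * (ρ * a) := by
      have := mul_le_mul_of_nonneg_right hs2' hρa
      linarith
    have e4 : 9 * (ρ * a) ≤ Real.pi ^ 2 * (ρ * a) := by
      gcongr
    calc (1 - ε) * (R₀ * F₀ - R₁ * F₁) ≤ (1 - ε) * (9 * (ρ * a)) :=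
          mul_le_mul_of_nonneg_left e3 (by linarith)
      _ ≤ 9 * (ρ * a) := mul_le_of_le_one_left (by positivity) (by linarith)
      _ ≤ _ := by linarith
  have hsq : √(n * ℓ) = n * √(ℓ / n) := by
    rw [← Real.sqrt_sq hn.le, ← Real.sqrt_mul (by positivity), Real.sqrt_sq hn.le]
    congr 1
    field_simp
  have hmono : √(ℓ / n) ≤ √(ℓ' / n) := Real.sqrt_le_sqrt (by gcongr)
  rw [hsq] at hs
  set r := √(ℓ / n)
  set r' := √(ℓ' / n)
  have hr : 0 ≤ r := Real.sqrt_nonneg _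
  have hpos : 0 < n * √(2 * ε) := by positivity
  have hq : 1 / n * q = √(2 * ε) * q / (n * √(2 * ε)) := by
    have : √(2 * ε) ≠ 0 := by positivity
    field_simp
  have e3 : (2 * (√(2 * ε) * (ρ * (√C * (√2 * a)))) + 8 * (ρ * (ε * C) * (√2 * a))) * (n * r) =
      (n * √(2 * ε)) * (r * 2 * √2 * (ρ * √C * a) + r * 8 * √ε * (C * ρ * a)) := by
    rw [h2ε]
    linear_combination -8 * ρ * C * √2 * a * n * r * hsε2
  have e4 : n * (ε * (4 * √2 * (ρ * a ^ 3 / b ^ 2))) =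
      (n * √(2 * ε)) * (4 * √ε * (ρ * a ^ 3 / b ^ 2)) := by
    rw [h2ε]
    linear_combination -4 * √2 * n * (ρ * a ^ 3 / b ^ 2) * hsε2
  rw [hq, div_le_iff₀ hpos]
  have e5 : r * 2 * √2 * (ρ * √C * a) ≤ r' * 8 * (Real.pi * ρ * √C * a ^ 2 / b) := by
    have : Real.pi * ρ * √C * a ^ 2 / b = Real.pi * (ρ * √C * (a ^ 2 / b)) := by ring
    rw [this]
    calc r * 2 * √2 * (ρ * √C * a) ≤ r' * 2 * (3 / 2) * (ρ * √C * (a ^ 2 / b)) := by gcongr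
      _ = r' * (3 * (ρ * √C * (a ^ 2 / b))) := by ring
      _ ≤ r' * (8 * Real.pi * (ρ * √C * (a ^ 2 / b))) := by
        gcongr
        linarith
      _ = _ := by ring
  have e6 : r * 8 * √ε * (C * ρ * a) ≤ r' * 16 * √ε * (C * ρ * a ^ 3 / b ^ 2) := by
    have : C * ρ * a ^ 3 / b ^ 2 = C * ρ * (a ^ 3 / b ^ 2) := by ring
    rw [this]
    gcongr
    norm_num
  have e7 : Real.pi ^ 2 * ρ * a / (n * √(2 * ε)) * (n * √(2 * ε)) = Real.pi ^ 2 * ρ * a :=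
    div_mul_cancel₀ _ hpos.ne'
  rw [e3] at hs
  rw [e4] at h
  rw [add_mul, add_mul, add_mul, e7]
  have e8 := mul_le_mul_of_nonneg_left (add_le_add e5 e6) hpos.le
  linarith

/-! ### Centring the loss and bounding its increments -/

namespace ClippedSetting

variable {d : ℕ} {Γ : Type*} [MeasurableSpace Γ] {L : Γ → EuclideanSpace ℝ (Fin d) → ℝ}
  {ν : Measure Γ} {C α η lam ρ c : ℝ} {x : EuclideanSpace ℝ (Fin d)}

/-- The oscillation is at most πρ < 3.142ρ, split off-centre as 1.84 + 1.302. The loss offset ℓ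
enters through 1.01ρ + 2ℓ for large ratios and through -2ℓ for ratios near 0, so the asymmetry keeps
both below 4ρ; a centred split would give 1.01 + π > 4. -/
theorem exists_loss_center [IsProbabilityMeasure ν]
    (S : ClippedSetting L ν C α η lam)
    (hρ : ∀ z : EuclideanSpace ℝ (Fin d), ‖z‖ = 1 →
      ‖fderiv ℝ (fderiv ℝ (meanLoss L ν)) z‖ ≤ ρ) (hρ0 : 0 ≤ ρ)
    (hx : x ≠ 0) : ∃ c, ∀ z : EuclideanSpace ℝ (Fin d), z ≠ 0 →
      -(184 / 100 * ρ) ≤ meanLoss L ν z - c ∧ meanLoss L ν z - c ≤ 1302 / 1000 * ρ := by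
  have hsub : Metric.sphere (0 : EuclideanSpace ℝ (Fin d)) 1 ⊆ {0}ᶜ := by
    intro z hz h0
    rw [Set.mem_singleton_iff.1 h0] at hz
    simp at hz
  obtain ⟨a, ha, hmin⟩ := (isCompact_sphere (0 : EuclideanSpace ℝ (Fin d)) 1).exists_isMinOn
    ⟨unitDir x, by simpa using norm_unitDir hx⟩ (S.contDiffOn_mean.continuousOn.mono hsub)
  have ha1 : ‖a‖ = 1 := by simpa using ha
  obtain ⟨e, he, hae⟩ := S.exists_orthogonal ha1
  refine ⟨meanLoss L ν a + 184 / 100 * ρ, fun z hz => ?_⟩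
  have hu : meanLoss L ν (unitDir z) = meanLoss L ν z :=
    S.scaleInvariant_mean _ (inv_pos.2 (norm_pos_iff.2 hz)) z hz
  have h1 := S.scaleInvariant_mean.abs_sub_le_pi S.contDiffOn_mean hρ hρ0 ha1
    (norm_unitDir hz) he hae
  have h2 : meanLoss L ν a ≤ meanLoss L ν (unitDir z) :=
    hmin (by simpa using norm_unitDir hz)
  rw [hu] at h1 h2
  have h3 := (le_abs_self _).trans h1
  have hπ := Real.pi_lt_d4
  constructor <;> nlinarith

theorem measurable_weightedLossIncrement (S : ClippedSetting L ν C α η lam) (ρ c : ℝ) :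
    Measurable (Function.uncurry (weightedLossIncrement L ν C η lam ρ c)) := by
  have h1 : Measurable (meanLoss L ν) :=
    measurable_of_continuousOn_compl_singleton 0 S.contDiffOn_mean.continuousOn
  have h2 : Measurable (gradient (meanLoss L ν)) :=
    measurable_of_continuousOn_compl_singleton 0
      (continuousOn_gradient (S.contDiffOn_mean.of_le one_le_two))
  have h3 := h2.comp (measurable_unitDir (d := d))
  have h4 := _root_.measurable_clippedGradient S.contDiffOn S.measurable C η lam
  have h5 := S.measurable_clippedRatio
  have h6 := measurable_effRadius (d := d) (η := η) (lam := lam)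
  have h7 : Measurable fun p : EuclideanSpace ℝ (Fin d) × Γ =>
      (inner ℝ (gradient (meanLoss L ν) (unitDir p.1)) (clippedGradient L C η lam p.1 p.2) : ℝ) :=
    (h3.comp measurable_fst).inner h4
  unfold weightedLossIncrement Function.uncurry
  exact (((h6.comp measurable_fst).mul ((((h5.mul_const _).const_mul _).add
    ((((h1.comp measurable_fst).sub_const _).const_mul _).mul (h5.sub_const _))).add_const
      _)).const_mul _ |>.const_mul _).sub (h7.const_mul _)

theorem abs_inner_clippedGradient_le (S : ClippedSetting L ν C α η lam)
    (hρ : ∀ z : EuclideanSpace ℝ (Fin d), ‖z‖ = 1 →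
      ‖fderiv ℝ (fderiv ℝ (meanLoss L ν)) z‖ ≤ ρ) (hx : x ≠ 0) (γ : Γ) :
    |inner ℝ (gradient (meanLoss L ν) (unitDir x)) (clippedGradient L C η lam x γ)| ≤
      ρ * (√C * effRadius η lam x) :=
  (abs_real_inner_le_norm _ _).trans (mul_le_mul (S.norm_gradient_meanLoss_le hρ hx)
    (S.norm_clippedGradient_le x γ) (norm_nonneg _)
    ((norm_nonneg _).trans (S.norm_gradient_meanLoss_le hρ hx)))

/-- The increment is a constant plus two random terms, one linear in the clipped ratio and one the
inner product. Each lies in a symmetric interval because the ratio is at most C and the clipped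
gradient at most √C·R. -/
theorem weightedLossIncrement_mem_Icc [IsProbabilityMeasure ν]
    (S : ClippedSetting L ν C α η lam)
    (hρ : ∀ z : EuclideanSpace ℝ (Fin d), ‖z‖ = 1 →
      ‖fderiv ℝ (fderiv ℝ (meanLoss L ν)) z‖ ≤ ρ) (hρ0 : 0 ≤ ρ) (hx : x ≠ 0)
    (h1 : -(184 / 100 * ρ) ≤ meanLoss L ν x - c) (h2 : meanLoss L ν x - c ≤ 1302 / 1000 * ρ)
    {r : ℝ} (hr : effRadius η lam x ≤ r) :
    ∃ a, ∀ γ, weightedLossIncrement L ν C η lam ρ c x γ ∈ Set.Icc a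
      (a + (2 * (√(2 * (η * lam)) * (ρ * (√C * r))) + 8 * (ρ * (η * lam * C) * r))) := by
  have hε := S.eps_pos
  have hα1 := S.alpha_le_one hx
  have hε1 := S.one_lt_inv_eps hα1
  have hR := effRadius_pos S.η_pos S.lam_pos hx
  have hC := S.one_lt
  set R := effRadius η lam x
  set ℓ := meanLoss L ν x - c
  refine ⟨(1 - η * lam) * (η * lam * (R * (ρ * (1 / 100) - 2 * ℓ))) -
    (√(2 * (η * lam)) * (ρ * (√C * r)) + 4 * (ρ * (η * lam * C) * r)), fun γ => ?_⟩
  have e : weightedLossIncrement L ν C η lam ρ c x γ =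
      (1 - η * lam) * (η * lam * (R * (ρ * (1 / 100) - 2 * ℓ))) +
      (1 - η * lam) * (η * lam * R * ((101 / 100 * ρ + 2 * ℓ) * clippedRatio L C η lam x γ)) -
      √(2 * (η * lam)) * inner ℝ (gradient (meanLoss L ν) (unitDir x))
        (clippedGradient L C η lam x γ) := by
    simp only [weightedLossIncrement, R, ℓ]
    ring
  have hy := clippedRatio_nonneg (L := L) (C := C) (η := η) (lam := lam) x γ
  have hyC := S.clippedRatio_le hx γ
  have b1 : |(1 - η * lam) * (η * lam * R * ((101 / 100 * ρ + 2 * ℓ) *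
      clippedRatio L C η lam x γ))| ≤ 4 * (ρ * (η * lam * C) * r) := by
    rw [abs_mul, abs_mul, abs_mul (101 / 100 * ρ + 2 * ℓ), abs_of_nonneg hy,
      abs_of_nonneg (by linarith : 0 ≤ 1 - η * lam), abs_of_nonneg (by positivity : 0 ≤ η * lam * R)]
    calc _ ≤ 1 * (η * lam * r * (4 * ρ * C)) := by
          gcongr
          · linarith
          · exact mul_nonneg hε.le (hR.le.trans hr)
          · exact abs_linear_coeff_le hρ0 h1 h2
      _ = _ := by ring
  have b2 : |√(2 * (η * lam)) * inner ℝ (gradient (meanLoss L ν) (unitDir x))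
        (clippedGradient L C η lam x γ)| ≤ √(2 * (η * lam)) * (ρ * (√C * r)) := by
    rw [abs_mul, abs_of_nonneg (Real.sqrt_nonneg _)]
    gcongr
    refine (S.abs_inner_clippedGradient_le hρ hx γ).trans ?_
    gcongr
  rw [e]
  have b1' := abs_le.1 b1
  have b2' := abs_le.1 b2
  constructor <;> linarith

theorem integral_weightedLossIncrement [IsProbabilityMeasure ν]
    (S : ClippedSetting L ν C α η lam)
    (hx : x ≠ 0) (ρ c : ℝ) :
    ∫ γ, weightedLossIncrement L ν C η lam ρ c x γ ∂ν =
      (1 - η * lam) * (η * lam * (effRadius η lam x *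
        (ρ * ((∫ γ, clippedRatio L C η lam x γ ∂ν) * (101 / 100)) +
          2 * (meanLoss L ν x - c) * ((∫ γ, clippedRatio L C η lam x γ ∂ν) - 1) +
          ρ * (1 / 100)))) -
      √(2 * (η * lam)) * inner ℝ (gradient (meanLoss L ν) (unitDir x))
        (expectedClippedGradient L ν C η lam x) := by
  have hi := S.integrable_clippedRatio hx
  have hg := S.integrable_clippedGradient x
  have e : ∀ γ, weightedLossIncrement L ν C η lam ρ c x γ =
      (1 - η * lam) * (η * lam * (effRadius η lam x *
        (ρ * (1 / 100) - 2 * (meanLoss L ν x - c)))) +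
      (1 - η * lam) * (η * lam * (effRadius η lam x *
        (ρ * (101 / 100) + 2 * (meanLoss L ν x - c)))) * clippedRatio L C η lam x γ -
      √(2 * (η * lam)) * inner ℝ (gradient (meanLoss L ν) (unitDir x))
        (clippedGradient L C η lam x γ) := fun γ => by
    simp only [weightedLossIncrement]
    ring
  simp only [e]
  have h1 : Integrable (fun γ => (1 - η * lam) * (η * lam * (effRadius η lam x *
      (ρ * (1 / 100) - 2 * (meanLoss L ν x - c)))) +
      (1 - η * lam) * (η * lam * (effRadius η lam x *
        (ρ * (101 / 100) + 2 * (meanLoss L ν x - c)))) * clippedRatio L C η lam x γ) ν :=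
    (integrable_const _).add (hi.const_mul _)
  rw [integral_sub h1 ((hg.const_inner _).const_mul _),
    integral_add (integrable_const _) (hi.const_mul _), integral_const, integral_const_mul,
    integral_const_mul, integral_inner hg, integral_clippedGradient hx]
  simp only [probReal_univ, one_smul]
  ring

end ClippedSetting

/-! ### The averaged bound along a path -/

theorem sum_Ico_telescope (Φ : ℕ → ℝ) {m n : ℕ} (h : m ≤ n) :
    ∑ k ∈ Finset.Ico m n, (Φ k - Φ (k + 1)) = Φ m - Φ n := by
  induction n, h using Nat.le_induction with
  | base => simp
  | succ n hn ih => rw [Finset.sum_Ico_succ_top hn, ih]; ring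

theorem sum_range_ite_le (g : ℕ → ℝ) (m n : ℕ) :
    (∑ k ∈ Finset.range n, if m ≤ k then g k else 0) = ∑ k ∈ Finset.Ico m n, g k := by
  rw [← Finset.sum_filter]
  congr 1
  ext k
  simp [and_comm]

theorem rpow_three_halves {μ : ℝ} (hμ : 0 ≤ μ) : μ ^ (3 / 2 : ℝ) = √μ ^ 3 := by
  rw [Real.sqrt_eq_rpow, ← Real.rpow_natCast, ← Real.rpow_mul hμ]
  norm_num

namespace ClippedSetting

variable {d : ℕ} {Γ : Type*} [MeasurableSpace Γ] {L : Γ → EuclideanSpace ℝ (Fin d) → ℝ}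
  {ν : Measure Γ} [IsProbabilityMeasure ν] {C α η lam ρ c δ : ℝ}

/-- The deterministic half of the argument: on a path satisfying the radius bounds and the deviation
bound, sum the one-step descent, telescope the potential, and replace increments by their means. -/
theorem average_inner_le (S : ClippedSetting L ν C α η lam)
    (hρ : ∀ z : EuclideanSpace ℝ (Fin d), ‖z‖ = 1 →
      ‖fderiv ℝ (fderiv ℝ (meanLoss L ν)) z‖ ≤ ρ) (hρ0 : 0 ≤ ρ)
    (hc : ∀ z : EuclideanSpace ℝ (Fin d), z ≠ 0 →
      -(184 / 100 * ρ) ≤ meanLoss L ν z - c ∧ meanLoss L ν z - c ≤ 1302 / 1000 * ρ)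
    {X : ℕ → EuclideanSpace ℝ (Fin d)} {g : ℕ → Γ}
    (hX : ∀ k, X (k + 1) = sgdStep L C η lam (X k) (g k)) (hne : ∀ k, X k ≠ 0) {T' T : ℕ}
    (hT : T' < T) (hmin : ∀ k ∈ Finset.Ico T' T,
      clippedMeanMin L ν C / 2 ≤ effRadius η lam (X k) ^ 2)
    (hmax : ∀ k ∈ Finset.Ico T' T, effRadius η lam (X k) ^ 2 ≤ 2 * clippedMeanMax L ν C)
    (hδ : 0 < δ)
    (hs : ∑ k ∈ Finset.Ico T' T, (weightedLossIncrement L ν C η lam ρ c (X k) (g k) -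
        ∫ γ, weightedLossIncrement L ν C η lam ρ c (X k) γ ∂ν) ≤
      (2 * (√(2 * (η * lam)) * (ρ * (√C * (√2 * √(clippedMeanMax L ν C))))) +
        8 * (ρ * (η * lam * C) * (√2 * √(clippedMeanMax L ν C)))) *
        √(((T : ℝ) - T') * Real.log (1 / δ))) :
    1 / ((T : ℝ) - T') * ∑ k ∈ Finset.Ico T' T,
        inner ℝ (gradient (meanLoss L ν) (unitDir (X k)))
          (expectedClippedGradient L ν C η lam (X k)) ≤
      Real.pi ^ 2 * ρ * √(clippedMeanMax L ν C) / (((T : ℝ) - T') * √(2 * (η * lam)))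
      + 4 * √(η * lam) * (ρ * clippedMeanMax L ν C ^ (3 / 2 : ℝ) / clippedMeanMin L ν C)
      + √(Real.log (2 / δ) / ((T : ℝ) - T')) * 8 *
          (Real.pi * ρ * √C * clippedMeanMax L ν C / √(clippedMeanMin L ν C))
      + √(Real.log (2 / δ) / ((T : ℝ) - T')) * 16 * √(η * lam) *
          (C * ρ * clippedMeanMax L ν C ^ (3 / 2 : ℝ) / clippedMeanMin L ν C) := by
  have hα1 := S.alpha_le_one (hne 0)
  have hε := S.eps_pos
  have hε1 := S.one_lt_inv_eps hα1
  have hsmall := S.small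
  have hC := S.one_lt
  have hμmin := S.min_pos
  have hμmax := S.max_pos (hne 0)
  have hle : clippedMeanMin L ν C ≤ clippedMeanMax L ν C :=
    (S.clippedMean_mem_Icc (norm_unitDir (hne 0))).1.trans
      (S.clippedMean_mem_Icc (norm_unitDir (hne 0))).2
  set a := √(clippedMeanMax L ν C) with ha
  set b := √(clippedMeanMin L ν C) with hb
  have ha2 : clippedMeanMax L ν C = a ^ 2 := (Real.sq_sqrt hμmax.le).symm
  have hb2 : clippedMeanMin L ν C = b ^ 2 := (Real.sq_sqrt hμmin.le).symm
  have hb0 : 0 < b := Real.sqrt_pos.2 hμmin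
  have hab : b ≤ a := Real.sqrt_le_sqrt hle
  have ha0 : 0 < a := hb0.trans_le hab
  rw [rpow_three_halves hμmax.le, ← ha, ha2, hb2]
  have hn : (0 : ℝ) < (T : ℝ) - T' := sub_pos.2 (Nat.cast_lt.2 hT)
  have hR : ∀ k, 0 < effRadius η lam (X k) := fun k => effRadius_pos S.η_pos S.lam_pos (hne k)
  have hs2 : √2 ^ 2 = (2 : ℝ) := Real.sq_sqrt (by norm_num)
  have hRle : ∀ k ∈ Finset.Ico T' T, effRadius η lam (X k) ≤ √2 * a := fun k hk => by
    refine le_of_sq_le_sq ?_ (by positivity)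
    rw [mul_pow, hs2, ← ha2]
    exact hmax k hk
  -- The telescoped sum ends at time T, one beyond the controlled range; a single step from T - 1
  -- enlarges the radius by at most 11/10.
  have hlast : effRadius η lam (X T) ≤ 11 / 10 * (√2 * a) := by
    obtain ⟨t, rfl⟩ : ∃ t, T = t + 1 := ⟨T - 1, by omega⟩
    have h1 := hRle t (Finset.mem_Ico.2 ⟨by omega, by omega⟩)
    rw [hX, S.effRadius_sgdStep (hne t)]
    have h2 := mul_le_mul_of_nonneg_left (S.clippedRatio_le (hne t) (g t)) hε.le
    have h3 : (1 - η * lam) ^ 2 + 2 * (η * lam) * clippedRatio L C η lam (X t) (g t) ≤ 11 / 10 := by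
      nlinarith
    calc _ ≤ effRadius η lam (X t) * (11 / 10) := mul_le_mul_of_nonneg_left h3 (hR t).le
      _ ≤ √2 * a * (11 / 10) := by gcongr
      _ = _ := by ring
  have hlog : Real.log (1 / δ) ≤ Real.log (2 / δ) :=
    Real.log_le_log (by positivity) (by gcongr; norm_num)
  refine average_le (R₀ := effRadius η lam (X T')) (R₁ := effRadius η lam (X T))
    (F₀ := meanLoss L ν (X T') - c) (F₁ := meanLoss L ν (X T) - c) hε (by linarith) (by linarith)
    hρ0 hb0 hab hn hlog (hR T').le (hRle T' (Finset.mem_Ico.2 ⟨le_rfl, hT⟩)) (hR T).le hlast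
    (hc _ (hne T')).2 (hc _ (hne T)).1 hs ?_
  set Q := 4 * √2 * (ρ * a ^ 3 / b ^ 2) with hQ
  have hQ0 : 0 ≤ Q := by positivity
  have hpath : 0 ≤ ∑ k ∈ Finset.Ico T' T, ((1 - η * lam) *
      (effRadius η lam (X k) * (meanLoss L ν (X k) - c) -
        effRadius η lam (X (k + 1)) * (meanLoss L ν (X (k + 1)) - c)) +
      weightedLossIncrement L ν C η lam ρ c (X k) (g k)) := by
    refine Finset.sum_nonneg fun k _ => ?_
    rw [hX]
    have h := hc _ (hne k)
    exact S.weightedLoss_step_le hρ hρ0 (hne k)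
      (abs_le.2 ⟨by linarith [h.1], by linarith [h.2]⟩) (g k)
  rw [Finset.sum_add_distrib, ← Finset.mul_sum,
    sum_Ico_telescope (fun k => effRadius η lam (X k) * (meanLoss L ν (X k) - c)) hT.le] at hpath
  have hmean : ∑ k ∈ Finset.Ico T' T, ∫ γ, weightedLossIncrement L ν C η lam ρ c (X k) γ ∂ν ≤
      ∑ k ∈ Finset.Ico T' T, (η * lam * Q - √(2 * (η * lam)) *
        inner ℝ (gradient (meanLoss L ν) (unitDir (X k)))
          (expectedClippedGradient L ν C η lam (X k))) := by
    refine Finset.sum_le_sum fun k hk => ?_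
    rw [S.integral_weightedLossIncrement (hne k)]
    have h := hc _ (hne k)
    have hmk := hmax k hk
    have hmk' := hmin k hk
    have hmm := S.mul_integral_clippedRatio_le_max (hne k)
    rw [ha2] at hmk hmm
    rw [hb2] at hmk'
    have hW := mean_increment_le (hR k) hρ0 h.1 h.2
      (integral_nonneg (clippedRatio_nonneg (X k))) hb0 hab hmk hmk' hmm
    have hfin := mul_le_mul_of_nonneg_left (mul_le_mul_of_nonneg_left hW hε.le)
      (by linarith : 0 ≤ 1 - η * lam)
    have hεQ : 0 ≤ η * lam * (η * lam * Q) := by positivity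
    linarith
  rw [Finset.sum_sub_distrib, Finset.sum_const, nsmul_eq_mul, Nat.card_Ico,
    Nat.cast_sub hT.le, ← Finset.mul_sum] at hmean
  rw [Finset.sum_sub_distrib]
  linarith

end ClippedSetting

theorem one_le_log_div_sq {δ : ℝ} (hδ : 0 < δ) (hδ1 : δ < 1 / 5) {T : ℝ} (hT : 1 ≤ T) :
    1 ≤ Real.log (T / δ ^ 2) := by
  have h25 : 25 ≤ T / δ ^ 2 := by
    rw [le_div_iff₀ (by positivity)]
    nlinarith
  rw [Real.le_log_iff_exp_le (by linarith)]
  have := Real.exp_one_lt_d9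
  linarith

theorem le_two_mul_of_log_sub_log_le {a b : ℝ} (ha : 0 < a) (hb : 0 < b)
    (h : Real.log a - Real.log b ≤ Real.log 2) : a ≤ 2 * b := by
  rw [← Real.log_le_log_iff ha (by positivity), Real.log_mul (by norm_num) hb.ne']
  linarith

/-! ### Combining the radius and deviation events -/

namespace ClippedSetting

variable {d : ℕ} {Γ : Type*} [MeasurableSpace Γ] {L : Γ → EuclideanSpace ℝ (Fin d) → ℝ}
  {ν : Measure Γ} [IsProbabilityMeasure ν] {C α η lam θ : ℝ} {x₀ : EuclideanSpace ℝ (Fin d)}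
  {Ω : Type*} [MeasurableSpace Ω] {P : Measure Ω} [IsProbabilityMeasure P] {γ : ℕ → Ω → Γ}

theorem high_probability_bounds (S : ClippedSetting L ν C α η lam) (hx : x₀ ≠ 0)
    (hγ : ∀ n, Measurable (γ n)) (hind : iIndepFun γ P) (hν : ∀ n, P.map (γ n) = ν)
    (hθC : 160 * (η * lam * θ * C) = α) {δ : ℝ} (hδ : 0 < δ) (hδ1 : δ < 1 / 5) {T T' : ℕ}
    (hθ : 10 * Real.log (T / δ ^ 2) ≤ θ) (hTT : T' < T)
    (hT' : max (Real.log (effRadius η lam x₀ ^ 2) - Real.log (clippedMeanMax L ν C))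
      (Real.log (clippedMeanMin L ν C) - Real.log (effRadius η lam x₀ ^ 2)) + 1 ≤
      T' * (α * (η * lam))) {X : ℕ → Ω → EuclideanSpace ℝ (Fin d)}
    (hX : ∀ t ω, X t ω = clippedSGD L C η lam x₀ (fun s => γ s ω) t) :
    1 - 3 * δ ≤ P.real {ω | (∀ t ∈ Finset.Ico T' T,
        clippedMeanMin L ν C / 2 ≤ effRadius η lam (X t ω) ^ 2 ∧
          effRadius η lam (X t ω) ^ 2 ≤ 2 * clippedMeanMax L ν C) ∧
      1 / ((T : ℝ) - T') * ∑ t ∈ Finset.Ico T' T,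
          inner ℝ (gradient (meanLoss L ν) (unitDir (X t ω)))
            (expectedClippedGradient L ν C η lam (X t ω)) ≤
        Real.pi ^ 2 * sphereHessianBound (meanLoss L ν) * √(clippedMeanMax L ν C) /
            (((T : ℝ) - T') * √(2 * (η * lam)))
        + 4 * √(η * lam) * (sphereHessianBound (meanLoss L ν) *
            clippedMeanMax L ν C ^ (3 / 2 : ℝ) / clippedMeanMin L ν C)
        + √(Real.log (2 / δ) / ((T : ℝ) - T')) * 8 * (Real.pi *
            sphereHessianBound (meanLoss L ν) * √C * clippedMeanMax L ν C /
              √(clippedMeanMin L ν C))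
        + √(Real.log (2 / δ) / ((T : ℝ) - T')) * 16 * √(η * lam) *
            (C * sphereHessianBound (meanLoss L ν) * clippedMeanMax L ν C ^ (3 / 2 : ℝ) /
              clippedMeanMin L ν C)} := by
  have hα1 := S.alpha_le_one hx
  have hε := S.eps_pos
  have hC := S.one_lt
  set ρ := sphereHessianBound (meanLoss L ν)
  have hρ : ∀ z : EuclideanSpace ℝ (Fin d), ‖z‖ = 1 →
      ‖fderiv ℝ (fderiv ℝ (meanLoss L ν)) z‖ ≤ ρ := fun z hz =>
    norm_fderiv_fderiv_le_sphereHessianBound S.contDiffOn_mean hz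
  have hρ0 : 0 ≤ ρ :=
    (norm_nonneg _).trans (S.norm_gradient_meanLoss_le hρ hx)
  obtain ⟨c, hc⟩ := S.exists_loss_center hρ hρ0 hx
  have hμmax := S.max_pos hx
  have hμmin := S.min_pos
  obtain rfl : X = fun t ω => clippedSGD L C η lam x₀ (fun s => γ s ω) t :=
    funext fun t => funext fun ω => hX t ω
  set X : ℕ → Ω → EuclideanSpace ℝ (Fin d) :=
    fun t ω => clippedSGD L C η lam x₀ (fun s => γ s ω) t
  have hne : ∀ n ω, X n ω ≠ 0 := fun n ω => S.clippedSGD_ne_zero hα1 hx _ n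
  have hstep : ∀ n ω, X (n + 1) ω = sgdStep L C η lam (X n ω) (γ n ω) :=
    fun n ω => S.clippedSGD_succ hα1 hx _ n
  -- The increments have a bounded range only where the radius is controlled, so Azuma–Hoeffding is
  -- run with the indicator of D. On the event of the radius bounds the indicator is 1 from T' on.
  set D : Set (EuclideanSpace ℝ (Fin d)) := {x | x ≠ 0 ∧ effRadius η lam x ≤
    √2 * √(clippedMeanMax L ν C)}
  have hD : MeasurableSet D :=
    (measurableSet_singleton 0).compl.inter (measurableSet_le measurable_effRadius measurable_const)
  set B := 2 * (√(2 * (η * lam)) * (ρ * (√C * (√2 * √(clippedMeanMax L ν C))))) +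
        8 * (ρ * (η * lam * C) * (√2 * √(clippedMeanMax L ν C)))
  have hB : 0 ≤ B := by positivity
  have hbad₁ := S.measureReal_exists_effRadius_le hx hγ hind hν hθC hδ hδ1 hθ hTT hT'
  have hbad₂ := measureReal_lt_sum_le (Y := X) (y₀ := x₀)
    (Φ := fun (_ : ℕ) (p : EuclideanSpace ℝ (Fin d) × Γ) => sgdStep L C η lam p.1 p.2)
    hγ hind hν (fun _ => measurable_sgdStep S.contDiffOn S.measurable C η lam)
    (fun ω => rfl) hstep (S.measurable_weightedLossIncrement ρ c) hD hB
    (fun y hy => S.weightedLossIncrement_mem_Icc hρ hρ0 hy.1 (hc y hy.1).1 (hc y hy.1).2 hy.2)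
    hTT hδ (by linarith)
  -- The whole space is covered by the good event and two bad ones, of probabilities at most 2δ and
  -- δ.
  have hcover := measureReal_mono (μ := P) (s₁ := Set.univ)
    (s₂ := {ω | (∀ t ∈ Finset.Ico T' T,
        clippedMeanMin L ν C / 2 ≤ effRadius η lam (X t ω) ^ 2 ∧
          effRadius η lam (X t ω) ^ 2 ≤ 2 * clippedMeanMax L ν C) ∧
      1 / ((T : ℝ) - T') * ∑ t ∈ Finset.Ico T' T,
          inner ℝ (gradient (meanLoss L ν) (unitDir (X t ω)))
            (expectedClippedGradient L ν C η lam (X t ω)) ≤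
        Real.pi ^ 2 * ρ * √(clippedMeanMax L ν C) /
            (((T : ℝ) - T') * √(2 * (η * lam)))
        + 4 * √(η * lam) * (ρ * clippedMeanMax L ν C ^ (3 / 2 : ℝ) / clippedMeanMin L ν C)
        + √(Real.log (2 / δ) / ((T : ℝ) - T')) * 8 * (Real.pi * ρ * √C *
            clippedMeanMax L ν C / √(clippedMeanMin L ν C))
        + √(Real.log (2 / δ) / ((T : ℝ) - T')) * 16 * √(η * lam) *
            (C * ρ * clippedMeanMax L ν C ^ (3 / 2 : ℝ) / clippedMeanMin L ν C)} ∪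
      ({ω | ∃ t ∈ Finset.Ico T' T,
        Real.log 2 < Real.log (effRadius η lam (X t ω) ^ 2) - Real.log (clippedMeanMax L ν C) ∨
        Real.log 2 < Real.log (clippedMeanMin L ν C) - Real.log (effRadius η lam (X t ω) ^ 2)} ∪
      {ω | B * √(((T : ℝ) - T') * Real.log (1 / δ)) < ∑ k ∈ Finset.range T, if T' ≤ k then
        D.indicator (fun y => weightedLossIncrement L ν C η lam ρ c y (γ k ω) -
          ∫ g, weightedLossIncrement L ν C η lam ρ c y g ∂ν) (X k ω) else 0})) ?_
  · have h1 := measureReal_union_le (μ := P) _ _ |> hcover.trans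
    have h2 := h1.trans (add_le_add_right (measureReal_union_le (μ := P) _ _) _)
    rw [probReal_univ] at h2
    linarith
  · intro ω _
    by_contra hω
    simp only [Set.mem_union, not_or] at hω
    obtain ⟨hgood, hω₁, hω₂⟩ := hω
    apply hgood
    simp only [Set.mem_ofPred_eq, not_exists, not_and, not_or, not_lt] at hω₁ hω₂
    have hR : ∀ t, 0 < effRadius η lam (X t ω) ^ 2 := fun t =>
      pow_pos (effRadius_pos S.η_pos S.lam_pos (hne t ω)) 2
    have hmax : ∀ t ∈ Finset.Ico T' T,
        effRadius η lam (X t ω) ^ 2 ≤ 2 * clippedMeanMax L ν C := fun t ht =>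
      le_two_mul_of_log_sub_log_le (hR t) hμmax (hω₁ t ht).1
    have hmin : ∀ t ∈ Finset.Ico T' T,
        clippedMeanMin L ν C / 2 ≤ effRadius η lam (X t ω) ^ 2 := fun t ht => by
      have := le_two_mul_of_log_sub_log_le hμmin (hR t) (hω₁ t ht).2
      linarith
    refine ⟨fun t ht => ⟨hmin t ht, hmax t ht⟩, ?_⟩
    refine S.average_inner_le hρ hρ0 hc (fun k => hstep k ω) (fun k => hne k ω) hTT hmin hmax hδ ?_
    rw [sum_range_ite_le] at hω₂
    refine le_trans (le_of_eq (Finset.sum_congr rfl fun k hk => ?_)) hω₂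
    have hmem : X k ω ∈ D := by
      refine ⟨hne k ω, ?_⟩
      rw [← Real.sqrt_mul (by norm_num)]
      exact Real.le_sqrt_of_sq_le (hmax k hk)
    rw [Set.indicator_of_mem hmem]

end ClippedSetting

/-! ### Choice of constants and conclusion -/

theorem theorem4p3 :
    ∃ κ : ℝ, 0 < κ ∧ ∃ K : ℝ, 0 < K ∧
      ∀ (d : ℕ) (Γ : Type*) [MeasurableSpace Γ] (ν : Measure Γ) [IsProbabilityMeasure ν]
        (L : Γ → EuclideanSpace ℝ (Fin d) → ℝ)
        -- each loss is scale invariant and continuously differentiable away from the origin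
        (_ : ∀ γ, ∀ c : ℝ, 0 < c → ∀ x, x ≠ 0 → L γ (c • x) = L γ x)
        (_ : ∀ γ, ContDiffOn ℝ 1 (L γ) {0}ᶜ)
        -- the expected loss exists and is twice continuously differentiable there
        (_ : ∀ x, x ≠ 0 → Measurable (fun γ => L γ x))
        (_ : ∀ x, x ≠ 0 → Integrable (fun γ => L γ x) ν)
        (_ : ContDiffOn ℝ 2 (meanLoss L ν) {0}ᶜ)
        (C α η lam : ℝ) (_ : 1 < C) (_ : 0 < α) (_ : 0 < η) (_ : 0 < lam)
        (_ : ConcentratedFromBelow L ν C α)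
        (μmin μmax ρ : ℝ)
        (_ : μmin = clippedMeanMin L ν C) (_ : μmax = clippedMeanMax L ν C)
        (_ : ρ = sphereHessianBound (meanLoss L ν))
        (_ : 0 < μmin)
        (x₀ : EuclideanSpace ℝ (Fin d)) (_ : x₀ ≠ 0)
        -- i.i.d. samples
        (Ω : Type*) [MeasurableSpace Ω] (P : Measure Ω) [IsProbabilityMeasure P]
        (γ : ℕ → Ω → Γ) (_ : ∀ t, Measurable (γ t)) (_ : iIndepFun γ P)
        (_ : ∀ t, P.map (γ t) = ν)
        (X : ℕ → Ω → EuclideanSpace ℝ (Fin d))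
        (_ : ∀ t ω, X t ω = clippedSGD L C η lam x₀ (fun s => γ s ω) t)
        (δ : ℝ) (_ : 0 < δ) (_ : δ < 1) (T T' : ℕ)
        (_ : η * lam ≤ κ * min 1 (α / (C * Real.log (T / δ ^ 2))))
        (_ : T' = ⌈(max (Real.log ((2 * lam / η * ‖x₀‖ ^ 4) / μmax))
            (Real.log (μmin / (2 * lam / η * ‖x₀‖ ^ 4))) + K) / (α * (η * lam))⌉₊)
        (_ : T' < T),
        1 - 5 * δ ≤ P.real {ω |
          (∀ t : ℕ, T' ≤ t → t ≤ T - 1 →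
            μmin / 2 ≤ 2 * lam / η * ‖X t ω‖ ^ 4 ∧ 2 * lam / η * ‖X t ω‖ ^ 4 ≤ 2 * μmax) ∧
          1 / ((T : ℝ) - T') * ∑ t ∈ Finset.Ico T' T,
              inner ℝ (gradient (meanLoss L ν) (unitDir (X t ω)))
                (expectedClippedGradient L ν C η lam (X t ω)) ≤
            Real.pi ^ 2 * ρ * √μmax / (((T : ℝ) - T') * √(2 * (η * lam)))
            + 4 * √(η * lam) * (ρ * μmax ^ (3 / 2 : ℝ) / μmin)
            + √(Real.log (2 / δ) / ((T : ℝ) - T')) * 8 * (Real.pi * ρ * √C * μmax / √μmin)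
            + √(Real.log (2 / δ) / ((T : ℝ) - T')) * 16 * √(η * lam) *
                (C * ρ * μmax ^ (3 / 2 : ℝ) / μmin)} := by
  refine ⟨1 / 1000000, by norm_num, 1, one_pos, ?_⟩
  intro d Γ _ ν _ L hinv hdiff hmeas _ hmean C α η lam hC hα hη hlam hconc μmin μmax ρ
    hμmin hμmax hρ hpos x₀ hx Ω _ P _ γ hγ hind hν X hX δ hδ _ T T' hεκ hT' hTT
  subst hμmin hμmax hρ
  -- For δ ≥ 1/5 the claimed probability is nonpositive. Otherwise T/δ² ≥ 25 > e, so the logarithm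
  -- is at least 1 and the step-size hypothesis also yields the condition without it.
  rcases le_or_gt (1 / 5) δ with h5 | h5
  · exact le_trans (by linarith) measureReal_nonneg
  have hε : 0 < η * lam := mul_pos hη hlam
  have hC0 : 0 < C := by linarith
  have hlog := one_le_log_div_sq hδ h5 (T := T) (by exact_mod_cast (by omega : 1 ≤ T))
  set ℓ := Real.log (T / δ ^ 2)
  have hεℓ : 1000000 * (η * lam * C) * ℓ ≤ α := by
    have h1 : η * lam ≤ 1 / 1000000 * (α / (C * ℓ)) :=
      hεκ.trans (mul_le_mul_of_nonneg_left (min_le_right _ _) (by norm_num))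
    rw [mul_div_assoc', le_div_iff₀ (by positivity)] at h1
    linarith
  have hεC : 0 < η * lam * C := mul_pos hε hC0
  have S : ClippedSetting L ν C α η lam :=
    ⟨hinv, hdiff, hmeas, hmean, hC, hα, hη, hlam, hconc, hpos, by nlinarith⟩
  -- The exponent θ = α/(160εC) is the one fixed by the drift estimates; the step-size hypothesis
  -- makes it at least 10 ln(T/δ²) with room to spare.
  have hθC : 160 * (η * lam * (α / (160 * (η * lam * C))) * C) = α := by
    field_simp
  have hθ : 10 * ℓ ≤ α / (160 * (η * lam * C)) := by
    rw [le_div_iff₀ (by positivity)]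
    have := mul_nonneg hεC.le (by linarith : 0 ≤ ℓ)
    linarith
  have hR0 : 0 < 2 * lam / η * ‖x₀‖ ^ 4 := by
    have := norm_pos_iff.2 hx
    positivity
  have hceil : max (Real.log (effRadius η lam x₀ ^ 2) - Real.log (clippedMeanMax L ν C))
      (Real.log (clippedMeanMin L ν C) - Real.log (effRadius η lam x₀ ^ 2)) + 1 ≤
      T' * (α * (η * lam)) := by
    rw [effRadius_sq hη hlam, ← Real.log_div hR0.ne' (S.max_pos hx).ne',
      ← Real.log_div hpos.ne' hR0.ne', ← div_le_iff₀ (by positivity), hT']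
    exact Nat.le_ceil _
  refine le_trans (by linarith) ((S.high_probability_bounds hx hγ hind hν hθC hδ h5 hθ hTT hceil
    hX).trans (measureReal_mono ?_))
  rintro ω ⟨h1, h2⟩
  refine ⟨fun t ht ht' => ?_, h2⟩
  rw [← effRadius_sq hη hlam]
  exact h1 t (Finset.mem_Ico.2 ⟨ht, by omega⟩)
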